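/- **Setting.** Let $\widetilde G=\langle x_0,\dots,x_6\mid x_ix_{i+1}x_{i+3},\ i\in\mathbb Z/7\rangle$ and let $G\le\widetilde G$ be the subgroup generated by $x_0,x_1,x_3$. The group $\widetilde G$ is represented by infinite upper triangular matrices $(A_{rc})_{r,c\ge 0}$ of $3\times3$ blocks over $\mathbb F_2$ with $A_{r+3,c+3}=A_{rc}$ and $A_{rr}=1$, as follows. Let $\mathbb F_8=\mathbb F_2[t]/(t^3+t+1)$ with basis $1,t^2,t$, let $\sigma$ be a variable with $\sigma b=b^2\sigma$ for $b\in\mathbb F_8$, put $Y=\sigma^3$ and $z=Y/(1+Y)$; the matrix of $x_i$ describes (on row vectors) the map $w\mapsto(1+t^i\sigma)^{-1}\,w\,(1+t^i\sigma)$ in the basis $b\,\sigma^jz^m$ ($b\in\{1,t^2,t\}$, $0\le j\le2$, $m\ge0$), where block row $3m+j$ belongs to $\sigma^jz^m$. For $k\ge 0$ let $G^k\trianglelefteq G$ be the normal subgroup of all elements whose matrices have vanishing first $k$ upper diagonals (that is, $A_{r,r+d}=0$ for all $r$ and $1\le d\le k$), and put $G_k=G/G^k$. The images of $x_0,x_1,x_3$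 in $G_k$ are denoted by the same letters; note that $x_0x_1x_3=1$. Let $k\ge 2$. Let $\mathcal S_0$ be obtained by gluing a white and a black copy of a compact hyperbolic triangle with angles $\pi/\mathrm{ord}(x_0),\pi/\mathrm{ord}(x_1),\pi/\mathrm{ord}(x_3)$ (orders in $G_k$) at its vertices $P_0,P_1,P_2$ along corresponding sides, and let $\gamma_0,\gamma_1,\gamma_2$ be simple loops around $P_0,P_1,P_2$, based at the centre of the white triangle, with $\gamma_0\gamma_1\gamma_2=1$. The surface $\mathcal S_k$ is the branched covering of $\mathcal S_0$ given by the homomorphism $\gamma_0\mapsto x_0,\ \gamma_1\mapsto x_1,\ \gamma_2\mapsto x_3$ from $\pi_1(\mathcal S_0\setminus\{P_0,P_1,P_2\})$ to $G_k$, with the induced metric. Explicitly, it is glued from one white and one black triangle for every $g\in G_k$: the white triangle $g$ is glued along its sides opposite to $P_0,P_1,P_2$ to the corresponding sides of the black triangles $gx_3$, $g$, $gx_0^{-1}$, respectively. The tessellation $T_k\subset\mathcal S_k$ has as vertices the centres of all these triangles; its edges are the geodesic arcs which join the centres of two triangles with a common side through the midpoint of that side; its faces are the connected components of the complement of the union of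 its edges. Let $V_k,E_k,F_k$ be the sets of its vertices, edges and faces. (As a graph, $T_k$ is the $(\Delta\text{-}Y)$-transformation of the Cayley graph of $G_k$ with respect to $x_0^{\pm1},x_1^{\pm1},x_3^{\pm1}$, applied in the triangles $h,\,hx_0,\,hx_0x_1$.) **Proposition.** Let $k\ge2$ and $n_k=\lfloor\log_2k\rfloor+1$. The elements $x_0,x_1,x_3$ of $G_k$ all have order $2^{n_k}$ (so the triangles above are equilateral with angles $\pi/2^{n_k}$), and $G_k$ is a finite $2$-group. Write $|G_k|=2^{N_k}$. Then $\mathcal S_k$ is a closed connected orientable hyperbolic surface, its isometry group has order $\ge2^{N_k}$, and $$|V_k|=2^{N_k+1},\qquad |E_k|=3\cdot2^{N_k},\qquad |F_k|=3\cdot2^{N_k-n_k}.$$ All faces of $T_k\subset\mathcal S_k$ are regular hyperbolic $2^{n_k+1}$-gons with interior angles $2\pi/3$, and the genus of $\mathcal S_k$ is $$g(\mathcal S_k)=1+2^{N_k-n_k-1}\,(2^{n_k}-3).$$ -/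

import Mathlib

namespace TrivalentExpanders

open UpperHalfPlane MatrixGroups

/-! ## The groups -/

section Groups

/-- `3 × 3` matrices over the field with two elements. -/
abbrev Block : Type := Matrix (Fin 3) (Fin 3) (ZMod 2)

/-- Infinite upper triangular matrices (rows and columns indexed by `ℕ`) of `3 × 3` blocks; the
product in the incidence algebra of `ℕ` is the usual matrix product. -/
abbrev UpperTriangular : Type := IncidenceAlgebra Block ℕ

/-- The infinite upper triangular matrix whose `d`-th upper diagonal is the sequence
`a d 0, a d 1, a d 2, a d 0, a d 1, a d 2, …`, of period three. -/
def bandMatrix (a : ℕ → ZMod 3 → Block) : UpperTriangular where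
  toFun r c := if r ≤ c then a (c - r) (r : ZMod 3) else 0
  eq_zero_of_not_le' _ _ h := if_neg h

/-- The upper diagonals of a product of two periodic matrices. -/
def conv (a b : ℕ → ZMod 3 → Block) (d : ℕ) (j : ZMod 3) : Block :=
  ∑ p ∈ Finset.range (d + 1), a p j * b (d - p) (j + (p : ZMod 3))

theorem bandMatrix_mul (a b : ℕ → ZMod 3 → Block) :
    bandMatrix a * bandMatrix b = bandMatrix (conv a b) := by
  refine IncidenceAlgebra.ext fun r c hrc => ?_
  obtain ⟨d, rfl⟩ := Nat.exists_eq_add_of_le hrc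
  rw [IncidenceAlgebra.mul_apply]
  simp only [bandMatrix, conv, IncidenceAlgebra.coe_mk]
  rw [← Finset.Ico_add_one_right_eq_Icc r (r + d), Finset.sum_Ico_eq_sum_range]
  have e : r + d + 1 - r = d + 1 := by omega
  rw [e, if_pos (by omega), show r + d - r = d by omega]
  refine Finset.sum_congr rfl fun p hp => ?_
  have hp' : p ≤ d := by simpa [Nat.lt_succ_iff] using hp
  rw [if_pos (by omega), if_pos (by omega), show r + p - r = p by omega,
    show r + d - (r + p) = d - p by omega]
  push_cast
  rfl

theorem bandMatrix_one :
    bandMatrix (fun d _ => if d = 0 then 1 else 0) = 1 := by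
  refine IncidenceAlgebra.ext fun r c hrc => ?_
  simp only [bandMatrix, IncidenceAlgebra.coe_mk, IncidenceAlgebra.one_apply, if_pos hrc]
  by_cases h : r = c
  · simp [h]
  · rw [if_neg (by omega), if_neg h]

theorem conv_eq_zero {a b : ℕ → ZMod 3 → Block} (ha : ∀ d, 5 < d → ∀ j, a d j = 0)
    (hb : ∀ d, 5 < d → ∀ j, b d j = 0) (d : ℕ) (hd : 10 < d) (j : ZMod 3) :
    conv a b d j = 0 := by
  refine Finset.sum_eq_zero fun p _ => ?_
  rcases Nat.lt_or_ge 5 p with h | h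
  · rw [ha p h, zero_mul]
  · rw [hb (d - p) (by omega), mul_zero]

/-- Multiplication by `t` on the field `𝔽₈ = 𝔽₂[t]/(t³ + t + 1)` in the basis `1, t², t`
(all linear maps act on row vectors). -/
def zetaMat : Block := !![0, 0, 1; 1, 0, 1; 0, 1, 0]

/-- The Frobenius map `b ↦ b²` of `𝔽₈` in the basis `1, t², t`. -/
def frobMat : Block := !![1, 0, 0; 0, 1, 1; 0, 1, 0]

/-- Multiplication by the powers of `t`, an element of order seven. -/
def zetaPow (e : ZMod 7) : Block := zetaMat ^ e.val

/- The representation. Let `φ` be the Frobenius map of `𝔽₈`, and consider the algebra of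
polynomials in `σ` over `𝔽₈` with `σ b = φ(b) σ`, whose centre contains `Y = σ³`. The elements
`1 + tⁱ σ` satisfy `(1 + tⁱσ)(1 + tⁱ⁺¹σ)(1 + tⁱ⁺³σ) = 1 + Y`, so that conjugation
`w ↦ (1 + tⁱσ)⁻¹ w (1 + tⁱσ)` gives a representation of the group with generators `x₀, …, x₆` and
relators `xᵢ xᵢ₊₁ xᵢ₊₃`. Put `z = Y / (1 + Y)`. In the basis `b σʲ zᵐ` with `j = 0, 1, 2` and
`m ≥ 0` (block row `3 m + j`), conjugation by `1 + σ` is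
`w ↦ (1 + z) (1 + σ + σ²) w (1 + σ)`, and `(1 + z) σ³ = z`; this gives the matrix of `x₀`.
Conjugation by `tⁱ` is diagonal and takes `1 + σ` to `1 + tⁱ σ`. -/

/-- Passing from coefficients with respect to powers of `σ` to the basis `b σʲ zᵐ`. -/
def foldCoeff (c : ℕ → Block) (d : ℕ) (j : ZMod 3) : Block :=
  c d + if 3 ≤ d ∧ d + j.val ≤ 5 then c (d - 3) else 0

/-- The upper diagonals of the matrix of `x₀`, that is, of `w ↦ (1 + σ)⁻¹ w (1 + σ)`. -/
def baseCoeff : ℕ → ZMod 3 → Block :=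
  foldCoeff fun d => match d with
    | 0 => 1
    | 1 => frobMat + 1
    | 2 => frobMat ^ 2 + frobMat
    | 3 => frobMat ^ 2
    | _ => 0

/-- The upper diagonals of the inverse, that is, of `w ↦ (1 + σ) w (1 + σ)⁻¹`. -/
def baseInvCoeff : ℕ → ZMod 3 → Block :=
  foldCoeff fun d => match d with
    | 0 => 1
    | 1 => frobMat + 1
    | 2 => frobMat + 1
    | 3 => frobMat
    | _ => 0

/-- The diagonal matrix of `w ↦ t⁻ⁱ w tⁱ`. -/
def twistCoeff (i : ZMod 7) (d : ℕ) (j : ZMod 3) : Block :=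
  if d = 0 then zetaPow ((2 ^ j.val - 1) * i) else 0

/-- The upper diagonals after conjugation by the diagonal matrix of `w ↦ t⁻ⁱ w tⁱ`. -/
def conjCoeff (i : ZMod 7) (a : ℕ → ZMod 3 → Block) (d : ℕ) (j : ZMod 3) : Block :=
  zetaPow ((2 ^ j.val - 1) * -i) * a d j *
    zetaPow ((2 ^ (j + (d : ZMod 3)).val - 1) * i)

theorem foldCoeff_eq_zero {c : ℕ → Block} (hc : ∀ d, 3 < d → c d = 0) (d : ℕ) (hd : 5 < d)
    (j : ZMod 3) : foldCoeff c d j = 0 := by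
  unfold foldCoeff
  rw [hc d (by omega), if_neg (by omega), add_zero]

theorem baseCoeff_eq_zero (d : ℕ) (hd : 5 < d) (j : ZMod 3) : baseCoeff d j = 0 :=
  foldCoeff_eq_zero (fun d hd => by
    obtain ⟨e, rfl⟩ : ∃ e, d = e + 4 := ⟨d - 4, by omega⟩
    rfl) d hd j

theorem baseInvCoeff_eq_zero (d : ℕ) (hd : 5 < d) (j : ZMod 3) : baseInvCoeff d j = 0 :=
  foldCoeff_eq_zero (fun d hd => by
    obtain ⟨e, rfl⟩ : ∃ e, d = e + 4 := ⟨d - 4, by omega⟩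
    rfl) d hd j

theorem conjCoeff_eq_zero {a : ℕ → ZMod 3 → Block} (ha : ∀ d, 5 < d → ∀ j, a d j = 0)
    (i : ZMod 7) (d : ℕ) (hd : 5 < d) (j : ZMod 3) : conjCoeff i a d j = 0 := by
  unfold conjCoeff
  rw [ha d hd, mul_zero, zero_mul]

theorem twist_mul_left (i : ZMod 7) (a : ℕ → ZMod 3 → Block) :
    conv (twistCoeff i) a = fun d j => zetaPow ((2 ^ j.val - 1) * i) * a d j := by
  funext d j
  unfold conv
  rw [Finset.sum_eq_single 0]
  · simp [twistCoeff]
  · intro p _ hp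
    simp [twistCoeff, hp]
  · simp

theorem twist_mul_right (i : ZMod 7) (a : ℕ → ZMod 3 → Block) :
    conv a (twistCoeff i) =
      fun d j => a d j * zetaPow ((2 ^ (j + (d : ZMod 3)).val - 1) * i) := by
  funext d j
  unfold conv
  rw [Finset.sum_eq_single d]
  · simp [twistCoeff]
  · intro p hp hpd
    have : d - p ≠ 0 := by
      have := Finset.mem_range.1 hp
      omega
    simp [twistCoeff, this]
  · simp

theorem zetaPow_mul : ∀ a b : ZMod 7, zetaPow a * zetaPow b = zetaPow (a + b) := by
  decide +kernel

theorem bandMatrix_twist_mul (i i' : ZMod 7) :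
    bandMatrix (twistCoeff i) * bandMatrix (twistCoeff i') = bandMatrix (twistCoeff (i + i')) := by
  rw [bandMatrix_mul, twist_mul_left]
  congr 1
  funext d j
  by_cases h : d = 0
  · simp [twistCoeff, h, zetaPow_mul, mul_add]
  · simp [twistCoeff, h]

theorem bandMatrix_twist_zero : bandMatrix (twistCoeff 0) = 1 := by
  rw [← bandMatrix_one]
  refine congrArg bandMatrix ?_
  funext d j
  simp [twistCoeff, zetaPow]

/-- The matrix of `w ↦ t⁻ⁱ w tⁱ`, as a unit. -/
def twistUnit (i : ZMod 7) : UpperTriangularˣ where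
  val := bandMatrix (twistCoeff i)
  inv := bandMatrix (twistCoeff (-i))
  val_inv := by rw [bandMatrix_twist_mul, add_neg_cancel, bandMatrix_twist_zero]
  inv_val := by rw [bandMatrix_twist_mul, neg_add_cancel, bandMatrix_twist_zero]

theorem twistUnit_add (i i' : ZMod 7) : twistUnit (i + i') = twistUnit i * twistUnit i' :=
  Units.ext (bandMatrix_twist_mul i i').symm

set_option maxRecDepth 100000 in
theorem base_mul_inv_aux : ∀ d < 11, ∀ j : ZMod 3,
    conv baseCoeff baseInvCoeff d j = if d = 0 then 1 else 0 := by
  decide +kernel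

set_option maxRecDepth 100000 in
theorem base_inv_mul_aux : ∀ d < 11, ∀ j : ZMod 3,
    conv baseInvCoeff baseCoeff d j = if d = 0 then 1 else 0 := by
  decide +kernel

set_option maxRecDepth 100000 in
theorem base_relation_aux : ∀ d < 11, ∀ j : ZMod 3,
    conv baseCoeff (conjCoeff 1 baseCoeff) d j = conjCoeff 3 baseInvCoeff d j := by
  decide +kernel

/-- The matrix of `x₀`, as a unit. -/
def baseUnit : UpperTriangularˣ where
  val := bandMatrix baseCoeff
  inv := bandMatrix baseInvCoeff
  val_inv := by
    rw [bandMatrix_mul, ← bandMatrix_one]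
    congr 1
    funext d j
    rcases Nat.lt_or_ge d 11 with h | h
    · exact base_mul_inv_aux d h j
    · rw [conv_eq_zero baseCoeff_eq_zero baseInvCoeff_eq_zero d (by omega), if_neg (by omega)]
  inv_val := by
    rw [bandMatrix_mul, ← bandMatrix_one]
    congr 1
    funext d j
    rcases Nat.lt_or_ge d 11 with h | h
    · exact base_inv_mul_aux d h j
    · rw [conv_eq_zero baseInvCoeff_eq_zero baseCoeff_eq_zero d (by omega), if_neg (by omega)]

/-- The matrix of the generator `xᵢ`. -/
def genUnit (i : ZMod 7) : UpperTriangularˣ := (twistUnit i)⁻¹ * baseUnit * twistUnit i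

theorem conj_bandMatrix (i : ZMod 7) (a : ℕ → ZMod 3 → Block) :
    bandMatrix (twistCoeff (-i)) * bandMatrix a * bandMatrix (twistCoeff i) =
      bandMatrix (conjCoeff i a) := by
  rw [bandMatrix_mul, twist_mul_left, bandMatrix_mul, twist_mul_right]
  rfl

theorem genUnit_val (i : ZMod 7) :
    (genUnit i : UpperTriangular) = bandMatrix (conjCoeff i baseCoeff) :=
  conj_bandMatrix i baseCoeff

/-- The three periodic entries of the first upper diagonals of `x₀`, `x₁` and `x₃`. -/
theorem first_diagonals :
    (∀ j, conjCoeff 0 baseCoeff 1 j = !![0, 0, 0; 0, 0, 1; 0, 1, 1]) ∧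
    (conjCoeff 1 baseCoeff 1 0 = !![0, 0, 0; 0, 1, 0; 1, 1, 1] ∧
      conjCoeff 1 baseCoeff 1 1 = !![0, 1, 1; 1, 0, 0; 0, 0, 0] ∧
      conjCoeff 1 baseCoeff 1 2 = !![0, 1, 0; 0, 0, 1; 0, 1, 0]) ∧
    (conjCoeff 3 baseCoeff 1 0 = !![0, 0, 0; 0, 1, 1; 1, 0, 0] ∧
      conjCoeff 3 baseCoeff 1 1 = !![0, 1, 1; 1, 0, 1; 0, 1, 1] ∧
      conjCoeff 3 baseCoeff 1 2 = !![0, 1, 0; 0, 0, 0; 0, 0, 1]) := by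
  decide +kernel

theorem base_relation : baseUnit * genUnit 1 * genUnit 3 = 1 := by
  have h : baseUnit * genUnit 1 = (twistUnit 3)⁻¹ * baseUnit⁻¹ * twistUnit 3 := by
    apply Units.ext
    have hl : ((baseUnit * genUnit 1 : UpperTriangularˣ) : UpperTriangular) =
        bandMatrix (conv baseCoeff (conjCoeff 1 baseCoeff)) := by
      rw [Units.val_mul, genUnit_val, ← bandMatrix_mul]
      rfl
    have hr : (((twistUnit 3)⁻¹ * baseUnit⁻¹ * twistUnit 3 : UpperTriangularˣ) :
        UpperTriangular) = bandMatrix (conjCoeff 3 baseInvCoeff) :=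
      conj_bandMatrix 3 baseInvCoeff
    rw [hl, hr]
    congr 1
    funext d j
    rcases Nat.lt_or_ge d 11 with h | h
    · exact base_relation_aux d h j
    · rw [conv_eq_zero baseCoeff_eq_zero (conjCoeff_eq_zero baseCoeff_eq_zero 1) d (by omega),
        conjCoeff_eq_zero baseInvCoeff_eq_zero 3 d (by omega)]
  rw [h, genUnit]
  group

/-- The relators `xᵢ xᵢ₊₁ xᵢ₊₃`, with indices modulo seven. -/
def relators : Set (FreeGroup (ZMod 7)) :=
  Set.range fun i => FreeGroup.of i * FreeGroup.of (i + 1) * FreeGroup.of (i + 3)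

/-- The group with generators `x₀, …, x₆` and relators `xᵢ xᵢ₊₁ xᵢ₊₃`. -/
abbrev BigGroup : Type := PresentedGroup relators

theorem genUnit_relation :
    ∀ r ∈ relators, FreeGroup.lift genUnit r = 1 := by
  rintro _ ⟨i, rfl⟩
  simp only [map_mul, FreeGroup.lift_apply_of]
  have h := base_relation
  have h1 : genUnit (i + 1) = (twistUnit i)⁻¹ * genUnit 1 * twistUnit i := by
    rw [add_comm]
    simp only [genUnit, twistUnit_add]
    group
  have h3 : genUnit (i + 3) = (twistUnit i)⁻¹ * genUnit 3 * twistUnit i := by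
    rw [add_comm]
    simp only [genUnit, twistUnit_add]
    group
  rw [h1, h3]
  calc genUnit i * ((twistUnit i)⁻¹ * genUnit 1 * twistUnit i) *
        ((twistUnit i)⁻¹ * genUnit 3 * twistUnit i)
      = (twistUnit i)⁻¹ * (baseUnit * genUnit 1 * genUnit 3) * twistUnit i := by
        rw [show genUnit i = (twistUnit i)⁻¹ * baseUnit * twistUnit i from rfl]
        group
    _ = 1 := by rw [h]; group

/-- The representation by infinite upper triangular matrices. -/
noncomputable def rep : BigGroup →* UpperTriangularˣ := PresentedGroup.toGroup genUnit_relation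

/-- The subgroup generated by `x₀, x₁, x₃`. -/
def G : Subgroup BigGroup :=
  Subgroup.closure {PresentedGroup.of 0, PresentedGroup.of 1, PresentedGroup.of 3}

theorem rep_diagonal (g : BigGroup) (r : ℕ) : (rep g : UpperTriangular) r r = 1 := by
  let f : UpperTriangular →* Block :=
    { toFun := fun M => M r r
      map_one' := by simp
      map_mul' := fun M N => by simp }
  have h : (Units.map f).comp rep = 1 := by
    refine PresentedGroup.ext fun i => Units.ext ?_
    have : rep (PresentedGroup.of i) = genUnit i := PresentedGroup.toGroup.of _
    rw [MonoidHom.comp_apply, this, Units.coe_map, genUnit_val]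
    change bandMatrix _ r r = 1
    have h0 : ∀ (i : ZMod 7) (j : ZMod 3), conjCoeff i baseCoeff 0 j = 1 := by decide +kernel
    simp [bandMatrix, h0]
  have := congrArg Units.val (DFunLike.congr_fun h g)
  exact this

/-- Vanishing of the first `k` upper diagonals. -/
def VanishingDiagonals (k : ℕ) (M : UpperTriangular) : Prop :=
  ∀ r d : ℕ, 1 ≤ d → d ≤ k → M r (r + d) = 0

theorem vanishing_iff (k : ℕ) (g : BigGroup) :
    VanishingDiagonals k (rep g) ↔
      ∀ r c : ℕ, c ≤ r + k → ((rep g : UpperTriangular) - 1) r c = 0 := by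
  constructor
  · intro h r c hc
    rw [IncidenceAlgebra.sub_apply, IncidenceAlgebra.one_apply]
    rcases lt_trichotomy r c with hlt | rfl | hgt
    · obtain ⟨d, rfl⟩ := Nat.exists_eq_add_of_le hlt.le
      rw [h r d (by omega) (by omega), if_neg (by omega), sub_zero]
    · rw [rep_diagonal, if_pos rfl, sub_self]
    · rw [IncidenceAlgebra.apply_eq_zero_of_not_le (by omega), if_neg (by omega), sub_zero]
  · intro h r d h1 h2
    have := h r (r + d) (by omega)
    rwa [IncidenceAlgebra.sub_apply, IncidenceAlgebra.one_apply, if_neg (by omega), sub_zero]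
      at this

theorem ideal_left {k : ℕ} {M : UpperTriangular} (h : ∀ r c : ℕ, c ≤ r + k → M r c = 0)
    (A : UpperTriangular) (r c : ℕ) (hc : c ≤ r + k) : (A * M) r c = 0 := by
  rw [IncidenceAlgebra.mul_apply]
  refine Finset.sum_eq_zero fun x hx => ?_
  rw [h x c (by have := (Finset.mem_Icc.1 hx).1; omega), mul_zero]

theorem ideal_right {k : ℕ} {M : UpperTriangular} (h : ∀ r c : ℕ, c ≤ r + k → M r c = 0)
    (A : UpperTriangular) (r c : ℕ) (hc : c ≤ r + k) : (M * A) r c = 0 := by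
  rw [IncidenceAlgebra.mul_apply]
  refine Finset.sum_eq_zero fun x hx => ?_
  rw [h r x (by have := (Finset.mem_Icc.1 hx).2; omega), zero_mul]

/-- The subgroup `Gᵏ` of all elements of `G` whose matrices have vanishing first `k` upper
diagonals. -/
def GUpper (k : ℕ) : Subgroup G where
  carrier := {g | VanishingDiagonals k (rep (g : BigGroup))}
  one_mem' := by
    intro r d h1 _
    simp only [OneMemClass.coe_one, map_one, Units.val_one, IncidenceAlgebra.one_apply]
    exact if_neg (by omega)
  mul_mem' := by
    intro a b ha hb
    rw [Set.mem_ofPred_eq, vanishing_iff] at *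
    intro r c hc
    have e : (rep ((a * b : G) : BigGroup) : UpperTriangular) - 1 =
        ((rep (a : BigGroup) : UpperTriangular) - 1) * (rep (b : BigGroup) : UpperTriangular) +
          ((rep (b : BigGroup) : UpperTriangular) - 1) := by
      rw [Subgroup.coe_mul, map_mul, Units.val_mul, sub_mul, one_mul]
      abel
    rw [e, IncidenceAlgebra.add_apply, ideal_right ha _ r c hc, hb r c hc, add_zero]
  inv_mem' := by
    intro a ha
    rw [Set.mem_ofPred_eq, vanishing_iff] at *
    intro r c hc
    have e : (rep ((a⁻¹ : G) : BigGroup) : UpperTriangular) - 1 =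
        (rep ((a⁻¹ : G) : BigGroup) : UpperTriangular) *
          (1 - (rep (a : BigGroup) : UpperTriangular)) := by
      rw [Subgroup.coe_inv, map_inv, mul_sub, Units.inv_mul, mul_one]
    rw [e]
    refine ideal_left (fun r c hc => ?_) _ r c hc
    have := ha r c hc
    rw [IncidenceAlgebra.sub_apply, sub_eq_zero] at this
    rw [IncidenceAlgebra.sub_apply, this, sub_self]

instance (k : ℕ) : (GUpper k).Normal where
  conj_mem a ha g := by
    change VanishingDiagonals k _ at ha
    change VanishingDiagonals k _
    rw [vanishing_iff] at *
    intro r c hc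
    have e : (rep ((g * a * g⁻¹ : G) : BigGroup) : UpperTriangular) - 1 =
        (rep (g : BigGroup) : UpperTriangular) * ((rep (a : BigGroup) : UpperTriangular) - 1) *
          ((rep (g : BigGroup))⁻¹ : UpperTriangularˣ) := by
      rw [mul_sub, sub_mul, mul_one, Units.mul_inv]
      simp
    rw [e]
    exact ideal_right (ideal_left ha _) _ r c hc

/-- The group `G_k = G / Gᵏ`. -/
abbrev GQuot (k : ℕ) : Type := G ⧸ GUpper k

/-- The generators `x₀, x₁, x₃` as elements of `G`, listed as the entries `0, 1, 2`. -/
def genG : ZMod 3 → G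
  | 0 => ⟨PresentedGroup.of 0, Subgroup.subset_closure (by simp)⟩
  | 1 => ⟨PresentedGroup.of 1, Subgroup.subset_closure (by simp)⟩
  | 2 => ⟨PresentedGroup.of 3, Subgroup.subset_closure (by simp)⟩

/-- The images of `x₀, x₁, x₃` in `G_k`, listed as the entries `0, 1, 2`. -/
def gen (k : ℕ) (i : ZMod 3) : GQuot k := QuotientGroup.mk (genG i)

end Groups

/-! ## Hyperbolic geometry in the upper half plane -/

section Hyperbolic

/-- The coordinate of `q` in the Poincaré disc model centred at `p` (a conformal map to the unit
disc taking `p` to `0` and the geodesic rays from `p` to straight rays from `0`). -/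
noncomputable def discCoord (p q : ℍ) : ℂ :=
  ((q : ℂ) - (p : ℂ)) / ((q : ℂ) - (starRingEnd ℂ) (p : ℂ))

/-- The hyperbolic angle at `p` between the geodesic rays towards `q` and `r`. -/
noncomputable def hypAngle (q p r : ℍ) : ℝ :=
  InnerProductGeometry.angle (discCoord p q) (discCoord p r)

/-- The geodesic segment between two points. -/
def hypSegment (a b : ℍ) : Set ℍ := {p | dist a p + dist p b = dist a b}

/-- Geodesically convex sets. -/
def HypConvex (s : Set ℍ) : Prop := ∀ a ∈ s, ∀ b ∈ s, hypSegment a b ⊆ s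

/-- The geodesic convex hull. -/
def hypHull (s : Set ℍ) : Set ℍ := ⋂₀ {t | HypConvex t ∧ s ⊆ t}

/-- The points `v j`, in this cyclic order, are the vertices of a regular hyperbolic `m`-gon with
centre `c` and interior angles `θ`; the polygon itself is `hypHull (Set.range v)`. -/
def IsRegularPolygon {m : ℕ} (c : ℍ) (v : ZMod m → ℍ) (θ : ℝ) : Prop :=
  3 ≤ m ∧
  (∃ ρ α : ℝ, 0 < ρ ∧ ∀ j : ZMod m,
    discCoord c (v j) =
      (ρ : ℂ) * Complex.exp (((α + 2 * Real.pi * (j.val : ℝ) / (m : ℝ) : ℝ) : ℂ) * Complex.I)) ∧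
  ∀ j : ZMod m, hypAngle (v (j - 1)) (v j) (v (j + 1)) = θ

/-- The rotation of the hyperbolic plane about `i` by the angle `2 α`. -/
noncomputable def rotation (α : ℝ) : SL(2, ℝ) :=
  ⟨!![Real.cos α, Real.sin α; -Real.sin α, Real.cos α], by
    rw [Matrix.det_fin_two_of]
    nlinarith [Real.sin_sq_add_cos_sq α]⟩

/-- The circumradius of an equilateral hyperbolic triangle with interior angles `π / n`. -/
noncomputable def circumradius (n : ℕ) : ℝ :=
  Real.arcosh (1 / (Real.sqrt 3 * Real.tan (Real.pi / (2 * n))))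

/-- The vertices of the equilateral hyperbolic triangle with centre `i` and interior angles
`π / n`. -/
noncomputable def triVertex (n : ℕ) (j : ZMod 3) : ℍ :=
  rotation (Real.pi * (j.val : ℝ) / 3) •
    ((⟨Real.exp (circumradius n), Real.exp_pos _⟩ : {x : ℝ // 0 < x}) • UpperHalfPlane.I)

/-- The compact equilateral hyperbolic triangle with centre `i` and interior angles `π / n`. -/
def triangle (n : ℕ) : Set ℍ := hypHull (Set.range (triVertex n))

/-- The side opposite to the `i`-th vertex. -/
def triSide (n : ℕ) (i : ZMod 3) : Set ℍ :=
  hypSegment (triVertex n (i + 1)) (triVertex n (i + 2))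

/-- The geodesic segment from the centre of the triangle to the midpoint of the `i`-th side. -/
def triSpoke (n : ℕ) (i : ZMod 3) : Set ℍ :=
  {p | ∃ m ∈ triSide n i, dist m (triVertex n (i + 1)) = dist m (triVertex n (i + 2)) ∧
    p ∈ hypSegment UpperHalfPlane.I m}

end Hyperbolic

/-! ## The branched covering surface -/

section Surface

open scoped ENNReal

/-- The two colours of triangles. -/
inductive Colour : Type
  | white
  | black

variable {Γ : Type} [Group Γ]

/-- Let `S₀` be the union of a white and a black triangle, glued along corresponding sides, and
`γ_i` (`i = 0, 1, 2`) the loops around its vertices `P_i`, based in the white triangle, such that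
`γ₀` leaves the white triangle through side `1` and returns through side `2`, `γ₁` leaves through
`2` and returns through `0`, and `γ₂` leaves through `0` and returns through `1`, whence
`γ₀ γ₁ γ₂ = 1`. In the branched covering given by `γ_i ↦ x i` (where `x 0 * x 1 * x 2 = 1`), the
white triangle with label `g` and the black triangle with label `g * crossing x i` share their
`i`-th sides; the black labels are such that side `1` joins equal labels. -/
def crossing (x : ZMod 3 → Γ) : ZMod 3 → Γ
  | 0 => x 2
  | 1 => 1
  | 2 => (x 0)⁻¹

/-- The identification of the points on the sides of the triangles. -/
inductive Glue (x : ZMod 3 → Γ) (n : ℕ) :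
    Γ × Colour × triangle n → Γ × Colour × triangle n → Prop
  | side (g : Γ) (i : ZMod 3) (p : triangle n) (hp : (p : ℍ) ∈ triSide n i) :
      Glue x n (g, Colour.white, p) (g * crossing x i, Colour.black, p)

/-- The surface glued from white and black triangles with interior angles `π / n`, one of each
colour for each element of the group, which is the branched covering of `S₀` given by
`γ_i ↦ x i`. -/
def GluedSurface (x : ZMod 3 → Γ) (n : ℕ) : Type := Quot (Glue x n)

variable (x : ZMod 3 → Γ) (n : ℕ)

/-- The point of the surface given by a point of one of the triangles. -/
def GluedSurface.mk (g : Γ) (c : Colour) (p : triangle n) : GluedSurface x n :=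
  Quot.mk _ (g, c, p)

/-- `IsChain a b ℓ`: there is a chain of total length `ℓ` from `a` to `b`, every step of which
stays in one of the triangles and is measured there by the hyperbolic distance. -/
inductive IsChain : GluedSurface x n → GluedSurface x n → ℝ≥0∞ → Prop
  | nil (a : GluedSurface x n) : IsChain a a 0
  | cons (g : Γ) (c : Colour) (p q : triangle n) {b : GluedSurface x n} {ℓ : ℝ≥0∞}
      (h : IsChain (GluedSurface.mk x n g c q) b ℓ) :
      IsChain (GluedSurface.mk x n g c p) b (edist p q + ℓ)

variable {x n}

theorem IsChain.trans {a b c : GluedSurface x n} {ℓ ℓ' : ℝ≥0∞} (h : IsChain x n a b ℓ)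
    (h' : IsChain x n b c ℓ') : IsChain x n a c (ℓ + ℓ') := by
  induction h with
  | nil a => simpa using h'
  | cons g col p q _ ih =>
    rw [add_assoc]
    exact IsChain.cons g col p q (ih h')

theorem IsChain.symm {a b : GluedSurface x n} {ℓ : ℝ≥0∞} (h : IsChain x n a b ℓ) :
    IsChain x n b a ℓ := by
  induction h with
  | nil a => exact IsChain.nil a
  | cons g col p q _ ih =>
    have := ih.trans (IsChain.cons g col q p (IsChain.nil _))
    rwa [add_zero, add_comm, edist_comm] at this

/-- The quotient metric: the distance is the infimum of the lengths of chains. -/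
noncomputable instance : PseudoEMetricSpace (GluedSurface x n) where
  edist a b := ⨅ (ℓ : ℝ≥0∞) (_ : IsChain x n a b ℓ), ℓ
  edist_self a := le_antisymm (iInf₂_le 0 (IsChain.nil a)) zero_le
  edist_comm a b := le_antisymm
    (le_iInf₂ fun ℓ h => iInf₂_le ℓ h.symm) (le_iInf₂ fun ℓ h => iInf₂_le ℓ h.symm)
  edist_triangle a b c := by
    simp only [ENNReal.iInf_add, ENNReal.add_iInf]
    exact le_iInf₂ fun ℓ' h' => le_iInf₂ fun ℓ h => iInf₂_le (ℓ + ℓ') (h.trans h')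

variable (x n)

/-- The vertices of the tessellation: the centres of all triangles. The white triangle with label
`g` stands for the vertex `g` of the Cayley graph with respect to `x 0`, `x 1`, `x 2`; its edges
lead from `g` to `g * x i`. The black triangle with label `h` is adjacent to the white triangles
with labels `h`, `h * x 0` and `h * x 0 * x 1`, and stands for the new vertex which the
`(Δ-Y)`-transformation puts into this triangle of the Cayley graph. -/
def tessVertices : Set (GluedSurface x n) :=
  {s | ∃ (g : Γ) (c : Colour) (p : triangle n),
    (p : ℍ) = UpperHalfPlane.I ∧ s = GluedSurface.mk x n g c p}

/-- The edge through the `i`-th side of the white triangle with label `g`: the geodesic arc which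
joins the centres of this triangle and of its black neighbour through the midpoint of the side. -/
def tessEdge (g : Γ) (i : ZMod 3) : Set (GluedSurface x n) :=
  {s | ∃ p : triangle n, (p : ℍ) ∈ triSpoke n i ∧
    (s = GluedSurface.mk x n g Colour.white p ∨
      s = GluedSurface.mk x n (g * crossing x i) Colour.black p)}

/-- The edges of the tessellation. -/
def tessEdges : Set (Set (GluedSurface x n)) := {e | ∃ g i, e = tessEdge x n g i}

/-- The faces of the tessellation: the connected components of the complement of its edges. -/
def tessFaces : Set (Set (GluedSurface x n)) :=
  {f | ∃ s ∈ (⋃₀ tessEdges x n)ᶜ, f = connectedComponentIn (⋃₀ tessEdges x n)ᶜ s}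

end Surface

/-! ## Surfaces and tessellations -/

section Topology

open Topology Filter

/-- A closed (compact, connected, without boundary), orientable hyperbolic surface: a compact
connected Hausdorff space with an atlas of distance-preserving charts into the hyperbolic plane
whose changes of coordinates are orientation-preserving isometries of the hyperbolic plane. -/
def IsClosedOrientableHyperbolicSurface (X : Type) [PseudoEMetricSpace X] : Prop :=
  CompactSpace X ∧ ConnectedSpace X ∧ T2Space X ∧
  ∃ A : Set (OpenPartialHomeomorph X ℍ),
    (∀ s : X, ∃ e ∈ A, s ∈ e.source) ∧
    (∀ e ∈ A, ∀ s ∈ e.source, ∀ t ∈ e.source, edist (e s) (e t) = edist s t) ∧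
    ∀ e ∈ A, ∀ e' ∈ A, ∀ s ∈ e.source ∩ e'.source,
      ∃ g : SL(2, ℝ), ∀ᶠ t in 𝓝 s, e' t = g • e t

/-- The closed orientable surface `X` has genus `g`: it has a finite (two-dimensional) CW structure
with Euler characteristic `2 - 2 g`. -/
def HasGenus (X : Type) [TopologicalSpace X] (g : ℕ) : Prop :=
  ∃ C : Topology.CWComplex (Set.univ : Set X),
    (∀ d, Finite (C.cell d)) ∧ (∀ d, 2 < d → IsEmpty (C.cell d)) ∧
    (Nat.card (C.cell 0) : ℤ) - Nat.card (C.cell 1) + Nat.card (C.cell 2) = 2 - 2 * (g : ℤ)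

/-- The face `f` of a tessellation with vertices `V` and edges `E` is a regular hyperbolic `m`-gon
with interior angles `θ`: there are a regular hyperbolic polygon and a locally distance-preserving
map from it to the surface which takes its interior bijectively to `f`, its vertices to vertices of
the tessellation and each of its sides bijectively to an edge of the tessellation. -/
def IsRegularFace {X : Type} [PseudoEMetricSpace X] (V : Set X) (E : Set (Set X)) (f : Set X)
    (m : ℕ) (θ : ℝ) : Prop :=
  ∃ (c : ℍ) (v : ZMod m → ℍ) (φ : ℍ → X), IsRegularPolygon c v θ ∧
    (∀ p ∈ hypHull (Set.range v), ∃ U ∈ 𝓝 p, ∀ q ∈ U ∩ hypHull (Set.range v),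
      ∀ r ∈ U ∩ hypHull (Set.range v), edist (φ q) (φ r) = edist q r) ∧
    Set.BijOn φ (interior (hypHull (Set.range v))) f ∧
    ∀ j : ZMod m, φ (v j) ∈ V ∧ ∃ e ∈ E, Set.BijOn φ (hypSegment (v j) (v (j + 1))) e

end Topology

/-! ## The surfaces and the tessellations of the groups `G_k` -/

/-- The surface `S_k`, the branched covering of the orbifold of two triangles with interior angles
`π / ord x₀ = π / ord x₁ = π / ord x₃` given by `γ₀ ↦ x₀`, `γ₁ ↦ x₁`, `γ₂ ↦ x₃`. -/
abbrev Surf (k : ℕ) : Type := GluedSurface (gen k) (orderOf (gen k 0))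

/-- The vertices of the tessellation `T_k` of `S_k`. -/
abbrev V (k : ℕ) : Set (Surf k) := tessVertices (gen k) (orderOf (gen k 0))

/-- The edges of the tessellation `T_k` of `S_k`. -/
abbrev E (k : ℕ) : Set (Set (Surf k)) := tessEdges (gen k) (orderOf (gen k 0))

/-- The faces of the tessellation `T_k` of `S_k`. -/
abbrev F (k : ℕ) : Set (Set (Surf k)) := tessFaces (gen k) (orderOf (gen k 0))

end TrivalentExpanders

/-!
In characteristic two `(1 + N) ^ (2 ^ a) = 1 + N ^ (2 ^ a)`, where `1 + N` is the matrix of `x₀`,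
and the first upper diagonal of `N` consists of copies of one block that is not nilpotent. So the
first nonzero diagonal of `(1 + N) ^ (2 ^ a) - 1` is the one of index `2 ^ a`; as `x₁` and `x₃` are
represented by conjugates of this matrix, the orders in `G_k` are the smallest power of two
exceeding `k` (`orderOf_gen`). The group `G_k` is a finite `2`-group because its elements are
determined by finitely many blocks, and it is not generated by `x₀`, whence its order exceeds theirs
(`exists_card_GQuot`).

The rest holds for every finite group with generators `x 0`, `x 1`, `x 2` of the same order `n ≥ 4`
and product one (`IsTriangleSystem`). The hyperbolic plane is treated by means of the hyperboloid
coordinates `hypTime`, `hypFst`, `hypSnd` and of the Klein model `klein`, in which geodesic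
segments, convex hulls and half planes are the Euclidean ones; the triangle is described by three
homogeneous barycentric coordinates `bary`. Around each vertex, `2 n` copies of the triangle with
angle `π / n` fit together (`place`, `place_eq_place`): they cover a convex open star, in which the
centres of the triangles span a regular `2 n`-gon with interior angles `2 π / 3`
(`isRegularPolygon_face`, `hypHull_faceVertex`). Since `x i` has order exactly `n`, the triangles of
the surface around a vertex are glued in the same cyclic pattern, and this gives a developing map
`star` from the star to the surface. It is injective there (`injOn_star`), chains of short length
lift along it (`exists_lift_chain`), and it does not increase distances as the star is convex
(`edist_star_le`). Therefore it is a local isometry onto an open set (`edist_star_eq`), and its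
local inverses are the charts of the hyperbolic structure. Two charts differ by an
orientation-preserving isometry because adjacent triangles have different colours
(`exists_smul_eq`).

A point of a triangle lies off the edges of the tessellation exactly if one of its barycentric
coordinates exceeds the other two. The points whose largest coordinate belongs to a given vertex of
the surface form the image of the open `2 n`-gon; these sets are disjoint, open and connected, and
so they are the faces (`tessFaces_eq`). They correspond to the cosets of the subgroups generated by
the `x i`, which gives their number. The genus is read off from the triangulation, whose cells are
the cosets, the white sides and the triangles (`hasGenus`).
-/


namespace TrivalentExpanders

open UpperHalfPlane MatrixGroups

/-! ### The groups `G_k` -/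

/-- All entries strictly below the `k`-th upper diagonal vanish. -/
def Deep (k : ℕ) (M : UpperTriangular) : Prop := ∀ r c : ℕ, c < r + k → M r c = 0

theorem Deep.mul {a b : ℕ} {M N : UpperTriangular} (hM : Deep a M) (hN : Deep b N) :
    Deep (a + b) (M * N) := by
  intro r c hc
  rw [IncidenceAlgebra.mul_apply]
  refine Finset.sum_eq_zero fun x _ => ?_
  rcases Nat.lt_or_ge x (r + a) with h | h
  · rw [hM r x h, zero_mul]
  · rw [hN x c (by omega), mul_zero]

theorem Deep.mono {a b : ℕ} {M : UpperTriangular} (hM : Deep a M) (h : b ≤ a) : Deep b M :=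
  fun r c hc => hM r c (by omega)

theorem deep_zero (M : UpperTriangular) : Deep 0 M := fun _ _ hc =>
  IncidenceAlgebra.apply_eq_zero_of_not_le (by omega) _

theorem Deep.mul_left {a : ℕ} {M : UpperTriangular} (hM : Deep a M) (A : UpperTriangular) :
    Deep a (A * M) := by simpa using (deep_zero A).mul hM

theorem Deep.mul_right {a : ℕ} {M : UpperTriangular} (hM : Deep a M) (A : UpperTriangular) :
    Deep a (M * A) := by simpa using hM.mul (deep_zero A)

theorem Deep.mul_apply {a b : ℕ} {M N : UpperTriangular} (hM : Deep a M) (hN : Deep b N) (r : ℕ) :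
    (M * N) r (r + (a + b)) = M r (r + a) * N (r + a) (r + (a + b)) := by
  rw [IncidenceAlgebra.mul_apply]
  refine Finset.sum_eq_single (r + a) (fun x _ hx => ?_) fun h => ?_
  · rcases Nat.lt_or_ge x (r + a) with h | h
    · rw [hM r x h, zero_mul]
    · rw [hN x _ (by omega), mul_zero]
  · exact absurd (Finset.mem_Icc.2 ⟨by omega, by omega⟩) h

theorem upperTriangular_add_self (M : UpperTriangular) : M + M = 0 := by
  refine IncidenceAlgebra.ext fun r c _ => ?_
  rw [IncidenceAlgebra.add_apply, IncidenceAlgebra.zero_apply]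
  ext i j
  exact CharTwo.add_self_eq_zero _

/-- In characteristic two, `A² - 1 = (A - 1)²`. -/
theorem sq_sub_one (A : UpperTriangular) : A * A - 1 = (A - 1) * (A - 1) := by
  have h := upperTriangular_add_self (A - 1)
  calc A * A - 1 = (A - 1) * (A - 1) + ((A - 1) + (A - 1)) := by
        rw [sub_mul, mul_sub, mul_one, one_mul]
        abel
    _ = _ := by rw [h, add_zero]

theorem deep_pow_two_pow {A : UpperTriangular} (hA : Deep 1 (A - 1)) (a : ℕ) :
    Deep (2 ^ a) (A ^ 2 ^ a - 1) := by
  induction a with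
  | zero => simpa using hA
  | succ a ih =>
    rw [pow_succ, pow_mul, pow_two, sq_sub_one, mul_two]
    exact ih.mul ih

/-- The entries of the first upper diagonal of `x₀`. -/
def leadBlock : Block := frobMat + 1

theorem leadBlock_ne_zero : leadBlock ≠ 0 ∧ leadBlock * leadBlock ≠ 0 ∧
    leadBlock * leadBlock * (leadBlock * leadBlock) = leadBlock := by decide +kernel

theorem baseUnit_diag : ∀ r, (baseUnit : UpperTriangular) r r = 1 := by
  intro r
  have h0 : ∀ j : ZMod 3, baseCoeff 0 j = 1 := by decide +kernel
  change bandMatrix baseCoeff r r = 1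
  simp [bandMatrix, h0]

theorem deep_one_of_diag {A : UpperTriangular} (h : ∀ r, A r r = 1) : Deep 1 (A - 1) := by
  intro r c hc
  rw [IncidenceAlgebra.sub_apply, IncidenceAlgebra.one_apply]
  rcases Nat.lt_or_ge c r with h' | h'
  · rw [IncidenceAlgebra.apply_eq_zero_of_not_le (by omega), if_neg (by omega), sub_zero]
  · obtain rfl : r = c := by omega
    simp [h]

theorem baseUnit_lead (a : ℕ) : ∃ Q, (Q = leadBlock ∨ Q = leadBlock * leadBlock) ∧
    ∀ r, ((baseUnit : UpperTriangular) ^ 2 ^ a - 1 : UpperTriangular) r (r + 2 ^ a) = Q := by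
  induction a with
  | zero =>
    refine ⟨leadBlock, Or.inl rfl, fun r => ?_⟩
    have h1 : ∀ j : ZMod 3, baseCoeff 1 j = leadBlock := by decide +kernel
    rw [pow_zero, pow_one, IncidenceAlgebra.sub_apply, IncidenceAlgebra.one_apply,
      if_neg (by omega), sub_zero]
    change bandMatrix baseCoeff r (r + 1) = _
    simp [bandMatrix, h1]
  | succ a ih =>
    obtain ⟨Q, hQ, h⟩ := ih
    have hd := deep_pow_two_pow (deep_one_of_diag baseUnit_diag) a
    refine ⟨Q * Q, ?_, fun r => ?_⟩
    · rcases hQ with rfl | rfl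
      · exact Or.inr rfl
      · exact Or.inl leadBlock_ne_zero.2.2
    · rw [pow_succ, pow_mul, pow_two, sq_sub_one, mul_two, hd.mul_apply hd, h, ← add_assoc, h]

theorem deep_baseUnit_pow_iff (a k : ℕ) :
    Deep (k + 1) ((baseUnit : UpperTriangular) ^ 2 ^ a - 1) ↔ k < 2 ^ a := by
  constructor
  · intro h
    by_contra! hk
    obtain ⟨Q, hQ, hl⟩ := baseUnit_lead a
    have := h 0 (0 + 2 ^ a) (by omega)
    rw [hl] at this
    rcases hQ with rfl | rfl
    · exact leadBlock_ne_zero.1 this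
    · exact leadBlock_ne_zero.2.1 this
  · intro h
    exact (deep_pow_two_pow (deep_one_of_diag baseUnit_diag) a).mono h

theorem deep_conj_iff (u A : UpperTriangularˣ) (k : ℕ) :
    Deep k (((u⁻¹ * A * u : UpperTriangularˣ) : UpperTriangular) - 1) ↔
      Deep k ((A : UpperTriangular) - 1) := by
  constructor
  · intro h
    have := (h.mul_left (u : UpperTriangular)).mul_right ((u⁻¹ : UpperTriangularˣ) : UpperTriangular)
    convert this using 1
    simp [mul_sub, sub_mul, mul_assoc]
  · intro h
    have := (h.mul_left ((u⁻¹ : UpperTriangularˣ) : UpperTriangular)).mul_right (u : UpperTriangular)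
    convert this using 1
    simp [mul_sub, sub_mul, mul_assoc]

theorem genUnit_pow (i : ZMod 7) (p : ℕ) :
    genUnit i ^ p = (twistUnit i)⁻¹ * baseUnit ^ p * twistUnit i := by
  have := conj_pow (i := p) (a := (twistUnit i)⁻¹) (b := baseUnit)
  rw [inv_inv] at this
  exact this

theorem mem_GUpper_iff (k : ℕ) (g : G) :
    g ∈ GUpper k ↔ Deep (k + 1) ((rep (g : BigGroup) : UpperTriangular) - 1) := by
  change VanishingDiagonals k _ ↔ _
  rw [vanishing_iff]
  exact ⟨fun h r c hc => h r c (by omega), fun h r c hc => h r c (by omega)⟩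

theorem rep_of (i : ZMod 7) : rep (PresentedGroup.of i) = genUnit i := PresentedGroup.toGroup.of _

theorem exists_rep_genG (i : ZMod 3) : ∃ j, rep (genG i : BigGroup) = genUnit j := by
  fin_cases i
  exacts [⟨0, rep_of 0⟩, ⟨1, rep_of 1⟩, ⟨3, rep_of 3⟩]

theorem gen_pow_eq_one_iff (k : ℕ) (i : ZMod 3) (a : ℕ) :
    gen k i ^ 2 ^ a = 1 ↔ k < 2 ^ a := by
  obtain ⟨j, hj⟩ := exists_rep_genG i
  rw [gen, ← QuotientGroup.mk_pow, QuotientGroup.eq_one_iff, mem_GUpper_iff, Subgroup.coe_pow,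
    map_pow, hj, genUnit_pow, deep_conj_iff, Units.val_pow_eq_pow_val, deep_baseUnit_pow_iff]

theorem orderOf_gen {k : ℕ} (hk : k ≠ 0) (i : ZMod 3) :
    orderOf (gen k i) = 2 ^ (Nat.log 2 k + 1) := by
  refine orderOf_eq_prime_pow ?_ ?_
  · rw [gen_pow_eq_one_iff, not_lt]
    exact Nat.pow_log_le_self 2 hk
  · rw [gen_pow_eq_one_iff]
    exact Nat.lt_pow_succ_log_self (by norm_num) k

theorem isPGroup_GQuot (k : ℕ) : IsPGroup 2 (GQuot k) := by
  intro g
  refine ⟨k + 1, ?_⟩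
  induction g using QuotientGroup.induction_on with
  | H g =>
    rw [← QuotientGroup.mk_pow, QuotientGroup.eq_one_iff, mem_GUpper_iff, Subgroup.coe_pow,
      map_pow, Units.val_pow_eq_pow_val]
    exact (deep_pow_two_pow (deep_one_of_diag (rep_diagonal _)) _).mono Nat.lt_two_pow_self.le

/-- The units of period three along the diagonals. -/
def periodicUnits : Subgroup UpperTriangularˣ where
  carrier := {u | (∀ r c, (u : UpperTriangular) (r + 3) (c + 3) = (u : UpperTriangular) r c) ∧
    ∀ r c, ((u⁻¹ : UpperTriangularˣ) : UpperTriangular) (r + 3) (c + 3) =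
      ((u⁻¹ : UpperTriangularˣ) : UpperTriangular) r c}
  one_mem' := by simp [IncidenceAlgebra.one_apply]
  mul_mem' := by
    have key : ∀ M N : UpperTriangular, (∀ r c, M (r + 3) (c + 3) = M r c) →
        (∀ r c, N (r + 3) (c + 3) = N r c) → ∀ r c, (M * N) (r + 3) (c + 3) = (M * N) r c := by
      intro M N hM hN r c
      rw [IncidenceAlgebra.mul_apply, IncidenceAlgebra.mul_apply, ← Finset.map_add_right_Icc,
        Finset.sum_map]
      exact Finset.sum_congr rfl fun x _ => by simp [hM, hN]
    rintro a b ⟨ha, ha'⟩ ⟨hb, hb'⟩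
    refine ⟨fun r c => ?_, fun r c => ?_⟩
    · rw [Units.val_mul]; exact key _ _ ha hb r c
    · rw [mul_inv_rev, Units.val_mul]; exact key _ _ hb' ha' r c
  inv_mem' := by
    rintro a ⟨ha, ha'⟩
    exact ⟨ha', by simpa using ha⟩

theorem bandMatrix_periodic (a : ℕ → ZMod 3 → Block) (r c : ℕ) :
    bandMatrix a (r + 3) (c + 3) = bandMatrix a r c := by
  have h3 : ((r + 3 : ℕ) : ZMod 3) = (r : ZMod 3) := by
    rw [Nat.cast_add]; exact add_zero _
  simp [bandMatrix, -Nat.cast_add, h3]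

theorem rep_mem_periodicUnits (g : BigGroup) : rep g ∈ periodicUnits := by
  have h : ∀ i, genUnit i ∈ periodicUnits := fun i => by
    refine mul_mem (mul_mem (inv_mem ?_) ?_) ?_
    all_goals exact ⟨bandMatrix_periodic _, bandMatrix_periodic _⟩
  induction g using PresentedGroup.induction_on with
  | _ w =>
    change FreeGroup.lift genUnit w ∈ _
    induction w using FreeGroup.induction_on with
    | C1 => rw [map_one]; exact one_mem _
    | of x => simpa using h x
    | inv_of x => rw [map_inv]; simpa using h x
    | mul x y hx hy => rw [map_mul]; exact mul_mem hx hy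

theorem rep_periodic (g : BigGroup) (q r c : ℕ) :
    (rep g : UpperTriangular) (r + 3 * q) (c + 3 * q) = (rep g : UpperTriangular) r c := by
  induction q with
  | zero => rfl
  | succ q ih => rw [← ih]; exact (rep_mem_periodicUnits g).1 (r + 3 * q) (c + 3 * q)

instance finite_GQuot (k : ℕ) : Finite (GQuot k) := by
  let f : GQuot k → Fin (k + 1) → Fin 3 → Block := fun g d j =>
    (rep ((Quotient.out g : G) : BigGroup) : UpperTriangular) j (j + d)
  refine Finite.of_injective f fun g h hgh => ?_
  have key : ∀ a b : G, (∀ (d : Fin (k + 1)) (j : Fin 3),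
      (rep (a : BigGroup) : UpperTriangular) j (j + d) =
        (rep (b : BigGroup) : UpperTriangular) j (j + d)) → a⁻¹ * b ∈ GUpper k := by
    intro a b hab
    rw [mem_GUpper_iff]
    have hd : Deep (k + 1) ((rep (b : BigGroup) : UpperTriangular) -
        (rep (a : BigGroup) : UpperTriangular)) := by
      intro r c hc
      rw [IncidenceAlgebra.sub_apply, sub_eq_zero]
      rcases Nat.lt_or_ge c r with h | h
      · rw [IncidenceAlgebra.apply_eq_zero_of_not_le (by omega),
          IncidenceAlgebra.apply_eq_zero_of_not_le (by omega)]
      · have e1 : r = r % 3 + 3 * (r / 3) := (Nat.mod_add_div r 3).symm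
        have e2 : c = (r % 3 + (c - r)) + 3 * (r / 3) := by omega
        rw [e1, e2, rep_periodic, rep_periodic]
        exact (hab ⟨c - r, by omega⟩ ⟨r % 3, Nat.mod_lt _ (by norm_num)⟩).symm
    have := hd.mul_left ((rep (a : BigGroup))⁻¹ : UpperTriangularˣ)
    rwa [mul_sub, Units.inv_mul, ← map_inv, ← Units.val_mul, ← map_mul] at this
  have := QuotientGroup.eq.2 (key (Quotient.out g) (Quotient.out h)
    fun d j => congrFun (congrFun hgh d) j)
  rwa [QuotientGroup.out_eq', QuotientGroup.out_eq'] at this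

theorem gen_mul_gen_mul_gen (k : ℕ) : gen k 0 * gen k 1 * gen k 2 = 1 := by
  have h : genG 0 * genG 1 * genG 2 = 1 := by
    apply Subtype.ext
    change (PresentedGroup.of 0 * PresentedGroup.of 1 * PresentedGroup.of 3 : BigGroup) = 1
    exact PresentedGroup.one_of_mem (rels := relators) ⟨0, by simp⟩
  exact congrArg (QuotientGroup.mk (s := GUpper k)) h

theorem closure_gen (k : ℕ) : Subgroup.closure (Set.range (gen k)) = ⊤ := by
  have h : Subgroup.closure (Set.range genG) = ⊤ := by
    refine top_unique ?_
    refine (Subgroup.closure_closure_coe_preimage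
      (k := {PresentedGroup.of (rels := relators) 0, PresentedGroup.of 1,
        PresentedGroup.of 3})).ge.trans ?_
    refine Subgroup.closure_mono ?_
    rintro ⟨g, hg⟩ (h | h | h)
    · exact ⟨0, Subtype.ext h.symm⟩
    · exact ⟨1, Subtype.ext h.symm⟩
    · exact ⟨2, Subtype.ext h.symm⟩
  have e : Set.range (gen k) = QuotientGroup.mk' (GUpper k) '' Set.range genG := by
    rw [← Set.range_comp]; rfl
  rw [e, ← MonoidHom.map_closure, h]
  exact Subgroup.map_top_of_surjective _ (QuotientGroup.mk'_surjective _)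

/-- An entry of the first upper diagonal, as a homomorphism. It takes `x₀` to `0` and `x₁` to `1`,
so that `G_k` is not generated by `x₀`. -/
noncomputable def diagonalEntry : G →* Multiplicative (ZMod 2) where
  toFun g := Multiplicative.ofAdd ((rep (g : BigGroup) : UpperTriangular) 0 1 2 0)
  map_one' := by simp [IncidenceAlgebra.one_apply]
  map_mul' a b := by
    rw [Subgroup.coe_mul, map_mul, Units.val_mul, IncidenceAlgebra.mul_apply]
    rw [show Finset.Icc 0 1 = {0, 1} by rfl, Finset.sum_pair (by norm_num), rep_diagonal,
      rep_diagonal, one_mul, mul_one, Matrix.add_apply, add_comm, ofAdd_add]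

theorem gen_one_notMem_zpowers {k : ℕ} (hk : k ≠ 0) : gen k 1 ∉ Subgroup.zpowers (gen k 0) := by
  have hker : GUpper k ≤ diagonalEntry.ker := by
    intro g hg
    have : (rep (g : BigGroup) : UpperTriangular) 0 (0 + 1) = 0 := hg 0 1 le_rfl (by omega)
    rw [MonoidHom.mem_ker]
    change Multiplicative.ofAdd ((rep (g : BigGroup) : UpperTriangular) 0 1 2 0) = 1
    rw [zero_add] at this
    rw [this]
    rfl
  let f : GQuot k →* Multiplicative (ZMod 2) := QuotientGroup.lift _ diagonalEntry hker
  have e : ∀ i : ZMod 7, (genUnit i : UpperTriangular) 0 1 = conjCoeff i baseCoeff 1 0 := by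
    intro i
    rw [genUnit_val]
    simp [bandMatrix]
  have h0 : f (gen k 0) = 1 := by
    change Multiplicative.ofAdd ((rep (PresentedGroup.of 0) : UpperTriangular) 0 1 2 0) = 1
    rw [rep_of, e, first_diagonals.1 0]
    rfl
  have h1 : f (gen k 1) ≠ 1 := by
    change Multiplicative.ofAdd ((rep (PresentedGroup.of 1) : UpperTriangular) 0 1 2 0) ≠ 1
    rw [rep_of, e, first_diagonals.2.1.1]
    decide
  rintro ⟨z, hz⟩
  apply h1
  rw [← hz, map_zpow, h0, one_zpow]

/-- The order of `G_k` is a power of two, larger than the order of its generators. -/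
theorem exists_card_GQuot {k : ℕ} (hk : k ≠ 0) :
    ∃ N, Nat.card (GQuot k) = 2 ^ N ∧ Nat.log 2 k + 2 ≤ N := by
  obtain ⟨N, hN⟩ := (IsPGroup.iff_card (p := 2)).1 (isPGroup_GQuot k)
  refine ⟨N, hN, ?_⟩
  by_contra! h
  have hdvd := orderOf_dvd_natCard (gen k 0)
  rw [orderOf_gen hk, hN, Nat.pow_dvd_pow_iff_le_right (by norm_num)] at hdvd
  obtain rfl : N = Nat.log 2 k + 1 := by omega
  have : Subgroup.zpowers (gen k 0) = ⊤ := by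
    apply Subgroup.eq_top_of_card_eq
    rw [Nat.card_zpowers, orderOf_gen hk, hN]
  exact gen_one_notMem_zpowers hk (this ▸ Subgroup.mem_top _)

/-! ### The Klein model of the hyperbolic plane -/

/-- The time coordinate of a point of the hyperbolic plane in the hyperboloid model. -/
noncomputable def hypTime (z : ℍ) : ℝ := (z.re ^ 2 + z.im ^ 2 + 1) / (2 * z.im)

/-- The first space coordinate in the hyperboloid model. -/
noncomputable def hypFst (z : ℍ) : ℝ := (z.re ^ 2 + z.im ^ 2 - 1) / (2 * z.im)

/-- The second space coordinate in the hyperboloid model. -/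
noncomputable def hypSnd (z : ℍ) : ℝ := -(z.re / z.im)

theorem hyp_eq (z : ℍ) : hypTime z ^ 2 = 1 + hypFst z ^ 2 + hypSnd z ^ 2 := by
  have := z.im_pos.ne'
  unfold hypTime hypFst hypSnd
  field_simp
  ring

theorem hypTime_pos (z : ℍ) : 0 < hypTime z := by
  have := z.im_pos
  unfold hypTime
  positivity

theorem cosh_dist_eq (z w : ℍ) : Real.cosh (dist z w) =
    hypTime z * hypTime w - hypFst z * hypFst w - hypSnd z * hypSnd w := by
  have h1 := z.im_pos.ne'
  have h2 := w.im_pos.ne'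
  rw [UpperHalfPlane.cosh_dist, Complex.dist_eq, ← Complex.normSq_eq_norm_sq, Complex.normSq_apply]
  simp only [Complex.sub_re, Complex.sub_im, UpperHalfPlane.coe_re, UpperHalfPlane.coe_im]
  unfold hypTime hypFst hypSnd
  field_simp
  ring

theorem eq_of_cosh_eq {x y : ℝ} (hx : 0 ≤ x) (hy : 0 ≤ y) (h : Real.cosh x = Real.cosh y) :
    x = y := by
  have h1 := Real.cosh_le_cosh.1 h.le
  have h2 := Real.cosh_le_cosh.1 h.ge
  rw [abs_of_nonneg hx, abs_of_nonneg hy] at h1 h2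
  exact le_antisymm h1 h2

/-- The Klein model of the hyperbolic plane: geodesics become straight line segments in the open
unit disc. -/
noncomputable def klein (z : ℍ) : ℂ := ⟨hypFst z / hypTime z, hypSnd z / hypTime z⟩

theorem klein_re (z : ℍ) : (klein z).re = hypFst z / hypTime z := rfl
theorem klein_im (z : ℍ) : (klein z).im = hypSnd z / hypTime z := rfl

theorem hypTime_mul_re (z : ℍ) : hypTime z * (klein z).re = hypFst z :=
  mul_div_cancel₀ _ (hypTime_pos z).ne'
theorem hypTime_mul_im (z : ℍ) : hypTime z * (klein z).im = hypSnd z :=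
  mul_div_cancel₀ _ (hypTime_pos z).ne'

theorem hypTime_sq_mul (z : ℍ) : hypTime z ^ 2 * (1 - Complex.normSq (klein z)) = 1 := by
  rw [Complex.normSq_apply]
  have h := hyp_eq z
  rw [← hypTime_mul_re, ← hypTime_mul_im] at h
  linear_combination h

theorem normSq_klein_lt (z : ℍ) : Complex.normSq (klein z) < 1 := by
  have h := hypTime_sq_mul z
  have := hypTime_pos z
  by_contra! h'
  nlinarith [sq_nonneg (hypTime z)]

theorem norm_klein_lt (z : ℍ) : ‖klein z‖ < 1 := by
  have := normSq_klein_lt z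
  rw [Complex.normSq_eq_norm_sq] at this
  nlinarith [norm_nonneg (klein z)]

theorem klein_mem_ball (z : ℍ) : klein z ∈ Metric.ball (0 : ℂ) 1 := by
  simpa using norm_klein_lt z

theorem hypTime_eq (z : ℍ) : hypTime z = 1 / √(1 - Complex.normSq (klein z)) := by
  have h := hypTime_sq_mul z
  have h2 := hypTime_pos z
  have h3 : 0 < 1 - Complex.normSq (klein z) := by linarith [normSq_klein_lt z]
  rw [eq_div_iff (by positivity), ← Real.sqrt_sq h2.le, ← Real.sqrt_mul (by positivity), h,
    Real.sqrt_one]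

/-- The inverse of the Klein model (with junk value `i` outside of the open unit disc). -/
noncomputable def unklein (ζ : ℂ) : ℍ :=
  if h : Complex.normSq ζ < 1 then
    UpperHalfPlane.mk ⟨-ζ.im / (1 - ζ.re), √(1 - Complex.normSq ζ) / (1 - ζ.re)⟩ (by
      have : ζ.re < 1 := by rw [Complex.normSq_apply] at h; nlinarith [sq_nonneg ζ.im]
      have : 0 < 1 - ζ.re := by linarith
      have : 0 < 1 - Complex.normSq ζ := by linarith
      change 0 < √(1 - Complex.normSq ζ) / (1 - ζ.re)
      positivity)
  else UpperHalfPlane.I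

theorem klein_unklein {ζ : ℂ} (h : Complex.normSq ζ < 1) : klein (unklein ζ) = ζ := by
  have h1 : ζ.re < 1 := by rw [Complex.normSq_apply] at h; nlinarith [sq_nonneg ζ.im]
  have h1 : 1 - ζ.re ≠ 0 := by linarith
  have h2 : 0 < 1 - Complex.normSq ζ := by linarith
  have h3 : √(1 - Complex.normSq ζ) ^ 2 = 1 - Complex.normSq ζ := Real.sq_sqrt h2.le
  have h4 : 0 < √(1 - Complex.normSq ζ) := by positivity
  have hre : (unklein ζ).re = -ζ.im / (1 - ζ.re) := by rw [unklein, dif_pos h]; rfl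
  have him : (unklein ζ).im = √(1 - Complex.normSq ζ) / (1 - ζ.re) := by
    rw [unklein, dif_pos h]; rfl
  have hA : (unklein ζ).re ^ 2 + (unklein ζ).im ^ 2 = (1 + ζ.re) / (1 - ζ.re) := by
    rw [hre, him, div_pow, div_pow, h3, Complex.normSq_apply]
    field_simp
    ring
  have h0 : hypTime (unklein ζ) = 1 / √(1 - Complex.normSq ζ) := by
    rw [hypTime, hA, him]
    field_simp
    ring
  have h0' : hypFst (unklein ζ) = ζ.re / √(1 - Complex.normSq ζ) := by
    rw [hypFst, hA, him]
    field_simp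
    ring
  have h0'' : hypSnd (unklein ζ) = ζ.im / √(1 - Complex.normSq ζ) := by
    rw [hypSnd, hre, him]
    field_simp
  apply Complex.ext
  · rw [klein_re, h0, h0']; field_simp
  · rw [klein_im, h0, h0'']; field_simp

theorem klein_injective : Function.Injective klein := by
  intro z w h
  have h0 : hypTime z = hypTime w := by rw [hypTime_eq, hypTime_eq, h]
  have h1 : hypFst z = hypFst w := by rw [← hypTime_mul_re, ← hypTime_mul_re, h0, h]
  have h2 : hypSnd z = hypSnd w := by rw [← hypTime_mul_im, ← hypTime_mul_im, h0, h]
  have hz := z.im_pos.ne'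
  have hw := w.im_pos.ne'
  have him : z.im = w.im := by
    have : hypTime z - hypFst z = hypTime w - hypFst w := by rw [h0, h1]
    unfold hypTime hypFst at this
    field_simp at this
    linarith
  have hre : z.re = w.re := by
    unfold hypSnd at h2
    rw [him] at h2
    field_simp at h2
    linarith
  exact UpperHalfPlane.ext (Complex.ext hre him)

theorem unklein_klein (z : ℍ) : unklein (klein z) = z :=
  klein_injective (klein_unklein (normSq_klein_lt z))

theorem normSq_lt_one_of_mem_ball {ζ : ℂ} (h : ζ ∈ Metric.ball (0 : ℂ) 1) :
    Complex.normSq ζ < 1 := by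
  rw [mem_ball_zero_iff] at h
  rw [Complex.normSq_eq_norm_sq]
  nlinarith [norm_nonneg ζ]

theorem continuous_hypTime : Continuous hypTime := by
  unfold hypTime
  refine Continuous.div (by fun_prop) (by fun_prop) fun z => ?_
  have := z.im_pos
  positivity

theorem continuous_klein : Continuous klein := by
  have h1 : Continuous hypFst := by
    unfold hypFst
    refine Continuous.div (by fun_prop) (by fun_prop) fun z => ?_
    have := z.im_pos
    positivity
  have h2 : Continuous hypSnd := by
    unfold hypSnd
    exact (Continuous.div (by fun_prop) (by fun_prop) fun z => z.im_pos.ne').neg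
  have : klein = fun z => Complex.equivRealProdCLM.symm
      (hypFst z / hypTime z, hypSnd z / hypTime z) := rfl
  rw [this]
  refine (ContinuousLinearEquiv.continuous _).comp ?_
  exact (h1.div continuous_hypTime fun z => (hypTime_pos z).ne').prodMk
    (h2.div continuous_hypTime fun z => (hypTime_pos z).ne')

theorem continuousOn_unklein : ContinuousOn unklein (Metric.ball 0 1) := by
  rw [UpperHalfPlane.isEmbedding_coe.continuousOn_iff]
  have : Set.EqOn ((↑) ∘ unklein : ℂ → ℂ) (fun ζ : ℂ => Complex.equivRealProdCLM.symm
      (-ζ.im / (1 - ζ.re), √(1 - Complex.normSq ζ) / (1 - ζ.re))) (Metric.ball 0 1) := by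
    intro ζ h
    have h' := normSq_lt_one_of_mem_ball h
    simp only [Function.comp, unklein, dif_pos h']
    rfl
  refine ContinuousOn.congr ?_ this
  refine (ContinuousLinearEquiv.continuous _).comp_continuousOn ?_
  have hne : ∀ ζ ∈ Metric.ball (0 : ℂ) 1, 1 - ζ.re ≠ 0 := by
    intro ζ h
    have h' := normSq_lt_one_of_mem_ball h
    have : ζ.re < 1 := by rw [Complex.normSq_apply] at h'; nlinarith [sq_nonneg ζ.im]
    linarith
  have hn : Continuous fun ζ : ℂ => √(1 - Complex.normSq ζ) :=
    Real.continuous_sqrt.comp (continuous_const.sub Complex.continuous_normSq)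
  refine ContinuousOn.prodMk ?_ ?_
  · exact ContinuousOn.div (by fun_prop) (by fun_prop) hne
  · exact hn.continuousOn.div (by fun_prop) hne

theorem isOpenMap_klein : IsOpenMap klein := by
  intro U hU
  have : klein '' U = Metric.ball 0 1 ∩ unklein ⁻¹' U := by
    ext ζ
    constructor
    · rintro ⟨z, hz, rfl⟩
      exact ⟨klein_mem_ball z, by simpa [unklein_klein] using hz⟩
    · rintro ⟨h1, h2⟩
      exact ⟨_, h2, klein_unklein (normSq_lt_one_of_mem_ball h1)⟩
  rw [this]
  exact continuousOn_unklein.isOpen_inter_preimage Metric.isOpen_ball hU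

/-! ### Geodesic segments and convex hulls in the Klein model -/

theorem dist_add_eq_of_klein {a p b : ℍ} {s t : ℝ} (hs : 0 ≤ s) (ht : 0 ≤ t)
    (h0 : hypTime p = s * hypTime a + t * hypTime b) (h1 : hypFst p = s * hypFst a + t * hypFst b)
    (h2 : hypSnd p = s * hypSnd a + t * hypSnd b) : dist a p + dist p b = dist a b := by
  set γ := Real.cosh (dist a b) with hγ
  have hg := cosh_dist_eq a b
  have hα : Real.cosh (dist a p) = s + t * γ := by
    rw [cosh_dist_eq, hγ, hg, h0, h1, h2]
    linear_combination s * hyp_eq a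
  have hβ : Real.cosh (dist p b) = s * γ + t := by
    rw [cosh_dist_eq, hγ, hg, h0, h1, h2]
    linear_combination t * hyp_eq b
  have hone : s ^ 2 + t ^ 2 + 2 * s * t * γ = 1 := by
    have := hyp_eq p
    rw [h0, h1, h2] at this
    rw [hγ, hg]
    linear_combination this - s ^ 2 * hyp_eq a - t ^ 2 * hyp_eq b
  have hΓ := Real.sinh_nonneg_iff.2 (dist_nonneg (x := a) (y := b))
  have hsq := Real.cosh_sq (dist a b)
  rw [← hγ] at hsq
  have hsα : Real.sinh (dist a p) = t * Real.sinh (dist a b) := by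
    have h3 := Real.sinh_nonneg_iff.2 (dist_nonneg (x := a) (y := p))
    have h4 := Real.cosh_sq (dist a p)
    rw [hα] at h4
    refine (sq_eq_sq₀ h3 (by positivity)).1 ?_
    linear_combination -h4 + t ^ 2 * hsq + hone
  have hsβ : Real.sinh (dist p b) = s * Real.sinh (dist a b) := by
    have h3 := Real.sinh_nonneg_iff.2 (dist_nonneg (x := p) (y := b))
    have h4 := Real.cosh_sq (dist p b)
    rw [hβ] at h4
    refine (sq_eq_sq₀ h3 (by positivity)).1 ?_
    linear_combination -h4 + s ^ 2 * hsq + hone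
  have : Real.cosh (dist a p + dist p b) = Real.cosh (dist a b) := by
    rw [Real.cosh_add, hα, hβ, hsα, hsβ, ← hγ]
    linear_combination γ * hone - s * t * hsq
  exact eq_of_cosh_eq (add_nonneg dist_nonneg dist_nonneg) dist_nonneg this

/-- The Minkowski form is definite on the orthogonal complement of a point of the hyperboloid. -/
theorem eq_zero_of_orthogonal (p : ℍ) {y0 y1 y2 : ℝ}
    (ho : y0 * hypTime p = y1 * hypFst p + y2 * hypSnd p) (hn : y1 ^ 2 + y2 ^ 2 ≤ y0 ^ 2) :
    y0 = 0 ∧ y1 = 0 ∧ y2 = 0 := by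
  have h := hyp_eq p
  have hcs : (y0 * hypTime p) ^ 2 ≤ (y1 ^ 2 + y2 ^ 2) * (hypFst p ^ 2 + hypSnd p ^ 2) := by
    rw [ho]
    nlinarith [sq_nonneg (y1 * hypSnd p - y2 * hypFst p)]
  have h0 : y0 ^ 2 ≤ 0 := by
    have : (y1 ^ 2 + y2 ^ 2) * (hypFst p ^ 2 + hypSnd p ^ 2) ≤
        y0 ^ 2 * (hypFst p ^ 2 + hypSnd p ^ 2) := mul_le_mul_of_nonneg_right hn (by positivity)
    nlinarith
  have h0' : y0 = 0 := by nlinarith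
  refine ⟨h0', ?_, ?_⟩ <;> nlinarith [sq_nonneg y1, sq_nonneg y2]

theorem exists_of_dist_add_eq {a p b : ℍ} (h : dist a p + dist p b = dist a b) (hap : a ≠ p) :
    ∃ s t r : ℝ, 0 ≤ s ∧ 0 < t ∧ 0 < r ∧ s * hypTime a + t * hypTime b = r * hypTime p ∧
      s * hypFst a + t * hypFst b = r * hypFst p ∧ s * hypSnd a + t * hypSnd b = r * hypSnd p := by
  set α := Real.cosh (dist a p) with hα
  set β := Real.cosh (dist p b) with hβ
  set s := Real.sinh (dist p b) with hs
  set t := Real.sinh (dist a p) with ht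
  have hs0 : 0 ≤ s := Real.sinh_nonneg_iff.2 dist_nonneg
  have ht0 : 0 < t := Real.sinh_pos_iff.2 (dist_pos.2 hap)
  have hα1 := Real.one_le_cosh (dist a p)
  have hβ1 := Real.one_le_cosh (dist p b)
  have h1 : α ^ 2 = t ^ 2 + 1 := Real.cosh_sq _
  have h2 : β ^ 2 = s ^ 2 + 1 := Real.cosh_sq _
  have h3 : Real.cosh (dist a b) = α * β + t * s := by rw [← h, Real.cosh_add]
  rw [cosh_dist_eq] at h3
  have h4 := cosh_dist_eq a p
  have h5 := cosh_dist_eq p b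
  rw [← hα] at h4
  rw [← hβ] at h5
  obtain ⟨e0, e1, e2⟩ := eq_zero_of_orthogonal p
    (y0 := s * hypTime a + t * hypTime b - (s * α + t * β) * hypTime p)
    (y1 := s * hypFst a + t * hypFst b - (s * α + t * β) * hypFst p)
    (y2 := s * hypSnd a + t * hypSnd b - (s * α + t * β) * hypSnd p)
    (by linear_combination -(s * α + t * β) * hyp_eq p - s * h4 - t * h5)
    (by
      refine le_of_eq ?_
      linear_combination (s * α + t * β) ^ 2 * (-hyp_eq p) - s ^ 2 * hyp_eq a - t ^ 2 * hyp_eq b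
        - 2 * s * t * h3 + s ^ 2 * h1 + t ^ 2 * h2 - 2 * s * (s * α + t * β) * h4
        - 2 * t * (s * α + t * β) * h5)
  refine ⟨s, t, s * α + t * β, hs0, ht0, by positivity, ?_, ?_, ?_⟩ <;> linarith

/-- Geodesic segments are straight in the Klein model. -/
theorem mem_hypSegment_iff {a p b : ℍ} :
    p ∈ hypSegment a b ↔ klein p ∈ segment ℝ (klein a) (klein b) := by
  constructor
  · intro h
    by_cases hap : a = p
    · rw [hap]; exact left_mem_segment _ _ _
    obtain ⟨s, t, r, hs, ht, hr, h0, h1, h2⟩ := exists_of_dist_add_eq h hap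
    have ha := hypTime_pos a
    have hb := hypTime_pos b
    have hp := hypTime_pos p
    refine ⟨s * hypTime a / (r * hypTime p), t * hypTime b / (r * hypTime p), by positivity,
      by positivity, by rw [← add_div, h0, div_self (by positivity)], ?_⟩
    apply Complex.ext
    · simp only [Complex.add_re, Complex.smul_re, smul_eq_mul, klein_re]
      field_simp
      linear_combination h1
    · simp only [Complex.add_im, Complex.smul_im, smul_eq_mul, klein_im]
      field_simp
      linear_combination h2
  · rintro ⟨s, t, hs, ht, hst, h⟩
    have ha := hypTime_pos a
    have hb := hypTime_pos b
    have hp := hypTime_pos p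
    have hre := congrArg Complex.re h
    have him := congrArg Complex.im h
    simp only [Complex.add_re, Complex.smul_re, smul_eq_mul, klein_re] at hre
    simp only [Complex.add_im, Complex.smul_im, smul_eq_mul, klein_im] at him
    refine dist_add_eq_of_klein (s := s * hypTime p / hypTime a) (t := t * hypTime p / hypTime b)
      (by positivity) (by positivity) ?_ ?_ ?_
    · field_simp
      exact hst.symm
    · field_simp at hre ⊢
      linear_combination -hre
    · field_simp at him ⊢
      linear_combination -him

theorem image_klein_preimage {s : Set ℂ} (hs : s ⊆ Metric.ball 0 1) :
    klein '' (klein ⁻¹' s) = s := by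
  refine Set.image_preimage_eq_of_subset fun ζ hζ => ?_
  exact ⟨_, klein_unklein (normSq_lt_one_of_mem_ball (hs hζ))⟩

theorem image_klein_hypSegment (a b : ℍ) :
    klein '' hypSegment a b = segment ℝ (klein a) (klein b) := by
  rw [← image_klein_preimage (s := segment ℝ (klein a) (klein b))
    ((convex_ball _ _).segment_subset (klein_mem_ball a) (klein_mem_ball b))]
  exact congrArg _ (Set.ext fun p => mem_hypSegment_iff)

theorem hypConvex_preimage {s : Set ℂ} (hs : Convex ℝ s) : HypConvex (klein ⁻¹' s) :=
  fun _ ha _ hb _ hp => hs.segment_subset ha hb (mem_hypSegment_iff.1 hp)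

theorem HypConvex.convex_image {t : Set ℍ} (ht : HypConvex t) : Convex ℝ (klein '' t) := by
  rw [convex_iff_segment_subset]
  rintro _ ⟨a, ha, rfl⟩ _ ⟨b, hb, rfl⟩
  rw [← image_klein_hypSegment]
  exact Set.image_mono (ht a ha b hb)

/-- Geodesic convex hulls are convex hulls in the Klein model. -/
theorem hypHull_eq (s : Set ℍ) : hypHull s = klein ⁻¹' (convexHull ℝ (klein '' s)) := by
  apply Set.Subset.antisymm
  · refine Set.sInter_subset_of_mem ⟨hypConvex_preimage (convex_convexHull ℝ _), ?_⟩
    exact fun z hz => subset_convexHull ℝ _ ⟨z, hz, rfl⟩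
  · rintro z hz t ⟨ht, hst⟩
    have := convexHull_min (Set.image_mono hst) ht.convex_image hz
    exact klein_injective.mem_set_image.1 this

/-! ### Isometries in the Klein model -/

/-- Two points with the same distances to all points of a nonempty open set are equal. -/
theorem eq_of_dist_eq_on_open {U : Set ℍ} (hU : IsOpen U) (hne : U.Nonempty) {y y' : ℍ}
    (h : ∀ q ∈ U, dist y q = dist y' q) : y = y' := by
  obtain ⟨q, hq⟩ := hne
  set A := hypTime y - hypTime y' with hA
  set B := hypFst y - hypFst y' with hB
  set C := hypSnd y - hypSnd y' with hC
  have key : ∀ u ∈ U, A * hypTime u = B * hypFst u + C * hypSnd u := by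
    intro u hu
    have := congrArg Real.cosh (h u hu)
    rw [cosh_dist_eq, cosh_dist_eq] at this
    rw [hA, hB, hC]
    linear_combination this
  have key2 : ∀ u ∈ U, (A - B) * (u.re ^ 2 + u.im ^ 2) + (A + B) + 2 * C * u.re = 0 := by
    intro u hu
    have := key u hu
    have h0 := u.im_pos.ne'
    unfold hypTime hypFst hypSnd at this
    field_simp at this
    linear_combination this
  have hc : Continuous fun x : ℝ => x +ᵥ q := by
    rw [UpperHalfPlane.isEmbedding_coe.continuous_iff]
    have : ((↑) ∘ fun x : ℝ => x +ᵥ q : ℝ → ℂ) = fun x : ℝ => (x : ℂ) + q := by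
      ext x; simp
    rw [this]
    fun_prop
  have hmem : (fun x : ℝ => x +ᵥ q) ⁻¹' U ∈ nhds (0 : ℝ) :=
    (hU.preimage hc).mem_nhds (by simpa using hq)
  obtain ⟨ε, hε, hεU⟩ := Metric.mem_nhds_iff.1 hmem
  have hx : ∀ x : ℝ, |x| < ε → (A - B) * ((x + q.re) ^ 2 + q.im ^ 2) + (A + B)
      + 2 * C * (x + q.re) = 0 := by
    intro x hx
    have := key2 _ (hεU (show x ∈ Metric.ball 0 ε by simpa using hx))
    simpa using this
  have e0 := hx 0 (by simpa using hε)
  have e1 := hx (ε / 2) (by rw [abs_of_pos (by positivity)]; linarith)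
  have e2 := hx (-(ε / 2)) (by rw [abs_neg, abs_of_pos (by positivity)]; linarith)
  have hAB : A - B = 0 := by
    have : (A - B) * (2 * (ε / 2) ^ 2) = 0 := by linear_combination e1 + e2 - 2 * e0
    rcases mul_eq_zero.1 this with h | h
    · exact h
    · exfalso
      have : 0 < 2 * (ε / 2) ^ 2 := by positivity
      exact this.ne' h
  have hC0 : C = 0 := by
    have : C * (2 * ε) = 0 := by
      rw [hAB] at e1 e2
      linear_combination e1 - e2
    rcases mul_eq_zero.1 this with h | h
    · exact h
    · exact absurd h (by positivity)
  have hABp : A + B = 0 := by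
    rw [hAB, hC0] at e0
    linear_combination e0
  have hA0 : A = 0 := by linarith
  have hB0 : B = 0 := by linarith
  apply klein_injective
  apply Complex.ext
  · rw [klein_re, klein_re, sub_eq_zero.1 (hA.symm.trans hA0), sub_eq_zero.1 (hB.symm.trans hB0)]
  · rw [klein_im, klein_im, sub_eq_zero.1 (hA.symm.trans hA0), sub_eq_zero.1 (hC.symm.trans hC0)]

theorem sl_denom_ne (g : SL(2, ℝ)) (z : ℍ) : ((g 1 0 : ℝ) : ℂ) * z + (g 1 1 : ℝ) ≠ 0 := by
  intro h
  have h1 := congrArg Complex.re h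
  have h2 := congrArg Complex.im h
  simp at h1 h2
  have hd := g.det_coe
  rw [Matrix.det_fin_two] at hd
  rcases h2 with h2 | h2
  · rw [h2] at h1 hd
    have : g 1 1 = 0 := by simpa using h1
    rw [this] at hd
    simp at hd
  · exact z.im_pos.ne' h2

theorem sl_smul_coe (g : SL(2, ℝ)) (z : ℍ) : ((g • z : ℍ) : ℂ) =
    (((g 0 0 : ℝ) : ℂ) * z + (g 0 1 : ℝ)) / (((g 1 0 : ℝ) : ℂ) * z + (g 1 1 : ℝ)) := by
  rw [UpperHalfPlane.specialLinearGroup_apply]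
  rfl

/-- The action of `SL(2, ℝ)` on the hyperboloid: this is the action on symmetric matrices with
entries `|z|² / y`, `x / y`, `1 / y`. -/
theorem sl_smul_hyp (g : SL(2, ℝ)) (z : ℍ) :
    (hypTime (g • z) + hypFst (g • z) = g 0 0 ^ 2 * (hypTime z + hypFst z)
      - 2 * g 0 0 * g 0 1 * hypSnd z + g 0 1 ^ 2 * (hypTime z - hypFst z)) ∧
    (hypTime (g • z) - hypFst (g • z) = g 1 0 ^ 2 * (hypTime z + hypFst z)
      - 2 * g 1 0 * g 1 1 * hypSnd z + g 1 1 ^ 2 * (hypTime z - hypFst z)) ∧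
    hypSnd (g • z) = -(g 0 0 * g 1 0) * (hypTime z + hypFst z)
      + (g 0 0 * g 1 1 + g 0 1 * g 1 0) * hypSnd z
      - g 0 1 * g 1 1 * (hypTime z - hypFst z) := by
  have hd := g.det_coe
  rw [Matrix.det_fin_two] at hd
  have hne := sl_denom_ne g z
  have hn := Complex.normSq_pos.2 hne
  have hc := sl_smul_coe g z
  have hz := z.im_pos.ne'
  set a := g 0 0
  set b := g 0 1
  set c := g 1 0
  set d := g 1 1
  set n := Complex.normSq ((c : ℂ) * z + d) with hn'
  have hnv : n = (c * z.re + d) ^ 2 + (c * z.im) ^ 2 := by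
    rw [hn', Complex.normSq_apply]; simp; ring
  have hre : (g • z).re = ((a * z.re + b) * (c * z.re + d) + a * c * z.im ^ 2) / n := by
    rw [← UpperHalfPlane.coe_re, hc, Complex.div_re, ← hn']
    simp
    ring
  have him : (g • z).im = z.im / n := by
    rw [← UpperHalfPlane.coe_im, hc, Complex.div_im, ← hn']
    simp
    field_simp
    linear_combination hd
  have hsq : (g • z).re ^ 2 + (g • z).im ^ 2 = ((a * z.re + b) ^ 2 + (a * z.im) ^ 2) / n := by
    rw [hre, him]
    field_simp
    rw [hnv]
    have : z.im ^ 2 = z.im ^ 2 * (a * d - b * c) ^ 2 := by rw [hd]; ring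
    linear_combination this
  have hn0 := hn.ne'
  unfold hypTime hypFst hypSnd
  rw [hsq, hre, him]
  refine ⟨?_, ?_, ?_⟩
  · field_simp
    ring
  · field_simp
    linear_combination 2 * hnv
  · field_simp
    ring

theorem hyp_rotation (α : ℝ) (z : ℍ) : hypTime (rotation α • z) = hypTime z ∧
    hypFst (rotation α • z) = Real.cos (2 * α) * hypFst z - Real.sin (2 * α) * hypSnd z ∧
    hypSnd (rotation α • z) = Real.sin (2 * α) * hypFst z + Real.cos (2 * α) * hypSnd z := by
  obtain ⟨h1, h2, h3⟩ := sl_smul_hyp (rotation α) z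
  have e : rotation α 0 0 = Real.cos α ∧ rotation α 0 1 = Real.sin α ∧
    rotation α 1 0 = -Real.sin α ∧ rotation α 1 1 = Real.cos α := ⟨rfl, rfl, rfl, rfl⟩
  obtain ⟨e1, e2, e3, e4⟩ := e
  rw [e1, e2] at h1
  rw [e3, e4] at h2
  rw [e1, e2, e3, e4] at h3
  have hs := Real.sin_sq_add_cos_sq α
  rw [Real.sin_two_mul, Real.cos_two_mul']
  refine ⟨?_, ?_, ?_⟩
  · linear_combination h1 / 2 + h2 / 2 + hypTime z * hs
  · linear_combination h1 / 2 - h2 / 2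
  · linear_combination h3

theorem klein_rotation (α : ℝ) (z : ℍ) :
    klein (rotation α • z) = Complex.exp ((2 * α : ℝ) * Complex.I) * klein z := by
  obtain ⟨h0, h1, h2⟩ := hyp_rotation α z
  have := (hypTime_pos z).ne'
  apply Complex.ext
  · rw [Complex.mul_re, Complex.exp_ofReal_mul_I_re, Complex.exp_ofReal_mul_I_im, klein_re, h0, h1,
      klein_re, klein_im]
    field_simp
  · rw [Complex.mul_im, Complex.exp_ofReal_mul_I_re, Complex.exp_ofReal_mul_I_im, klein_im, h0, h2,
      klein_re, klein_im]
    field_simp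
    ring

/-- The reflection of the hyperbolic plane in the imaginary axis. -/
noncomputable def mirror (z : ℍ) : ℍ :=
  UpperHalfPlane.mk ⟨-z.re, z.im⟩ z.im_pos

theorem hyp_mirror (z : ℍ) : hypTime (mirror z) = hypTime z ∧ hypFst (mirror z) = hypFst z ∧
    hypSnd (mirror z) = -hypSnd z := by
  have h1 : (mirror z).re = -z.re := rfl
  have h2 : (mirror z).im = z.im := rfl
  unfold hypTime hypFst hypSnd
  rw [h1, h2]
  refine ⟨by ring, by ring, by ring⟩

theorem klein_mirror (z : ℍ) : klein (mirror z) = (starRingEnd ℂ) (klein z) := by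
  obtain ⟨h0, h1, h2⟩ := hyp_mirror z
  apply Complex.ext
  · rw [Complex.conj_re, klein_re, klein_re, h0, h1]
  · rw [Complex.conj_im, klein_im, klein_im, h0, h2, neg_div]

theorem mirror_mirror (z : ℍ) : mirror (mirror z) = z := by
  apply klein_injective
  rw [klein_mirror, klein_mirror, Complex.conj_conj]

/-- `mirror` as an isometry. -/
noncomputable def mirrorIso : ℍ ≃ᵢ ℍ where
  toFun := mirror
  invFun := mirror
  left_inv := mirror_mirror
  right_inv := mirror_mirror
  isometry_toFun := Isometry.of_dist_eq fun z w => by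
    apply eq_of_cosh_eq dist_nonneg dist_nonneg
    obtain ⟨h0, h1, h2⟩ := hyp_mirror z
    obtain ⟨k0, k1, k2⟩ := hyp_mirror w
    change Real.cosh (dist (mirror z) (mirror w)) = _
    rw [cosh_dist_eq, cosh_dist_eq, h0, h1, h2, k0, k1, k2]
    ring

/-- Conjugation by the reflection in the imaginary axis preserves orientations. -/
theorem exists_mirror_smul_mirror (g : SL(2, ℝ)) :
    ∃ g' : SL(2, ℝ), ∀ z, mirror (g • mirror z) = g' • z := by
  have hd := g.det_coe
  rw [Matrix.det_fin_two] at hd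
  refine ⟨⟨!![g 0 0, -g 0 1; -g 1 0, g 1 1], by rw [Matrix.det_fin_two_of]; linarith⟩,
    fun z => ?_⟩
  set g' : SL(2, ℝ) := ⟨!![g 0 0, -g 0 1; -g 1 0, g 1 1], _⟩ with hg'
  have e1 : g' 0 0 = g 0 0 := rfl
  have e2 : g' 0 1 = -g 0 1 := rfl
  have e3 : g' 1 0 = -g 1 0 := rfl
  have e4 : g' 1 1 = g 1 1 := rfl
  obtain ⟨h1, h2, h3⟩ := sl_smul_hyp g (mirror z)
  obtain ⟨k1, k2, k3⟩ := sl_smul_hyp g' z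
  obtain ⟨m0, m1, m2⟩ := hyp_mirror z
  obtain ⟨n0, n1, n2⟩ := hyp_mirror (g • mirror z)
  rw [m0, m1, m2] at h1 h2 h3
  rw [e1, e2] at k1
  rw [e3, e4] at k2
  rw [e1, e2, e3, e4] at k3
  have t0 : hypTime (mirror (g • mirror z)) = hypTime (g' • z) := by linarith
  have t1 : hypFst (mirror (g • mirror z)) = hypFst (g' • z) := by linarith
  have t2 : hypSnd (mirror (g • mirror z)) = hypSnd (g' • z) := by linarith
  apply klein_injective
  apply Complex.ext
  · rw [klein_re, klein_re, t0, t1]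
  · rw [klein_im, klein_im, t0, t2]

/-! ### Angles -/

theorem discCoord_I (z : ℍ) :
    discCoord UpperHalfPlane.I z = (hypTime z / (hypTime z + 1)) • klein z := by
  have hT := hypTime_pos z
  have hz := z.im_pos
  have hden : (z : ℂ) - (starRingEnd ℂ) (UpperHalfPlane.I : ℂ) ≠ 0 := by
    intro h
    have := congrArg Complex.im h
    simp at this
    linarith
  rw [discCoord, div_eq_iff hden]
  have h1 : hypTime z / (hypTime z + 1) * (klein z).re = hypFst z / (hypTime z + 1) := by
    rw [← hypTime_mul_re]; ring
  have h2 : hypTime z / (hypTime z + 1) * (klein z).im = hypSnd z / (hypTime z + 1) := by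
    rw [← hypTime_mul_im]; ring
  have h3 : hypTime z + 1 ≠ 0 := by positivity
  have h4 : z.re ^ 2 + z.im ^ 2 + 1 + 2 * z.im ≠ 0 := by positivity
  apply Complex.ext
  · rw [Complex.mul_re, Complex.smul_re, Complex.smul_im, smul_eq_mul, smul_eq_mul, h1, h2]
    simp
    field_simp
    unfold hypTime hypFst hypSnd
    field_simp
    ring
  · rw [Complex.mul_im, Complex.smul_re, Complex.smul_im, smul_eq_mul, smul_eq_mul, h1, h2]
    simp
    field_simp
    unfold hypTime hypFst hypSnd
    field_simp
    ring

theorem exists_discCoord_smul (g : SL(2, ℝ)) (p : ℍ) :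
    ∃ u : ℂ, u ≠ 0 ∧ ∀ q : ℍ, discCoord (g • p) (g • q) = u * discCoord p q := by
  have hp := sl_denom_ne g p
  have hp' : ((g 1 0 : ℝ) : ℂ) * (starRingEnd ℂ) (p : ℂ) + (g 1 1 : ℝ) ≠ 0 := by
    intro h
    apply hp
    have := congrArg (starRingEnd ℂ) h
    simpa using this
  refine ⟨(((g 1 0 : ℝ) : ℂ) * (starRingEnd ℂ) (p : ℂ) + (g 1 1 : ℝ)) /
    (((g 1 0 : ℝ) : ℂ) * p + (g 1 1 : ℝ)), div_ne_zero hp' hp, fun q => ?_⟩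
  have hq := sl_denom_ne g q
  have hd := g.det_coe
  rw [Matrix.det_fin_two] at hd
  have hdc : ((g 0 0 : ℝ) : ℂ) * (g 1 1 : ℝ) - (g 0 1 : ℝ) * (g 1 0 : ℝ) = 1 := by
    exact_mod_cast hd
  have hqp : (q : ℂ) - (starRingEnd ℂ) (p : ℂ) ≠ 0 := by
    intro h
    have := congrArg Complex.im h
    simp at this
    linarith [q.im_pos, p.im_pos]
  have e1 : ((g • q : ℍ) : ℂ) - ((g • p : ℍ) : ℂ) = (q - p) /
      ((((g 1 0 : ℝ) : ℂ) * q + (g 1 1 : ℝ)) * (((g 1 0 : ℝ) : ℂ) * p + (g 1 1 : ℝ))) := by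
    rw [sl_smul_coe, sl_smul_coe, div_sub_div _ _ hq hp]
    congr 1
    linear_combination ((q : ℂ) - p) * hdc
  have e2 : ((g • q : ℍ) : ℂ) - (starRingEnd ℂ) ((g • p : ℍ) : ℂ) =
      (q - (starRingEnd ℂ) (p : ℂ)) / ((((g 1 0 : ℝ) : ℂ) * q + (g 1 1 : ℝ)) *
        (((g 1 0 : ℝ) : ℂ) * (starRingEnd ℂ) (p : ℂ) + (g 1 1 : ℝ))) := by
    rw [sl_smul_coe, sl_smul_coe]
    simp only [map_div₀, map_add, map_mul, Complex.conj_ofReal]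
    rw [div_sub_div _ _ hq hp']
    congr 1
    linear_combination ((q : ℂ) - (starRingEnd ℂ) (p : ℂ)) * hdc
  rw [discCoord, discCoord, e1, e2, div_div_div_eq, div_mul_div_comm,
    div_eq_div_iff (mul_ne_zero (mul_ne_zero hq hp) hqp) (mul_ne_zero hp hqp)]
  ring

/-- Angles are invariant under orientation-preserving isometries, and angles at `i` are the
Euclidean ones of the Klein model. -/
theorem hypAngle_eq {g : SL(2, ℝ)} {p : ℍ} (hg : g • p = UpperHalfPlane.I) (q r : ℍ) :
    hypAngle q p r = InnerProductGeometry.angle (klein (g • q)) (klein (g • r)) := by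
  obtain ⟨u, hu, h⟩ := exists_discCoord_smul g p
  rw [hg] at h
  have e : ∀ z : ℍ, 0 < hypTime z / (hypTime z + 1) := fun z => by
    have := hypTime_pos z
    positivity
  rw [hypAngle, ← Complex.angle_mul_left hu, ← h, ← h, discCoord_I, discCoord_I,
    InnerProductGeometry.angle_smul_left_of_pos _ _ (e _),
    InnerProductGeometry.angle_smul_right_of_pos _ _ (e _)]

/-! ### The equilateral triangle -/

/-- Half of the interior angle of the triangle. -/
noncomputable def halfAngle (n : ℕ) : ℝ := Real.pi / (2 * n)

/-- The hyperbolic cosine of the circumradius. -/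
noncomputable def ch (n : ℕ) : ℝ := Real.cosh (circumradius n)

/-- The hyperbolic sine of the circumradius. -/
noncomputable def sh (n : ℕ) : ℝ := Real.sinh (circumradius n)

theorem ch_sq (n : ℕ) : ch n ^ 2 = sh n ^ 2 + 1 := Real.cosh_sq _

theorem ch_pos (n : ℕ) : 0 < ch n := Real.cosh_pos _

theorem two_mul_halfAngle {n : ℕ} (hn : 4 ≤ n) : 2 * halfAngle n * n = Real.pi := by
  have : (n : ℝ) ≠ 0 := by positivity
  unfold halfAngle
  field_simp

theorem halfAngle_pos {n : ℕ} (hn : 4 ≤ n) : 0 < halfAngle n := by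
  have : (0 : ℝ) < n := by positivity
  have := Real.pi_pos
  unfold halfAngle
  positivity

theorem halfAngle_lt {n : ℕ} (hn : 4 ≤ n) : 7 * halfAngle n < Real.pi := by
  have h1 := two_mul_halfAngle hn
  have h2 := halfAngle_pos hn
  have h3 : (4 : ℝ) ≤ n := by exact_mod_cast hn
  nlinarith

theorem sin_halfAngle_pos {n : ℕ} (hn : 4 ≤ n) : 0 < Real.sin (halfAngle n) := by
  have h1 := halfAngle_lt hn
  have h2 := halfAngle_pos hn
  exact Real.sin_pos_of_pos_of_lt_pi h2 (by linarith)

theorem cos_halfAngle_pos {n : ℕ} (hn : 4 ≤ n) : 0 < Real.cos (halfAngle n) := by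
  have h1 := halfAngle_lt hn
  have h2 := halfAngle_pos hn
  exact Real.cos_pos_of_mem_Ioo ⟨by linarith, by linarith⟩

theorem sqrt_three_mul_tan_lt {n : ℕ} (hn : 4 ≤ n) :
    0 < √3 * Real.tan (halfAngle n) ∧ √3 * Real.tan (halfAngle n) < 1 := by
  have h1 := halfAngle_lt hn
  have h2 := halfAngle_pos hn
  have h3 : Real.tan (halfAngle n) < Real.tan (Real.pi / 6) :=
    Real.tan_lt_tan_of_lt_of_lt_pi_div_two (by linarith) (by linarith) (by linarith)
  have h4 := Real.tan_pos_of_pos_of_lt_pi_div_two h2 (by linarith)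
  rw [Real.tan_pi_div_six] at h3
  refine ⟨by positivity, ?_⟩
  rw [lt_div_iff₀ (by positivity)] at h3
  linarith

theorem ch_eq {n : ℕ} (hn : 4 ≤ n) : ch n = 1 / (√3 * Real.tan (halfAngle n)) := by
  obtain ⟨h1, h2⟩ := sqrt_three_mul_tan_lt hn
  exact Real.cosh_arcosh (by
    change 1 ≤ 1 / (√3 * Real.tan (halfAngle n))
    rw [le_div_iff₀ h1]
    linarith)

theorem ch_mul {n : ℕ} (hn : 4 ≤ n) :
    √3 * ch n * Real.sin (halfAngle n) = Real.cos (halfAngle n) := by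
  have h1 := sin_halfAngle_pos hn
  have h2 := cos_halfAngle_pos hn
  rw [ch_eq hn, Real.tan_eq_sin_div_cos]
  field_simp

theorem one_lt_ch {n : ℕ} (hn : 4 ≤ n) : 1 < ch n := by
  obtain ⟨h1, h2⟩ := sqrt_three_mul_tan_lt hn
  rw [ch_eq hn, lt_div_iff₀ h1]
  linarith

theorem circumradius_pos {n : ℕ} (hn : 4 ≤ n) : 0 < circumradius n := by
  obtain ⟨h1, h2⟩ := sqrt_three_mul_tan_lt hn
  refine Real.arcosh_pos ?_
  change 1 < 1 / (√3 * Real.tan (halfAngle n))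
  rw [← ch_eq hn]
  exact one_lt_ch hn

theorem sh_pos {n : ℕ} (hn : 4 ≤ n) : 0 < sh n :=
  Real.sinh_pos_iff.2 (circumradius_pos hn)

theorem forall_zmod3 {P : ZMod 3 → Prop} : (∀ i, P i) ↔ P 0 ∧ P 1 ∧ P 2 := by
  constructor
  · exact fun h => ⟨h 0, h 1, h 2⟩
  · rintro ⟨h0, h1, h2⟩ i
    fin_cases i
    exacts [h0, h1, h2]

theorem cos_sin_third (i : ZMod 3) :
    (Real.cos (2 * (Real.pi * (i.val : ℝ) / 3)) = if i = 0 then 1 else -1 / 2) ∧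
    (Real.sin (2 * (Real.pi * (i.val : ℝ) / 3)) =
      if i = 0 then 0 else if i = 1 then √3 / 2 else -(√3 / 2)) := by
  revert i
  rw [forall_zmod3]
  refine ⟨by simp, ?_, ?_⟩
  · have e : 2 * (Real.pi * ((1 : ZMod 3).val : ℝ) / 3) = Real.pi - Real.pi / 3 := by
      rw [show (1 : ZMod 3).val = 1 from rfl]; push_cast; ring
    rw [e, Real.cos_pi_sub, Real.sin_pi_sub, Real.cos_pi_div_three, Real.sin_pi_div_three]
    constructor
    · rw [if_neg (by decide)]; ring
    · rw [if_neg (by decide), if_pos rfl]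
  · have e : 2 * (Real.pi * ((2 : ZMod 3).val : ℝ) / 3) = Real.pi / 3 + Real.pi := by
      rw [show (2 : ZMod 3).val = 2 from rfl]; push_cast; ring
    rw [e, Real.cos_add_pi, Real.sin_add_pi, Real.cos_pi_div_three, Real.sin_pi_div_three]
    constructor
    · rw [if_neg (by decide)]; ring
    · rw [if_neg (by decide), if_neg (by decide)]

theorem hyp_triVertex (n : ℕ) (j : ZMod 3) : hypTime (triVertex n j) = ch n ∧
    hypFst (triVertex n j) = sh n * (if j = 0 then 1 else -1 / 2) ∧
    hypSnd (triVertex n j) = sh n *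
      (if j = 0 then 0 else if j = 1 then √3 / 2 else -(√3 / 2)) := by
  obtain ⟨hc, hs⟩ := cos_sin_third j
  set w : ℍ := (⟨Real.exp (circumradius n), Real.exp_pos _⟩ : {x : ℝ // 0 < x}) •
    UpperHalfPlane.I with hw
  have hre : w.re = 0 := by simp [hw]
  have him : w.im = Real.exp (circumradius n) := by simp [hw]
  obtain ⟨h0, h1, h2⟩ := hyp_rotation (Real.pi * (j.val : ℝ) / 3) w
  rw [hc, hs] at h1 h2
  have hE := Real.exp_pos (circumradius n)
  have e0 : hypTime w = ch n := by
    rw [hypTime, hre, him, ch, Real.cosh_eq, Real.exp_neg]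
    field_simp
    ring
  have e1 : hypFst w = sh n := by
    rw [hypFst, hre, him, sh, Real.sinh_eq, Real.exp_neg]
    field_simp
    ring
  have e2 : hypSnd w = 0 := by simp [hypSnd, hre]
  rw [e0] at h0
  rw [e1, e2] at h1 h2
  refine ⟨h0, h1.trans (by ring), h2.trans (by ring)⟩

/-- Barycentric coordinates with respect to the vertices of the triangle, homogeneous of degree one
in the coordinates of the hyperboloid model. -/
noncomputable def bary (n : ℕ) : ZMod 3 → ℍ → ℝ
  | 0, z => sh n * hypTime z + 2 * ch n * hypFst z
  | 1, z => sh n * hypTime z - ch n * hypFst z + √3 * ch n * hypSnd z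
  | 2, z => sh n * hypTime z - ch n * hypFst z - √3 * ch n * hypSnd z

theorem bary_zero (n : ℕ) (z : ℍ) : bary n 0 z = sh n * hypTime z + 2 * ch n * hypFst z := rfl
theorem bary_one (n : ℕ) (z : ℍ) :
    bary n 1 z = sh n * hypTime z - ch n * hypFst z + √3 * ch n * hypSnd z := rfl
theorem bary_two (n : ℕ) (z : ℍ) :
    bary n 2 z = sh n * hypTime z - ch n * hypFst z - √3 * ch n * hypSnd z := rfl

theorem forall_zmod3' {P : ZMod 3 → Prop} (i : ZMod 3) :
    (∀ j, P j) ↔ P i ∧ P (i + 1) ∧ P (i + 2) := by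
  constructor
  · exact fun h => ⟨h _, h _, h _⟩
  · rintro ⟨h0, h1, h2⟩ j
    have : ∀ i j : ZMod 3, j = i ∨ j = i + 1 ∨ j = i + 2 := by decide
    rcases this i j with rfl | rfl | rfl <;> assumption

theorem sum_zmod3 {M : Type*} [AddCommMonoid M] (f : ZMod 3 → M) :
    ∑ i, f i = f 0 + f 1 + f 2 := Fin.sum_univ_three f

theorem continuous_hypFst : Continuous hypFst := by
  have : hypFst = fun z => hypTime z * (klein z).re := funext fun z => (hypTime_mul_re z).symm
  rw [this]
  exact continuous_hypTime.mul (Complex.continuous_re.comp continuous_klein)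

theorem continuous_hypSnd : Continuous hypSnd := by
  have : hypSnd = fun z => hypTime z * (klein z).im := funext fun z => (hypTime_mul_im z).symm
  rw [this]
  exact continuous_hypTime.mul (Complex.continuous_im.comp continuous_klein)

theorem continuous_bary (n : ℕ) (i : ZMod 3) : Continuous (bary n i) := by
  have h0 := continuous_hypTime
  have h1 := continuous_hypFst
  have h2 := continuous_hypSnd
  revert i
  rw [forall_zmod3]
  refine ⟨?_, ?_, ?_⟩
  · exact (continuous_const.mul h0).add (continuous_const.mul h1)
  · exact ((continuous_const.mul h0).sub (continuous_const.mul h1)).add (continuous_const.mul h2)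
  · exact ((continuous_const.mul h0).sub (continuous_const.mul h1)).sub (continuous_const.mul h2)

theorem sum_bary (n : ℕ) (i : ZMod 3) (z : ℍ) :
    bary n i z + bary n (i + 1) z + bary n (i + 2) z = 3 * sh n * hypTime z := by
  revert i
  rw [forall_zmod3]
  refine ⟨?_, ?_, ?_⟩
  · change bary n 0 z + bary n 1 z + bary n 2 z = _
    rw [bary_zero, bary_one, bary_two]; ring
  · change bary n 1 z + bary n 2 z + bary n 0 z = _
    rw [bary_zero, bary_one, bary_two]; ring
  · change bary n 2 z + bary n 0 z + bary n 1 z = _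
    rw [bary_zero, bary_one, bary_two]; ring

theorem sum_bary_pos {n : ℕ} (hn : 4 ≤ n) (i : ZMod 3) (z : ℍ) :
    0 < bary n i z + bary n (i + 1) z + bary n (i + 2) z := by
  have := sh_pos hn
  have := hypTime_pos z
  rw [sum_bary]
  positivity

theorem sqrt_three_sq : √3 * √3 = (3 : ℝ) := Real.mul_self_sqrt (by norm_num)

theorem hyp_triVertex_zero (n : ℕ) : hypTime (triVertex n 0) = ch n ∧
    hypFst (triVertex n 0) = sh n ∧ hypSnd (triVertex n 0) = 0 := by
  simpa using hyp_triVertex n 0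

theorem hyp_triVertex_one (n : ℕ) : hypTime (triVertex n 1) = ch n ∧
    hypFst (triVertex n 1) = sh n * (-1 / 2) ∧ hypSnd (triVertex n 1) = sh n * (√3 / 2) := by
  have := hyp_triVertex n 1
  rwa [if_neg (by decide), if_neg (by decide), if_pos rfl] at this

theorem hyp_triVertex_two (n : ℕ) : hypTime (triVertex n 2) = ch n ∧
    hypFst (triVertex n 2) = sh n * (-1 / 2) ∧ hypSnd (triVertex n 2) = sh n * (-(√3 / 2)) := by
  have := hyp_triVertex n 2
  rwa [if_neg (by decide), if_neg (by decide), if_neg (by decide)] at this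

theorem bary_triVertex (n : ℕ) (i j : ZMod 3) :
    bary n i (triVertex n j) = if i = j then 3 * sh n * ch n else 0 := by
  obtain ⟨a0, a1, a2⟩ := hyp_triVertex_zero n
  obtain ⟨b0, b1, b2⟩ := hyp_triVertex_one n
  obtain ⟨c0, c1, c2⟩ := hyp_triVertex_two n
  have h3 := sqrt_three_sq
  revert i j
  simp only [forall_zmod3, bary_zero, bary_one, bary_two, a0, a1, a2, b0, b1, b2, c0, c1, c2]
  refine ⟨⟨?_, ?_, ?_⟩, ⟨?_, ?_, ?_⟩, ⟨?_, ?_, ?_⟩⟩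
  · rw [if_pos trivial]; ring
  · rw [if_neg (by decide)]; ring
  · rw [if_neg (by decide)]; ring
  · rw [if_neg (by decide)]; ring
  · rw [if_pos trivial]
    linear_combination ch n * sh n / 2 * h3
  · rw [if_neg (by decide)]
    linear_combination -ch n * sh n / 2 * h3
  · rw [if_neg (by decide)]; ring
  · rw [if_neg (by decide)]
    linear_combination -ch n * sh n / 2 * h3
  · rw [if_pos trivial]
    linear_combination ch n * sh n / 2 * h3

theorem hyp_I : hypTime UpperHalfPlane.I = 1 ∧ hypFst UpperHalfPlane.I = 0 ∧
    hypSnd UpperHalfPlane.I = 0 := by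
  simp [hypTime, hypFst, hypSnd]

theorem klein_I : klein UpperHalfPlane.I = 0 := by
  obtain ⟨h0, h1, h2⟩ := hyp_I
  apply Complex.ext
  · rw [klein_re, h0, h1]; simp
  · rw [klein_im, h0, h2]; simp

theorem bary_I (n : ℕ) (i : ZMod 3) : bary n i UpperHalfPlane.I = sh n := by
  obtain ⟨h0, h1, h2⟩ := hyp_I
  revert i
  rw [forall_zmod3]
  refine ⟨?_, ?_, ?_⟩ <;> simp [bary_zero, bary_one, bary_two, h0, h1, h2]

/-- The hyperboloid coordinates are determined by the barycentric coordinates. -/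
theorem hyp_of_bary {n : ℕ} (hn : 4 ≤ n) {p a b : ℍ} {s t : ℝ}
    (h : ∀ i, bary n i p = s * bary n i a + t * bary n i b) :
    hypTime p = s * hypTime a + t * hypTime b ∧ hypFst p = s * hypFst a + t * hypFst b ∧
      hypSnd p = s * hypSnd a + t * hypSnd b := by
  have hs := sh_pos hn
  have hc := ch_pos n
  have h0 := h 0
  have h1 := h 1
  have h2 := h 2
  rw [bary_zero, bary_zero, bary_zero] at h0
  rw [bary_one, bary_one, bary_one] at h1
  rw [bary_two, bary_two, bary_two] at h2
  refine ⟨?_, ?_, ?_⟩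
  · have : 3 * sh n * hypTime p = 3 * sh n * (s * hypTime a + t * hypTime b) := by
      linear_combination h0 + h1 + h2
    exact mul_left_cancel₀ (by positivity) this
  · have : 6 * ch n * hypFst p = 6 * ch n * (s * hypFst a + t * hypFst b) := by
      linear_combination 2 * h0 - h1 - h2
    exact mul_left_cancel₀ (by positivity) this
  · have : 2 * √3 * ch n * hypSnd p = 2 * √3 * ch n * (s * hypSnd a + t * hypSnd b) := by
      linear_combination h1 - h2
    exact mul_left_cancel₀ (by positivity) this

theorem eq_of_bary_eq {n : ℕ} (hn : 4 ≤ n) {p q : ℍ} {r : ℝ} (h : ∀ i, bary n i p = r * bary n i q) :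
    p = q := by
  obtain ⟨h0, h1, h2⟩ := hyp_of_bary hn (p := p) (a := q) (b := q) (s := r) (t := 0)
    (fun i => by rw [h, zero_mul, add_zero])
  have hp := hypTime_pos p
  have hq := hypTime_pos q
  have hr : r ≠ 0 := by
    rintro rfl
    simp at h0
    exact hp.ne' h0
  apply klein_injective
  apply Complex.ext
  · rw [klein_re, klein_re, h0, h1, zero_mul, zero_mul, add_zero, add_zero,
      mul_div_mul_left _ _ hr]
  · rw [klein_im, klein_im, h0, h2, zero_mul, zero_mul, add_zero, add_zero,
      mul_div_mul_left _ _ hr]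

theorem mem_hypSegment_iff_bary {n : ℕ} (hn : 4 ≤ n) {a p b : ℍ} :
    p ∈ hypSegment a b ↔ ∃ s t : ℝ, 0 ≤ s ∧ 0 ≤ t ∧
      ∀ i, bary n i p = s * bary n i a + t * bary n i b := by
  constructor
  · intro h
    by_cases hap : a = p
    · exact ⟨1, 0, zero_le_one, le_rfl, fun i => by rw [hap]; ring⟩
    obtain ⟨s, t, r, hs, ht, hr, h0, h1, h2⟩ := exists_of_dist_add_eq h hap
    refine ⟨s / r, t / r, by positivity, by positivity, ?_⟩
    rw [forall_zmod3]
    refine ⟨?_, ?_, ?_⟩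
    · simp only [bary_zero]
      field_simp
      linear_combination -sh n * h0 - 2 * ch n * h1
    · simp only [bary_one]
      field_simp
      linear_combination -sh n * h0 + ch n * h1 - √3 * ch n * h2
    · simp only [bary_two]
      field_simp
      linear_combination -sh n * h0 + ch n * h1 + √3 * ch n * h2
  · rintro ⟨s, t, hs, ht, h⟩
    obtain ⟨h0, h1, h2⟩ := hyp_of_bary hn h
    exact dist_add_eq_of_klein hs ht h0 h1 h2

theorem klein_eq_sum {n : ℕ} (hn : 4 ≤ n) (z : ℍ) :
    klein z = ∑ i, (bary n i z / (3 * sh n * hypTime z)) • klein (triVertex n i) := by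
  have hs := sh_pos hn
  have hc := ch_pos n
  have hz := hypTime_pos z
  have h3 := sqrt_three_sq
  rw [sum_zmod3]
  obtain ⟨a0, a1, a2⟩ := hyp_triVertex_zero n
  obtain ⟨b0, b1, b2⟩ := hyp_triVertex_one n
  obtain ⟨c0, c1, c2⟩ := hyp_triVertex_two n
  rw [bary_zero, bary_one, bary_two]
  apply Complex.ext
  · simp only [Complex.add_re, Complex.smul_re, smul_eq_mul, klein_re, a0, a1, b0, b1, c0, c1]
    field_simp
    ring
  · simp only [Complex.add_im, Complex.smul_im, smul_eq_mul, klein_im, a0, a2, b0, b2, c0, c2]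
    field_simp
    ring_nf
    rw [Real.sq_sqrt (by norm_num)]
    ring

theorem mem_triangle_iff {n : ℕ} (hn : 4 ≤ n) {z : ℍ} :
    z ∈ triangle n ↔ ∀ i, 0 ≤ bary n i z := by
  have hs := sh_pos hn
  constructor
  · intro h i
    refine h {z | 0 ≤ bary n i z} ⟨?_, ?_⟩
    · intro a ha b hb p hp
      obtain ⟨s, t, hs, ht, h⟩ := (mem_hypSegment_iff_bary hn).1 hp
      change 0 ≤ bary n i a at ha
      change 0 ≤ bary n i b at hb
      change 0 ≤ bary n i p
      rw [h]
      positivity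
    · rintro _ ⟨j, rfl⟩
      have := ch_pos n
      change 0 ≤ bary n i _
      rw [bary_triVertex]
      split_ifs <;> positivity
  · intro h
    have hz := hypTime_pos z
    rw [triangle, hypHull_eq, Set.mem_preimage, klein_eq_sum hn]
    refine (convex_convexHull ℝ _).sum_mem (fun i _ => ?_) ?_ fun i _ =>
      subset_convexHull ℝ _ ⟨_, ⟨i, rfl⟩, rfl⟩
    · have := h i
      positivity
    · have := sum_bary n 0 z
      rw [sum_zmod3, ← add_div, ← add_div, div_eq_one_iff_eq (by positivity)]
      exact this

/-- There is a point with prescribed ratios of barycentric coordinates. -/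
theorem exists_bary_eq {n : ℕ} (hn : 4 ≤ n) {c : ZMod 3 → ℝ} (hc : ∀ i, 0 ≤ c i)
    (hpos : 0 < c 0 + c 1 + c 2) : ∃ z r, 0 < r ∧ ∀ i, bary n i z = r * c i := by
  have hs := sh_pos hn
  have hC := ch_pos n
  have h3 := sqrt_three_sq
  set m := c 0 + c 1 + c 2 with hm
  have hmem : ∑ i, (c i / m) • klein (triVertex n i) ∈ Metric.ball (0 : ℂ) 1 := by
    refine (convex_ball _ _).sum_mem (fun i _ => div_nonneg (hc i) hpos.le) ?_
      fun i _ => klein_mem_ball _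
    rw [sum_zmod3, ← add_div, ← add_div, ← hm, div_self hpos.ne']
  obtain ⟨z, hz⟩ : ∃ z, klein z = _ := ⟨_, klein_unklein (normSq_lt_one_of_mem_ball hmem)⟩
  have hT := hypTime_pos z
  refine ⟨z, 3 * sh n * hypTime z / m, by positivity, ?_⟩
  have hre := congrArg Complex.re hz
  have him := congrArg Complex.im hz
  obtain ⟨a0, a1, a2⟩ := hyp_triVertex_zero n
  obtain ⟨b0, b1, b2⟩ := hyp_triVertex_one n
  obtain ⟨c0, c1, c2⟩ := hyp_triVertex_two n
  rw [sum_zmod3] at hre him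
  simp only [Complex.add_re, Complex.smul_re, smul_eq_mul, klein_re, a0, a1, b0, b1, c0, c1] at hre
  simp only [Complex.add_im, Complex.smul_im, smul_eq_mul, klein_im, a0, a2, b0, b2, c0, c2] at him
  have hm' : m ≠ 0 := hpos.ne'
  have e1 : 2 * ch n * m * hypFst z = sh n * hypTime z * (2 * c 0 - c 1 - c 2) := by
    field_simp at hre
    linear_combination hre
  have e2 : 2 * ch n * m * hypSnd z = √3 * sh n * hypTime z * (c 1 - c 2) := by
    field_simp at him
    linear_combination him
  rw [forall_zmod3]
  refine ⟨?_, ?_, ?_⟩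
  · rw [bary_zero]
    field_simp
    linear_combination e1 + sh n * hypTime z * hm
  · rw [bary_one]
    field_simp
    linear_combination -e1 / 2 + √3 / 2 * e2 + sh n * hypTime z * hm +
      (sh n * hypTime z) / 2 * (c 1 - c 2) * h3
  · rw [bary_two]
    field_simp
    linear_combination -e1 / 2 - √3 / 2 * e2 + sh n * hypTime z * hm -
      (sh n * hypTime z) / 2 * (c 1 - c 2) * h3

theorem mem_triSide_iff {n : ℕ} (hn : 4 ≤ n) {i : ZMod 3} {z : ℍ} :
    z ∈ triSide n i ↔ z ∈ triangle n ∧ bary n i z = 0 := by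
  have hs := sh_pos hn
  have hc := ch_pos n
  have d1 : ∀ i : ZMod 3, i ≠ i + 1 ∧ i ≠ i + 2 ∧ i + 1 ≠ i + 2 ∧ i + 2 ≠ i + 1 := by decide
  obtain ⟨d1, d2, d3, d4⟩ := d1 i
  rw [triSide, mem_hypSegment_iff_bary hn, mem_triangle_iff hn]
  constructor
  · rintro ⟨s, t, hs, ht, h⟩
    constructor
    · intro l
      rw [h, bary_triVertex, bary_triVertex]
      split_ifs <;> positivity
    · rw [h, bary_triVertex, bary_triVertex, if_neg d1, if_neg d2]
      ring
  · rintro ⟨h, h0⟩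
    refine ⟨bary n (i + 1) z / (3 * sh n * ch n), bary n (i + 2) z / (3 * sh n * ch n),
      div_nonneg (h _) (by positivity), div_nonneg (h _) (by positivity), ?_⟩
    simp only [bary_triVertex]
    rw [forall_zmod3' i]
    refine ⟨?_, ?_, ?_⟩
    · rw [if_neg d1, if_neg d2, h0]; ring
    · rw [if_pos rfl, if_neg d3]; field_simp; ring
    · rw [if_pos rfl, if_neg d4]; field_simp; ring

/-- The distance to a vertex depends on the barycentric coordinate. -/
theorem dist_triVertex_eq_iff {n : ℕ} (hn : 4 ≤ n) {z : ℍ} {i j : ZMod 3} :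
    dist z (triVertex n i) = dist z (triVertex n j) ↔ bary n i z = bary n j z := by
  have hs := sh_pos hn
  have hc := ch_pos n
  have h3 := sqrt_three_sq
  have key : ∀ i, 2 * ch n * Real.cosh (dist z (triVertex n i)) =
      (2 * ch n ^ 2 + sh n ^ 2) * hypTime z - sh n * bary n i z := by
    rw [forall_zmod3]
    refine ⟨?_, ?_, ?_⟩
    · obtain ⟨a0, a1, a2⟩ := hyp_triVertex_zero n
      rw [cosh_dist_eq, a0, a1, a2, bary_zero]
      ring
    · obtain ⟨a0, a1, a2⟩ := hyp_triVertex_one n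
      rw [cosh_dist_eq, a0, a1, a2, bary_one]
      ring
    · obtain ⟨a0, a1, a2⟩ := hyp_triVertex_two n
      rw [cosh_dist_eq, a0, a1, a2, bary_two]
      ring
  constructor
  · intro h
    have h1 := key i
    rw [h, key j] at h1
    have : sh n * bary n i z = sh n * bary n j z := by linarith
    exact mul_left_cancel₀ hs.ne' this
  · intro h
    apply eq_of_cosh_eq dist_nonneg dist_nonneg
    have h1 := key i
    rw [h, ← key j] at h1
    exact mul_left_cancel₀ (by positivity) h1

theorem mem_triSpoke_iff {n : ℕ} (hn : 4 ≤ n) {i : ZMod 3} {z : ℍ} :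
    z ∈ triSpoke n i ↔ z ∈ triangle n ∧ bary n (i + 1) z = bary n (i + 2) z ∧
      bary n i z ≤ bary n (i + 1) z := by
  have hs := sh_pos hn
  constructor
  · rintro ⟨m, hm, hd, hz⟩
    rw [dist_triVertex_eq_iff hn] at hd
    obtain ⟨hmT, hm0⟩ := (mem_triSide_iff hn).1 hm
    rw [mem_triangle_iff hn] at hmT
    obtain ⟨s, t, hs', ht', h⟩ := (mem_hypSegment_iff_bary hn).1 hz
    rw [mem_triangle_iff hn]
    refine ⟨fun l => ?_, ?_, ?_⟩
    · rw [h, bary_I]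
      have := hmT l
      positivity
    · rw [h, h, bary_I, bary_I, hd]
    · rw [h, h, bary_I, bary_I, hm0, mul_zero]
      have := mul_nonneg ht' (hmT (i + 1))
      linarith
  · rintro ⟨hT, h1, h2⟩
    rw [mem_triangle_iff hn] at hT
    obtain ⟨m, r, hr, hm⟩ := exists_bary_eq hn (c := fun l => if l = i then 0 else 1)
      (fun l => by split_ifs <;> norm_num)
      (by
        revert i
        rw [forall_zmod3]
        refine ⟨?_, ?_, ?_⟩ <;> intros <;> simp +decide)
    have d1 : ∀ i : ZMod 3, i + 1 ≠ i ∧ i + 2 ≠ i := by decide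
    obtain ⟨d1, d2⟩ := d1 i
    have m0 : bary n i m = 0 := by rw [hm]; simp
    have m1 : bary n (i + 1) m = r := by rw [hm]; simp [d1]
    have m2 : bary n (i + 2) m = r := by rw [hm]; simp [d2]
    refine ⟨m, (mem_triSide_iff hn).2 ⟨(mem_triangle_iff hn).2 ?_, m0⟩, ?_, ?_⟩
    · rw [forall_zmod3' i, m0, m1, m2]
      exact ⟨le_rfl, hr.le, hr.le⟩
    · rw [dist_triVertex_eq_iff hn, m1, m2]
    · rw [mem_hypSegment_iff_bary hn]
      refine ⟨bary n i z / sh n, (bary n (i + 1) z - bary n i z) / r, div_nonneg (hT _) hs.le,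
        div_nonneg (by linarith) hr.le, ?_⟩
      rw [forall_zmod3' i, m0, m1, m2, bary_I, bary_I, bary_I, ← h1]
      refine ⟨?_, ?_, ?_⟩ <;> · field_simp; ring

theorem isCompact_triangle (n : ℕ) : IsCompact (triangle n) := by
  have hK : IsCompact (convexHull ℝ (klein '' Set.range (triVertex n))) :=
    ((Set.finite_range _).image _).isCompact_convexHull (𝕜 := ℝ)
  have hsub : convexHull ℝ (klein '' Set.range (triVertex n)) ⊆ Metric.ball 0 1 := by
    refine convexHull_min ?_ (convex_ball _ _)
    rintro _ ⟨z, _, rfl⟩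
    exact klein_mem_ball z
  have : triangle n = unklein '' convexHull ℝ (klein '' Set.range (triVertex n)) := by
    rw [triangle, hypHull_eq]
    ext z
    constructor
    · exact fun hz => ⟨_, hz, unklein_klein z⟩
    · rintro ⟨ζ, hζ, rfl⟩
      rw [Set.mem_preimage, klein_unklein (normSq_lt_one_of_mem_ball (hsub hζ))]
      exact hζ
  rw [this]
  exact hK.image_of_continuousOn (continuousOn_unklein.mono hsub)

theorem HypConvex.isPreconnected {s : Set ℍ} (hs : HypConvex s) : IsPreconnected s := by
  have h1 : IsPreconnected (klein '' s) := hs.convex_image.isPreconnected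
  have hsub : klein '' s ⊆ Metric.ball 0 1 := by
    rintro _ ⟨z, _, rfl⟩
    exact klein_mem_ball z
  have : s = unklein '' (klein '' s) := by
    rw [← Set.image_comp]
    simp [unklein_klein]
  rw [this]
  exact h1.image _ (continuousOn_unklein.mono hsub)

theorem hypConvex_hypHull (s : Set ℍ) : HypConvex (hypHull s) := by
  rw [hypHull_eq]
  exact hypConvex_preimage (convex_convexHull ℝ _)

/-! ### Polar coordinates -/

/-- `r` and `θ` are polar coordinates of the point `w` in the Klein model. -/
def Polar (w : ℍ) (r θ : ℝ) : Prop :=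
  hypFst w = hypTime w * r * Real.cos θ ∧ hypSnd w = hypTime w * r * Real.sin θ

theorem exists_polar (w : ℍ) : ∃ r θ, 0 ≤ r ∧ -Real.pi < θ ∧ θ ≤ Real.pi ∧ Polar w r θ := by
  refine ⟨‖klein w‖, (klein w).arg, norm_nonneg _, Complex.neg_pi_lt_arg _, Complex.arg_le_pi _,
    ?_, ?_⟩
  · rw [mul_assoc, Complex.norm_mul_cos_arg, hypTime_mul_re]
  · rw [mul_assoc, Complex.norm_mul_sin_arg, hypTime_mul_im]

theorem Polar.klein_eq {w : ℍ} {r θ : ℝ} (h : Polar w r θ) :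
    klein w = r * Complex.exp (θ * Complex.I) := by
  have hw := hypTime_pos w
  apply Complex.ext
  · rw [klein_re, h.1, Complex.re_ofReal_mul, Complex.exp_ofReal_mul_I_re]
    field_simp
  · rw [klein_im, h.2, Complex.im_ofReal_mul, Complex.exp_ofReal_mul_I_im]
    field_simp

theorem Polar.eq {w w' : ℍ} {r θ : ℝ} (h : Polar w r θ) (h' : Polar w' r θ) : w = w' := by
  apply klein_injective
  rw [h.klein_eq, h'.klein_eq]

theorem Polar.unique {w : ℍ} {r θ r' θ' : ℝ} (h : Polar w r θ) (h' : Polar w r' θ')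
    (hr : 0 ≤ r) (hr' : 0 ≤ r') :
    r = r' ∧ (r = 0 ∨ ∃ N : ℤ, θ = θ' + 2 * Real.pi * N) := by
  have hw := (hypTime_pos w).ne'
  have h1 : r * Real.cos θ = r' * Real.cos θ' := by
    have := h.1.symm.trans h'.1
    rw [mul_assoc, mul_assoc] at this
    exact mul_left_cancel₀ hw this
  have h2 : r * Real.sin θ = r' * Real.sin θ' := by
    have := h.2.symm.trans h'.2
    rw [mul_assoc, mul_assoc] at this
    exact mul_left_cancel₀ hw this
  have e : r = r' := by
    refine (sq_eq_sq₀ hr hr').1 ?_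
    have a := Real.sin_sq_add_cos_sq θ
    have b := Real.sin_sq_add_cos_sq θ'
    calc r ^ 2 = (r * Real.cos θ) ^ 2 + (r * Real.sin θ) ^ 2 := by linear_combination -r ^ 2 * a
      _ = _ := by rw [h1, h2]; linear_combination r' ^ 2 * b
  refine ⟨e, or_iff_not_imp_left.2 fun h0 => ?_⟩
  rw [← e] at h1 h2
  have := Real.Angle.cos_sin_inj (mul_left_cancel₀ h0 h1) (mul_left_cancel₀ h0 h2)
  obtain ⟨N, hN⟩ := Real.Angle.angle_eq_iff_two_pi_dvd_sub.1 this
  exact ⟨N, by linarith⟩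

/-- The sign of the orientation of the `j`-th sector: the sectors with odd numbers are
reflected. -/
noncomputable def sgn (j : ℤ) : ℝ := if Even j then 1 else -1

/-- The isometry of the hyperbolic plane which fixes `i` and takes the sector with angle `π / n`
around the positive real axis (in the Klein model) to the `j`-th sector. -/
noncomputable def spin (n : ℕ) (j : ℤ) : ℍ ≃ᵢ ℍ :=
  (if Even j then IsometryEquiv.refl ℍ else mirrorIso).trans
    (IsometryEquiv.constSMul (rotation (halfAngle n * j)))

theorem spin_apply_of_even (n : ℕ) {j : ℤ} (hj : Even j) (w : ℍ) :
    spin n j w = rotation (halfAngle n * j) • w := by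
  rw [spin, if_pos hj]; rfl

theorem spin_apply_of_odd (n : ℕ) {j : ℤ} (hj : ¬ Even j) (w : ℍ) :
    spin n j w = rotation (halfAngle n * j) • mirror w := by
  rw [spin, if_neg hj]; rfl

theorem hypTime_spin (n : ℕ) (j : ℤ) (w : ℍ) : hypTime (spin n j w) = hypTime w := by
  by_cases hj : Even j
  · rw [spin_apply_of_even n hj, (hyp_rotation _ _).1]
  · rw [spin_apply_of_odd n hj, (hyp_rotation _ _).1, (hyp_mirror _).1]

theorem Polar.spin {w : ℍ} {r θ : ℝ} (h : Polar w r θ) (n : ℕ) (j : ℤ) :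
    Polar (spin n j w) r (2 * halfAngle n * j + sgn j * θ) := by
  unfold Polar
  rw [hypTime_spin]
  by_cases hj : Even j
  · obtain ⟨h0, h1, h2⟩ := hyp_rotation (halfAngle n * j) w
    rw [spin_apply_of_even n hj, sgn, if_pos hj, one_mul, Real.cos_add, Real.sin_add, h1, h2, h.1,
      h.2, mul_assoc 2]
    constructor <;> ring
  · obtain ⟨h0, h1, h2⟩ := hyp_rotation (halfAngle n * j) (mirror w)
    obtain ⟨m0, m1, m2⟩ := hyp_mirror w
    rw [spin_apply_of_odd n hj, sgn, if_neg hj, Real.cos_add, Real.sin_add, h1, h2, m1, m2, h.1,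
      h.2, mul_assoc 2, neg_one_mul, Real.cos_neg, Real.sin_neg]
    constructor <;> ring

theorem sgn_add_one (j : ℤ) : sgn (j + 1) = -sgn j := by
  unfold sgn
  by_cases h : Even j
  · rw [if_pos h, if_neg (by simpa [Int.even_add_one] using h)]
  · rw [if_neg h, if_pos (by simpa [Int.even_add_one] using h), neg_neg]

theorem sgn_add_even (j k : ℤ) : sgn (j + 2 * k) = sgn j := by
  have : Even (j + 2 * k) ↔ Even j := by simp [Int.even_add]
  unfold sgn
  simp only [this]

theorem sgn_cases (j : ℤ) : sgn j = 1 ∨ sgn j = -1 := by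
  unfold sgn
  split_ifs <;> simp

theorem spin_add_period {n : ℕ} (hn : 4 ≤ n) (j N : ℤ) (w : ℍ) :
    spin n (j + 2 * n * N) w = spin n j w := by
  obtain ⟨r, θ, -, -, -, h⟩ := exists_polar w
  have h1 := h.spin n (j + 2 * n * N)
  have h2 := h.spin n j
  have hp := two_mul_halfAngle hn
  have e : 2 * halfAngle n * ((j + 2 * n * N : ℤ) : ℝ) + sgn (j + 2 * n * N) * θ =
      2 * halfAngle n * j + sgn j * θ + N * (2 * Real.pi) := by
    rw [mul_assoc 2 (n : ℤ), sgn_add_even, ← hp]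
    push_cast
    ring
  rw [e] at h1
  unfold Polar at h1
  rw [Real.cos_add_int_mul_two_pi, Real.sin_add_int_mul_two_pi] at h1
  exact Polar.eq h1 h2

/-! ### Placing the triangle around a vertex -/

/-- The isometry which takes the `0`-th vertex of the triangle to `i` and the ray to the centre of
the triangle to the positive real axis of the Klein model. -/
noncomputable def boost (n : ℕ) : SL(2, ℝ) :=
  ⟨!![0, Real.exp (circumradius n / 2); -Real.exp (-(circumradius n / 2)), 0], by
    rw [Matrix.det_fin_two_of, Real.exp_neg]
    have := (Real.exp_pos (circumradius n / 2)).ne'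
    field_simp
    ring⟩

theorem hyp_boost (n : ℕ) (z : ℍ) :
    hypTime (boost n • z) = ch n * hypTime z - sh n * hypFst z ∧
    hypFst (boost n • z) = sh n * hypTime z - ch n * hypFst z ∧
    hypSnd (boost n • z) = -hypSnd z := by
  obtain ⟨h1, h2, h3⟩ := sl_smul_hyp (boost n) z
  have e1 : boost n 0 0 = 0 := rfl
  have e2 : boost n 0 1 = Real.exp (circumradius n / 2) := rfl
  have e3 : boost n 1 0 = -Real.exp (-(circumradius n / 2)) := rfl
  have e4 : boost n 1 1 = 0 := rfl
  have f1 : Real.exp (circumradius n / 2) ^ 2 = Real.exp (circumradius n) := by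
    rw [← Real.exp_nat_mul]; congr 1; push_cast; ring
  have f2 : Real.exp (-(circumradius n / 2)) ^ 2 = Real.exp (-circumradius n) := by
    rw [← Real.exp_nat_mul]; congr 1; push_cast; ring
  have f3 : Real.exp (circumradius n / 2) * Real.exp (-(circumradius n / 2)) = 1 := by
    rw [← Real.exp_add, add_neg_cancel, Real.exp_zero]
  rw [e1, e2, f1] at h1
  rw [e3, e4, neg_sq, f2] at h2
  rw [e1, e2, e3, e4] at h3
  rw [ch, sh, Real.cosh_eq, Real.sinh_eq]
  refine ⟨?_, ?_, ?_⟩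
  · linear_combination h1 / 2 + h2 / 2
  · linear_combination h1 / 2 - h2 / 2
  · linear_combination h3 - hypSnd z * f3

/-- The isometry which takes the `i`-th vertex of the triangle to `i` and the ray to the centre of
the triangle to the positive real axis of the Klein model. -/
noncomputable def toVertex (n : ℕ) (i : ZMod 3) : SL(2, ℝ) :=
  boost n * rotation (-(Real.pi * (i.val : ℝ) / 3))

theorem bary_rotation (n : ℕ) (i l : ZMod 3) (z : ℍ) :
    bary n l (rotation (-(Real.pi * (i.val : ℝ) / 3)) • z) = bary n (l + i) z := by
  obtain ⟨h0, h1, h2⟩ := hyp_rotation (-(Real.pi * (i.val : ℝ) / 3)) z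
  obtain ⟨hc, hs⟩ := cos_sin_third i
  have h3 := sqrt_three_sq
  rw [mul_neg, Real.cos_neg, Real.sin_neg, hc, hs] at h1 h2
  have d0 : (1 : ZMod 3) ≠ 0 := by decide
  have d1 : (2 : ZMod 3) ≠ 0 := by decide
  have d2 : (2 : ZMod 3) ≠ 1 := by decide
  have a1 : (1 : ZMod 3) + 1 = 2 := rfl
  have a2 : (2 : ZMod 3) + 1 = 0 := rfl
  have a3 : (1 : ZMod 3) + 2 = 0 := rfl
  have a4 : (2 : ZMod 3) + 2 = 1 := rfl
  revert i l
  simp only [forall_zmod3]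
  refine ⟨⟨?_, ?_, ?_⟩, ⟨?_, ?_, ?_⟩, ⟨?_, ?_, ?_⟩⟩ <;> intro h0 h1 h2 hc hs <;>
    simp only [d0, d1, d2, a1, a2, a3, a4, zero_add, add_zero, if_true, if_false, bary_zero,
      bary_one, bary_two, h0, h1, h2] <;> clear h0 h1 h2 hc hs
  all_goals first
    | ring1
    | linear_combination (-ch n * hypFst z / 2) * h3
    | linear_combination (ch n * hypFst z / 2) * h3

/-- The barycentric coordinates after moving the `i`-th vertex to `i`. -/
theorem bary_eq_toVertex (n : ℕ) (i : ZMod 3) (p : ℍ) :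
    bary n i p = 3 * sh n * ch n * hypTime (toVertex n i • p)
      - (sh n ^ 2 + 2 * ch n ^ 2) * hypFst (toVertex n i • p) ∧
    bary n (i + 1) p = hypFst (toVertex n i • p) - √3 * ch n * hypSnd (toVertex n i • p) ∧
    bary n (i + 2) p = hypFst (toVertex n i • p) + √3 * ch n * hypSnd (toVertex n i • p) := by
  have h := bary_rotation n i
  set z := rotation (-(Real.pi * (i.val : ℝ) / 3)) • p with hz
  have e : toVertex n i • p = boost n • z := by rw [toVertex, mul_smul]
  obtain ⟨h0, h1, h2⟩ := hyp_boost n z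
  have hc := ch_sq n
  rw [e, h0, h1, h2]
  refine ⟨?_, ?_, ?_⟩
  · have := h 0 p
    rw [zero_add, ← hz, bary_zero] at this
    rw [← this]
    linear_combination (sh n * hypTime z + 2 * ch n * hypFst z) * (-hc)
  · rw [add_comm, ← h 1 p, ← hz, bary_one]
    ring
  · rw [add_comm, ← h 2 p, ← hz, bary_two]
    ring

theorem Polar.bary {n : ℕ} (hn : 4 ≤ n) {i : ZMod 3} {p : ℍ} {r θ : ℝ}
    (h : Polar (toVertex n i • p) r θ) :
    Real.sin (halfAngle n) * bary n (i + 1) p =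
      hypTime (toVertex n i • p) * r * Real.sin (halfAngle n - θ) ∧
    Real.sin (halfAngle n) * bary n (i + 2) p =
      hypTime (toVertex n i • p) * r * Real.sin (halfAngle n + θ) := by
  obtain ⟨-, h1, h2⟩ := bary_eq_toVertex n i p
  have hm := ch_mul hn
  rw [h1, h2, h.1, h.2, Real.sin_sub, Real.sin_add, ← hm]
  constructor <;> ring

theorem exists_polar_of_mem_triangle {n : ℕ} (hn : 4 ≤ n) (i : ZMod 3) {p : ℍ}
    (h1 : 0 ≤ bary n (i + 1) p) (h2 : 0 ≤ bary n (i + 2) p) :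
    ∃ r θ, 0 ≤ r ∧ |θ| ≤ halfAngle n ∧ Polar (toVertex n i • p) r θ := by
  obtain ⟨r, θ, hr, hθ1, hθ2, h⟩ := exists_polar (toVertex n i • p)
  have hφ := halfAngle_pos hn
  have hφ' := halfAngle_lt hn
  rcases hr.eq_or_lt with rfl | hr'
  · refine ⟨0, 0, le_rfl, by simpa using hφ.le, ?_⟩
    unfold Polar at h ⊢
    simpa using h
  refine ⟨r, θ, hr, ?_, h⟩
  obtain ⟨e1, e2⟩ := h.bary hn
  have hT := hypTime_pos (toVertex n i • p)
  have hs := sin_halfAngle_pos hn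
  have p1 : 0 ≤ Real.sin (halfAngle n - θ) := by
    have : 0 ≤ hypTime (toVertex n i • p) * r * Real.sin (halfAngle n - θ) := by
      rw [← e1]; positivity
    exact nonneg_of_mul_nonneg_right this (by positivity)
  have p2 : 0 ≤ Real.sin (halfAngle n + θ) := by
    have : 0 ≤ hypTime (toVertex n i • p) * r * Real.sin (halfAngle n + θ) := by
      rw [← e2]; positivity
    exact nonneg_of_mul_nonneg_right this (by positivity)
  rw [abs_le]
  constructor
  · by_contra! hlt
    have := Real.sin_neg_of_neg_of_neg_pi_lt (x := halfAngle n + θ) (by linarith) (by linarith)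
    linarith
  · by_contra! hlt
    have := Real.sin_neg_of_neg_of_neg_pi_lt (x := halfAngle n - θ) (by linarith) (by linarith)
    linarith

theorem Polar.bary_nonneg {n : ℕ} (hn : 4 ≤ n) {i : ZMod 3} {p : ℍ} {r θ : ℝ}
    (h : Polar (toVertex n i • p) r θ) (hr : 0 ≤ r) (hθ : |θ| ≤ halfAngle n) :
    0 ≤ TrivalentExpanders.bary n (i + 1) p ∧ 0 ≤ TrivalentExpanders.bary n (i + 2) p := by
  obtain ⟨e1, e2⟩ := h.bary hn
  have hT := hypTime_pos (toVertex n i • p)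
  have hs := sin_halfAngle_pos hn
  have hφ' := halfAngle_lt hn
  rw [abs_le] at hθ
  have p1 := Real.sin_nonneg_of_nonneg_of_le_pi (x := halfAngle n - θ) (by linarith) (by linarith)
  have p2 := Real.sin_nonneg_of_nonneg_of_le_pi (x := halfAngle n + θ) (by linarith) (by linarith)
  constructor
  · refine nonneg_of_mul_nonneg_right (a := Real.sin (halfAngle n)) ?_ hs
    rw [e1]; positivity
  · refine nonneg_of_mul_nonneg_right (a := Real.sin (halfAngle n)) ?_ hs
    rw [e2]; positivity

/-- The isometry which places the triangle, with its `i`-th vertex at `i`, into the `j`-th sector;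
consecutive sectors are mirror images of each other. -/
noncomputable def place (n : ℕ) (i : ZMod 3) (j : ℤ) : ℍ ≃ᵢ ℍ :=
  (IsometryEquiv.constSMul (toVertex n i)).trans (spin n j)

theorem place_apply (n : ℕ) (i : ZMod 3) (j : ℤ) (p : ℍ) :
    place n i j p = spin n j (toVertex n i • p) := rfl

theorem place_add_period {n : ℕ} (hn : 4 ≤ n) (i : ZMod 3) (j N : ℤ) (p : ℍ) :
    place n i (j + 2 * n * N) p = place n i j p := spin_add_period hn j N _

/-- The side of the triangle which the sectors `j` and `j + 1` around the `i`-th vertex have in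
common. -/
def sideAfter (i : ZMod 3) (j : ℤ) : ZMod 3 := if Even j then i + 1 else i + 2

theorem abs_sgn_mul (j : ℤ) (θ : ℝ) : |sgn j * θ| = |θ| := by
  rcases sgn_cases j with h | h <;> simp [h]

/-- On its common boundary with the next sector, the placement agrees with the next one. -/
theorem place_succ {n : ℕ} (hn : 4 ≤ n) {i : ZMod 3} {j : ℤ} {p : ℍ} (hp : p ∈ triangle n)
    (h : bary n (sideAfter i j) p = 0) : place n i (j + 1) p = place n i j p := by
  rw [mem_triangle_iff hn] at hp
  obtain ⟨r, θ, hr, hθ, hP⟩ := exists_polar_of_mem_triangle hn i (hp _) (hp _)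
  have hT := (hypTime_pos (toVertex n i • p)).ne'
  obtain ⟨e1, e2⟩ := hP.bary hn
  have hφ := halfAngle_pos hn
  have hφ' := halfAngle_lt hn
  have q1 := hP.spin n (j + 1)
  have q2 := hP.spin n j
  rw [place_apply, place_apply]
  rw [abs_le] at hθ
  rcases hr.eq_or_lt with rfl | hr'
  · unfold Polar at q1 q2
    simp only [mul_zero, zero_mul] at q1 q2
    apply klein_injective
    apply Complex.ext
    · rw [klein_re, klein_re, q1.1, q2.1, zero_div, zero_div]
    · rw [klein_im, klein_im, q1.2, q2.2, zero_div, zero_div]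
  · have hang : sgn j * θ = halfAngle n := by
      unfold sideAfter at h
      unfold sgn
      split_ifs at h ⊢ with hj
      · rw [h, mul_zero] at e1
        have := mul_left_cancel₀ (mul_ne_zero hT hr'.ne') (e1.symm.trans (mul_zero _).symm)
        have := (Real.sin_eq_zero_iff_of_lt_of_lt (by linarith) (by linarith)).1 this
        linarith
      · rw [h, mul_zero] at e2
        have := mul_left_cancel₀ (mul_ne_zero hT hr'.ne') (e2.symm.trans (mul_zero _).symm)
        have := (Real.sin_eq_zero_iff_of_lt_of_lt (by linarith) (by linarith)).1 this
        linarith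
    have e : 2 * halfAngle n * ((j + 1 : ℤ) : ℝ) + sgn (j + 1) * θ =
        2 * halfAngle n * j + sgn j * θ := by
      rw [sgn_add_one]
      push_cast
      linear_combination -2 * hang
    rw [e] at q1
    exact q1.eq q2

theorem bary_sideAfter_eq_zero {n : ℕ} (hn : 4 ≤ n) {i : ZMod 3} {j : ℤ} {p : ℍ} {r θ : ℝ}
    (h : Polar (toVertex n i • p) r θ) (hθ : sgn j * θ = halfAngle n) :
    bary n (sideAfter i j) p = 0 := by
  obtain ⟨e1, e2⟩ := h.bary hn
  have hs := (sin_halfAngle_pos hn).ne'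
  unfold sgn at hθ
  unfold sideAfter
  split_ifs at hθ ⊢ with hj
  · rw [one_mul] at hθ
    rw [hθ, sub_self, Real.sin_zero, mul_zero] at e1
    exact (mul_eq_zero.1 e1).resolve_left hs
  · have : halfAngle n + θ = 0 := by linarith
    rw [this, Real.sin_zero, mul_zero] at e2
    exact (mul_eq_zero.1 e2).resolve_left hs

/-- The placed triangles overlap only in their common boundaries. -/
theorem place_eq_place {n : ℕ} (hn : 4 ≤ n) {i : ZMod 3} {j k : ℤ} {p q : ℍ}
    (hp : p ∈ triangle n) (hq : q ∈ triangle n) (h : place n i j p = place n i k q) :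
    p = q ∧ ((bary n (i + 1) p = 0 ∧ bary n (i + 2) p = 0) ∨ ∃ N : ℤ, j = k + 2 * n * N ∨
      (j = k + 2 * n * N + 1 ∧ bary n (sideAfter i k) p = 0) ∨
      (k = j + 2 * n * N + 1 ∧ bary n (sideAfter i j) p = 0)) := by
  rw [mem_triangle_iff hn] at hp hq
  obtain ⟨r, θ, hr, hθ, hP⟩ := exists_polar_of_mem_triangle hn i (hp _) (hp _)
  obtain ⟨r', θ', hr', hθ', hQ⟩ := exists_polar_of_mem_triangle hn i (hq _) (hq _)
  have hφ := halfAngle_pos hn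
  have hpi := two_mul_halfAngle hn
  have q1 := hP.spin n j
  have q2 := hQ.spin n k
  rw [place_apply, place_apply] at h
  rw [h] at q1
  have hinj : Function.Injective fun z : ℍ => toVertex n i • z := MulAction.injective _
  obtain ⟨rfl, hN⟩ := q1.unique q2 hr hr'
  rcases hN with rfl | ⟨N, hN⟩
  · have hpq : p = q := by
      apply hinj
      refine Polar.eq (r := 0) (θ := 0) ?_ ?_
      · unfold Polar at hP ⊢; simpa using hP
      · unfold Polar at hQ ⊢; simpa using hQ
    obtain ⟨e1, e2⟩ := hP.bary hn
    have hs := (sin_halfAngle_pos hn).ne'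
    simp only [mul_zero, zero_mul] at e1 e2
    exact ⟨hpq, Or.inl ⟨(mul_eq_zero.1 e1).resolve_left hs, (mul_eq_zero.1 e2).resolve_left hs⟩⟩
  · have hM : 2 * halfAngle n * ((j - k - 2 * n * N : ℤ) : ℝ) = sgn k * θ' - sgn j * θ := by
      push_cast
      rw [← hpi] at hN
      linear_combination hN
    have b1 := abs_le.1 ((abs_sgn_mul j θ).trans_le hθ)
    have b2 := abs_le.1 ((abs_sgn_mul k θ').trans_le hθ')
    have l1 : ((j - k - 2 * n * N : ℤ) : ℝ) ≤ 1 := by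
      by_contra! hc
      nlinarith
    have l2 : (-1 : ℝ) ≤ ((j - k - 2 * n * N : ℤ) : ℝ) := by
      by_contra! hc
      nlinarith
    have l1' : j - k - 2 * n * N ≤ 1 := by exact_mod_cast l1
    have l2' : -1 ≤ j - k - 2 * n * N := by exact_mod_cast l2
    obtain hc | hc | hc : j = k + 2 * n * N ∨ j = k + 2 * n * N + 1 ∨ k = j + 2 * n * (-N) + 1 := by
      have : 2 * (n : ℤ) * (-N) = -(2 * n * N) := by ring
      rw [this]
      omega
    · have hz : j - k - 2 * n * N = 0 := by omega
      have hsg : sgn j = sgn k := by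
        rw [hc, mul_assoc 2 (n : ℤ), sgn_add_even]
      rw [hz, hsg, Int.cast_zero, mul_zero] at hM
      have hs0 : sgn k ≠ 0 := by rcases sgn_cases k with h | h <;> rw [h] <;> norm_num
      have : θ' = θ := mul_left_cancel₀ hs0 (sub_eq_zero.1 hM.symm)
      rw [this] at hQ
      exact ⟨hinj (hP.eq hQ), Or.inr ⟨N, Or.inl hc⟩⟩
    · have hz : j - k - 2 * n * N = 1 := by omega
      have hsg : sgn j = -sgn k := by
        rw [hc, sgn_add_one, mul_assoc 2 (n : ℤ), sgn_add_even]
      rw [hz, Int.cast_one, mul_one] at hM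
      have t2 : sgn k * θ' = halfAngle n := by linarith
      have t1 : sgn k * θ = halfAngle n := by rw [hsg] at hM b1; linarith
      have hs0 : sgn k ≠ 0 := by rcases sgn_cases k with h | h <;> rw [h] <;> norm_num
      have : θ' = θ := mul_left_cancel₀ hs0 (t2.trans t1.symm)
      rw [this] at hQ
      exact ⟨hinj (hP.eq hQ), Or.inr ⟨N, Or.inr (Or.inl ⟨hc, bary_sideAfter_eq_zero hn hP t1⟩)⟩⟩
    · have hz : j - k - 2 * n * N = -1 := by
        have : 2 * (n : ℤ) * (-N) = -(2 * n * N) := by ring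
        omega
      have hsg : sgn k = -sgn j := by
        rw [hc, sgn_add_one, mul_assoc 2 (n : ℤ), sgn_add_even]
      rw [hz] at hM
      push_cast at hM
      have t1 : sgn j * θ = halfAngle n := by linarith
      have t2 : sgn j * θ' = halfAngle n := by rw [hsg] at hM b2; linarith
      have hs0 : sgn j ≠ 0 := by rcases sgn_cases j with h | h <;> rw [h] <;> norm_num
      have : θ' = θ := mul_left_cancel₀ hs0 (t2.trans t1.symm)
      rw [this] at hQ
      exact ⟨hinj (hP.eq hQ), Or.inr ⟨-N, Or.inr (Or.inr ⟨hc, bary_sideAfter_eq_zero hn hP t1⟩)⟩⟩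

theorem exists_place_eq {n : ℕ} (hn : 4 ≤ n) (i : ZMod 3) (z : ℍ) :
    ∃ (j : ℤ) (p : ℍ), place n i j p = z ∧ 0 ≤ bary n (i + 1) p ∧ 0 ≤ bary n (i + 2) p := by
  obtain ⟨r, θ, hr, -, -, hP⟩ := exists_polar z
  have hφ := halfAngle_pos hn
  set j := round (θ / (2 * halfAngle n)) with hj
  have hround := abs_sub_round (θ / (2 * halfAngle n))
  rw [← hj] at hround
  have hψ : |θ - 2 * halfAngle n * j| ≤ halfAngle n := by
    have e : θ - 2 * halfAngle n * j = 2 * halfAngle n * (θ / (2 * halfAngle n) - j) := by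
      field_simp
    rw [e, abs_mul, abs_of_pos (by positivity)]
    nlinarith
  set ψ := sgn j * (θ - 2 * halfAngle n * j) with hψ'
  obtain ⟨w, hw⟩ : ∃ w, Polar w r ψ := by
    refine ⟨rotation ((ψ - θ) / 2) • z, ?_⟩
    obtain ⟨h0, h1, h2⟩ := hyp_rotation ((ψ - θ) / 2) z
    have e : ψ = 2 * ((ψ - θ) / 2) + θ := by ring
    unfold Polar
    rw [h0, h1, h2, hP.1, hP.2]
    constructor
    · conv_rhs => rw [e, Real.cos_add]
      ring
    · conv_rhs => rw [e, Real.sin_add]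
      ring
  refine ⟨j, (toVertex n i)⁻¹ • w, ?_, ?_⟩
  · rw [place_apply, smul_inv_smul]
    have q := hw.spin n j
    have hs : sgn j * sgn j = 1 := by rcases sgn_cases j with h | h <;> rw [h] <;> norm_num
    have e : 2 * halfAngle n * j + sgn j * ψ = θ := by
      rw [hψ']
      linear_combination (θ - 2 * halfAngle n * j) * hs
    rw [e] at q
    exact q.eq hP
  · refine Polar.bary_nonneg hn (r := r) (θ := ψ) (by rwa [smul_inv_smul]) hr ?_
    rw [hψ', abs_sgn_mul]
    exact hψ

/-! ### Regular polygons around a vertex -/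

/-- A linear functional on the hyperboloid model; its level sets are perpendicular to the ray from
`i` with angle `a`. -/
noncomputable def height (a : ℝ) (z : ℍ) : ℝ := Real.cos a * hypFst z + Real.sin a * hypSnd z

theorem Polar.height {z : ℍ} {r θ : ℝ} (h : Polar z r θ) (a : ℝ) :
    height a z = hypTime z * r * Real.cos (θ - a) := by
  rw [TrivalentExpanders.height, h.1, h.2, Real.cos_sub]
  ring

theorem continuous_height (a : ℝ) : Continuous (height a) := by
  have h1 := continuous_hypFst
  have h2 := continuous_hypSnd
  unfold height
  fun_prop

/-- Among the directions at the multiples of `2 * halfAngle n`, the direction `0` is the nearest to an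
angle of absolute value at most `halfAngle n`. -/
theorem cos_sub_le {n : ℕ} (hn : 4 ≤ n) {θ : ℝ} (hθ : |θ| ≤ halfAngle n) (k : ℤ) :
    Real.cos (θ - 2 * halfAngle n * k) ≤ Real.cos θ := by
  have hpi := two_mul_halfAngle hn
  have hφ := halfAngle_pos hn
  have hn' : (0 : ℤ) < 2 * n := by positivity
  set k' := k % (2 * n) with hk'
  have h0 : 0 ≤ k' := Int.emod_nonneg _ hn'.ne'
  have h1 : k' < 2 * n := Int.emod_lt_of_pos _ hn'
  have hk : k = k' + 2 * n * (k / (2 * n)) := (Int.emod_add_mul_ediv k (2 * n)).symm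
  have e : θ - 2 * halfAngle n * k =
      θ - 2 * halfAngle n * k' - (k / (2 * n) : ℤ) * (2 * Real.pi) := by
    conv_lhs => rw [hk]
    rw [← hpi]
    push_cast
    ring
  rw [e, Real.cos_sub_int_mul_two_pi]
  rw [abs_le] at hθ
  rcases h0.eq_or_lt with h | h
  · rw [← h]; simp
  · have h3 : (1 : ℝ) ≤ k' := by exact_mod_cast h
    have h4 : (k' : ℝ) + 1 ≤ 2 * n := by exact_mod_cast h1
    have s1 : 0 ≤ Real.sin (halfAngle n * k') := by
      apply Real.sin_nonneg_of_nonneg_of_le_pi (by positivity)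
      nlinarith
    have s2 : 0 ≤ Real.sin (halfAngle n * k' - θ) := by
      apply Real.sin_nonneg_of_nonneg_of_le_pi <;> nlinarith
    have e2 : Real.cos (θ - 2 * halfAngle n * k') - Real.cos θ =
        -2 * (Real.sin (halfAngle n * k' - θ) * Real.sin (halfAngle n * k')) := by
      rw [Real.cos_sub_cos, show (θ - 2 * halfAngle n * k' + θ) / 2 = -(halfAngle n * k' - θ) by ring,
        show (θ - 2 * halfAngle n * k' - θ) / 2 = -(halfAngle n * k') by ring, Real.sin_neg,
        Real.sin_neg]
      ring
    nlinarith [mul_nonneg s2 s1]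

theorem forall_int_iff_of_periodic {m : ℕ} (hm : 0 < m) {P : ℤ → Prop}
    (hP : ∀ j N : ℤ, P (j + m * N) ↔ P j) : (∀ j, P j) ↔ ∀ j : Fin m, P (j : ℕ) := by
  refine ⟨fun h j => h _, fun h j => ?_⟩
  have hm' : (0 : ℤ) < m := by exact_mod_cast hm
  have h0 := Int.emod_nonneg j hm'.ne'
  have h1 := Int.emod_lt_of_pos j hm'
  have := h ⟨(j % m).toNat, by omega⟩
  rw [← Int.emod_add_mul_ediv j m, hP]
  rwa [show ((⟨(j % m).toNat, by omega⟩ : Fin m) : ℕ) = (j % m).toNat from rfl,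
    Int.toNat_of_nonneg h0] at this

theorem height_add_period {n : ℕ} (hn : 4 ≤ n) (a : ℝ) (j N : ℤ) (z : ℍ) :
    height (2 * halfAngle n * ((j + (2 * n : ℕ) * N : ℤ) : ℝ) + a) z =
      height (2 * halfAngle n * j + a) z := by
  have hpi := two_mul_halfAngle hn
  have e : 2 * halfAngle n * ((j + (2 * n : ℕ) * N : ℤ) : ℝ) + a =
      2 * halfAngle n * j + a + N * (2 * Real.pi) := by
    rw [← hpi]
    push_cast
    ring
  unfold height
  rw [e, Real.cos_add_int_mul_two_pi, Real.sin_add_int_mul_two_pi]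

/-- The interior of the regular `2 n`-gon formed by the triangles around a vertex, moved to `i`: each
inequality is a half plane bounded by the side of a triangle opposite to `i`. The index `j` only
matters modulo `2 n`. -/
def starRegion (n : ℕ) : Set ℍ := {z | ∀ j : ℤ, (sh n ^ 2 + 2 * ch n ^ 2) *
  height (2 * halfAngle n * j + 0) z < 3 * sh n * ch n * hypTime z}

theorem isOpen_starRegion {n : ℕ} (hn : 4 ≤ n) : IsOpen (starRegion n) := by
  have : starRegion n = ⋂ j : Fin (2 * n), {z | (sh n ^ 2 + 2 * ch n ^ 2) *
      height (2 * halfAngle n * ((j : ℕ) : ℤ) + 0) z < 3 * sh n * ch n * hypTime z} := by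
    ext z
    rw [Set.mem_iInter]
    exact forall_int_iff_of_periodic (by omega) fun j N => by rw [height_add_period hn 0]
  rw [this]
  refine isOpen_iInter_of_finite fun j => isOpen_lt ?_ ?_
  · exact continuous_const.mul (continuous_height _)
  · exact continuous_const.mul continuous_hypTime

theorem place_mem_starRegion_iff {n : ℕ} (hn : 4 ≤ n) {i : ZMod 3} {j : ℤ} {p : ℍ}
    (h1 : 0 ≤ bary n (i + 1) p) (h2 : 0 ≤ bary n (i + 2) p) :
    place n i j p ∈ starRegion n ↔ 0 < bary n i p := by
  obtain ⟨r, θ, hr, hθ, hP⟩ := exists_polar_of_mem_triangle hn i h1 h2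
  obtain ⟨e, -, -⟩ := bary_eq_toVertex n i p
  have hT := hypTime_pos (toVertex n i • p)
  have hQ := hP.spin n j
  have hc := ch_pos n
  have key : ∀ l : ℤ, height (2 * halfAngle n * l + 0) (place n i j p) =
      hypTime (toVertex n i • p) * r * Real.cos (sgn j * θ - 2 * halfAngle n * (l - j : ℤ)) := by
    intro l
    rw [place_apply, hQ.height, hypTime_spin]
    congr 2
    push_cast
    ring
  have hcos : Real.cos (sgn j * θ) = Real.cos θ := by
    rcases sgn_cases j with h | h <;> rw [h] <;> simp
  have hbary : bary n i p = 3 * sh n * ch n * hypTime (toVertex n i • p)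
      - (sh n ^ 2 + 2 * ch n ^ 2) * (hypTime (toVertex n i • p) * r * Real.cos θ) := by
    rw [e, hP.1]
  have hTp : hypTime (place n i j p) = hypTime (toVertex n i • p) := hypTime_spin _ _ _
  constructor
  · intro h
    have := h j
    rw [key, hTp, sub_self, Int.cast_zero, mul_zero, sub_zero, hcos] at this
    linarith
  · intro h l
    rw [key, hTp]
    have hle := cos_sub_le hn ((abs_sgn_mul j θ).trans_le hθ) (l - j)
    rw [hcos] at hle
    have : (sh n ^ 2 + 2 * ch n ^ 2) * (hypTime (toVertex n i • p) * r *
        Real.cos (sgn j * θ - 2 * halfAngle n * (l - j : ℤ))) ≤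
        (sh n ^ 2 + 2 * ch n ^ 2) * (hypTime (toVertex n i • p) * r * Real.cos θ) := by gcongr
    linarith

theorem exists_place_of_mem_starRegion {n : ℕ} (hn : 4 ≤ n) (i : ZMod 3) {z : ℍ}
    (hz : z ∈ starRegion n) : ∃ j p, p ∈ triangle n ∧ 0 < bary n i p ∧ place n i j p = z := by
  obtain ⟨j, p, rfl, h1, h2⟩ := exists_place_eq hn i z
  have h0 := (place_mem_starRegion_iff hn h1 h2).1 hz
  exact ⟨j, p, (mem_triangle_iff hn).2 ((forall_zmod3' i).2 ⟨h0.le, h1, h2⟩), h0, rfl⟩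

/-- The interior of the regular `2 n`-gon whose vertices are the centres of the triangles around a
vertex. -/
def faceRegion (n : ℕ) : Set ℍ := {z | ∀ j : ℤ, ch n *
  height (2 * halfAngle n * j + halfAngle n) z < sh n * Real.cos (halfAngle n) * hypTime z}

/-- The closed regular `2 n`-gon whose vertices are the centres of the triangles around a
vertex. -/
def closedFaceRegion (n : ℕ) : Set ℍ := {z | ∀ j : ℤ, ch n *
  height (2 * halfAngle n * j + halfAngle n) z ≤ sh n * Real.cos (halfAngle n) * hypTime z}

theorem cos_face_le {n : ℕ} (hn : 4 ≤ n) {θ : ℝ} (hθ : |θ| ≤ halfAngle n) (m : ℤ) :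
    Real.cos (θ - (2 * halfAngle n * m + halfAngle n)) ≤ Real.cos (θ - halfAngle n) ∨
    Real.cos (θ - (2 * halfAngle n * m + halfAngle n)) ≤ Real.cos (θ + halfAngle n) := by
  rw [abs_le] at hθ
  have hφ := halfAngle_pos hn
  rcases le_total 0 θ with h | h
  · left
    have := cos_sub_le hn (θ := θ - halfAngle n) (abs_le.2 ⟨by linarith, by linarith⟩) m
    rwa [sub_sub, add_comm] at this
  · right
    have := cos_sub_le hn (θ := θ + halfAngle n) (abs_le.2 ⟨by linarith, by linarith⟩) (m + 1)
    convert this using 2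
    push_cast
    ring

/-- Membership in the polygon, tested on the two sides nearest to the sector of the point. The
relation `R` is `<` for the open and `≤` for the closed polygon. -/
theorem forall_height_iff {n : ℕ} (hn : 4 ≤ n) {i : ZMod 3} {j : ℤ} {p : ℍ}
    (h1 : 0 ≤ bary n (i + 1) p) (h2 : 0 ≤ bary n (i + 2) p) {R : ℝ → ℝ → Prop}
    (hR : ∀ {a b c}, a ≤ b → R b c → R a c) {c : ℝ}
    (hRc : ∀ l, l = i + 1 ∨ l = i + 2 → (R (bary n l p) (bary n i p) ↔
      R (sh n * Real.cos (halfAngle n) * hypTime (place n i j p) -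
        Real.cos (halfAngle n) * (bary n i p - bary n l p) / (3 * ch n)) c)) :
    (∀ l : ℤ, R (ch n * height (2 * halfAngle n * l + halfAngle n) (place n i j p)) c) ↔
      R (bary n (i + 1) p) (bary n i p) ∧ R (bary n (i + 2) p) (bary n i p) := by
  obtain ⟨r, θ, hr, hθ, hP⟩ := exists_polar_of_mem_triangle hn i h1 h2
  obtain ⟨e0, e1, e2⟩ := bary_eq_toVertex n i p
  have hT := hypTime_pos (toVertex n i • p)
  have hQ := hP.spin n j
  have hc := ch_pos n
  have hm := ch_mul hn
  have hsq := ch_sq n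
  have h3 := sqrt_three_sq
  have key : ∀ l : ℤ, height (2 * halfAngle n * l + halfAngle n) (place n i j p) =
      hypTime (toVertex n i • p) * r *
        Real.cos (sgn j * θ - (2 * halfAngle n * (l - j : ℤ) + halfAngle n)) := by
    intro l
    rw [place_apply, hQ.height, hypTime_spin]
    congr 2
    push_cast
    ring
  have hTp : hypTime (place n i j p) = hypTime (toVertex n i • p) := hypTime_spin _ _ _
  have a1 : sh n * Real.cos (halfAngle n) * hypTime (place n i j p) -
      Real.cos (halfAngle n) * (bary n i p - bary n (i + 1) p) / (3 * ch n) =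
      ch n * (hypTime (toVertex n i • p) * r * Real.cos (θ + halfAngle n)) := by
    rw [hTp, e0, e1, hP.1, hP.2, Real.cos_add]
    field_simp
    rw [← hm]
    ring_nf
    rw [show sh n ^ 2 = ch n ^ 2 - 1 by linarith, Real.sq_sqrt (by norm_num : (0 : ℝ) ≤ 3)]
    ring
  have a2 : sh n * Real.cos (halfAngle n) * hypTime (place n i j p) -
      Real.cos (halfAngle n) * (bary n i p - bary n (i + 2) p) / (3 * ch n) =
      ch n * (hypTime (toVertex n i • p) * r * Real.cos (θ - halfAngle n)) := by
    rw [hTp, e0, e2, hP.1, hP.2, Real.cos_sub]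
    field_simp
    rw [← hm]
    ring_nf
    rw [show sh n ^ 2 = ch n ^ 2 - 1 by linarith, Real.sq_sqrt (by norm_num : (0 : ℝ) ≤ 3)]
    ring
  rw [hRc _ (Or.inl rfl), hRc _ (Or.inr rfl), a1, a2]
  have s1 : (∀ l : ℤ, R (ch n * height (2 * halfAngle n * l + halfAngle n) (place n i j p)) c) ↔
      R (ch n * (hypTime (toVertex n i • p) * r * Real.cos (sgn j * θ + halfAngle n))) c ∧
      R (ch n * (hypTime (toVertex n i • p) * r * Real.cos (sgn j * θ - halfAngle n))) c := by
    constructor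
    · intro h
      constructor
      · have := h (j - 1)
        rw [key] at this
        convert this using 5
        push_cast
        ring
      · have := h j
        rw [key] at this
        convert this using 5
        push_cast
        ring
    · rintro ⟨h1, h2⟩ l
      rw [key]
      rcases cos_face_le hn ((abs_sgn_mul j θ).trans_le hθ) (l - j) with h | h
      · exact hR (by gcongr) h2
      · exact hR (by gcongr) h1
  rw [s1]
  rcases sgn_cases j with h | h
  · rw [h, one_mul]
  · rw [h, neg_one_mul, ← Real.cos_neg (-θ + _), ← Real.cos_neg (-θ - _), and_comm]
    ring_nf

theorem place_mem_faceRegion_iff {n : ℕ} (hn : 4 ≤ n) {i : ZMod 3} {j : ℤ} {p : ℍ}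
    (h1 : 0 ≤ bary n (i + 1) p) (h2 : 0 ≤ bary n (i + 2) p) :
    place n i j p ∈ faceRegion n ↔ bary n (i + 1) p < bary n i p ∧ bary n (i + 2) p < bary n i p := by
  have hc := ch_pos n
  have hcos := cos_halfAngle_pos hn
  refine forall_height_iff hn h1 h2 (R := (· < ·)) (fun h h' => h.trans_lt h') fun l _ => ?_
  rw [sub_lt_self_iff, div_pos_iff_of_pos_right (by positivity), mul_pos_iff_of_pos_left hcos,
    sub_pos]

theorem place_mem_closedFaceRegion_iff {n : ℕ} (hn : 4 ≤ n) {i : ZMod 3} {j : ℤ} {p : ℍ}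
    (h1 : 0 ≤ bary n (i + 1) p) (h2 : 0 ≤ bary n (i + 2) p) :
    place n i j p ∈ closedFaceRegion n ↔
      bary n (i + 1) p ≤ bary n i p ∧ bary n (i + 2) p ≤ bary n i p := by
  have hc := ch_pos n
  have hcos := cos_halfAngle_pos hn
  refine forall_height_iff hn h1 h2 (R := (· ≤ ·)) (fun h h' => h.trans h') fun l _ => ?_
  rw [sub_le_self_iff, ← sub_nonneg (a := bary n i p)]
  constructor
  · intro h; positivity
  · intro h
    have := mul_nonneg h (by positivity : 0 ≤ 3 * ch n)
    rw [div_mul_cancel₀ _ (by positivity)] at this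
    exact nonneg_of_mul_nonneg_right this hcos

theorem closedFaceRegion_subset {n : ℕ} (hn : 4 ≤ n) : closedFaceRegion n ⊆ starRegion n := by
  intro z hz
  obtain ⟨j, p, rfl, h1, h2⟩ := exists_place_eq hn 0 z
  obtain ⟨h3, h4⟩ := (place_mem_closedFaceRegion_iff hn h1 h2).1 hz
  rw [place_mem_starRegion_iff hn h1 h2]
  have := sum_bary_pos hn 0 p
  linarith

/-! ### The faces as regular polygons -/

theorem rotation_smul_I (α : ℝ) : rotation α • UpperHalfPlane.I = UpperHalfPlane.I := by
  apply klein_injective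
  rw [klein_rotation, klein_I, mul_zero]

theorem hyp_boost_I (n : ℕ) : hypTime (boost n • UpperHalfPlane.I) = ch n ∧
    hypFst (boost n • UpperHalfPlane.I) = sh n ∧ hypSnd (boost n • UpperHalfPlane.I) = 0 := by
  obtain ⟨h0, h1, h2⟩ := hyp_boost n UpperHalfPlane.I
  obtain ⟨i0, i1, i2⟩ := hyp_I
  rw [i0, i1] at h0 h1
  rw [i2] at h2
  refine ⟨by linarith, by linarith, by linarith⟩

theorem boost_boost (n : ℕ) (z : ℍ) : boost n • boost n • z = z := by
  obtain ⟨h0, h1, h2⟩ := hyp_boost n z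
  obtain ⟨k0, k1, k2⟩ := hyp_boost n (boost n • z)
  rw [h0, h1] at k0 k1
  rw [h2, neg_neg] at k2
  have hc := ch_sq n
  have e0 : hypTime (boost n • boost n • z) = hypTime z := by
    linear_combination k0 + hypTime z * hc
  have e1 : hypFst (boost n • boost n • z) = hypFst z := by
    linear_combination k1 + hypFst z * hc
  apply klein_injective
  apply Complex.ext
  · rw [klein_re, klein_re, e0, e1]
  · rw [klein_im, klein_im, e0, k2]

theorem toVertex_smul_I (n : ℕ) (i : ZMod 3) :
    toVertex n i • UpperHalfPlane.I = boost n • UpperHalfPlane.I := by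
  rw [toVertex, mul_smul, rotation_smul_I]

theorem polar_boost_I (n : ℕ) : Polar (boost n • UpperHalfPlane.I) (sh n / ch n) 0 := by
  obtain ⟨h0, h1, h2⟩ := hyp_boost_I n
  have := (ch_pos n).ne'
  unfold Polar
  rw [h0, h1, h2, Real.cos_zero, Real.sin_zero]
  constructor
  · field_simp
  · ring

/-- The centres of the triangles around a vertex. -/
noncomputable def faceVertex (n : ℕ) (j : ℤ) : ℍ := spin n j (boost n • UpperHalfPlane.I)

theorem place_I (n : ℕ) (i : ZMod 3) (j : ℤ) :
    place n i j UpperHalfPlane.I = faceVertex n j := by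
  rw [place_apply, toVertex_smul_I, faceVertex]

theorem polar_faceVertex (n : ℕ) (j : ℤ) :
    Polar (faceVertex n j) (sh n / ch n) (2 * halfAngle n * j) := by
  have := (polar_boost_I n).spin n j
  rwa [mul_zero, add_zero] at this

theorem faceVertex_congr {n : ℕ} (hn : 4 ≤ n) {a b : ℤ}
    (h : (a : ZMod (2 * n)) = (b : ZMod (2 * n))) : faceVertex n a = faceVertex n b := by
  rw [ZMod.intCast_eq_intCast_iff_dvd_sub] at h
  obtain ⟨N, hN⟩ := h
  obtain rfl : b = a + 2 * n * N := by push_cast at hN; linarith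
  exact (spin_add_period hn a N _).symm

theorem range_faceVertex {n : ℕ} (hn : 4 ≤ n) :
    Set.range (fun j : ZMod (2 * n) => faceVertex n (j.val : ℤ)) = Set.range (faceVertex n) := by
  have : NeZero (2 * n) := ⟨by omega⟩
  apply Set.Subset.antisymm
  · rintro _ ⟨j, rfl⟩
    exact ⟨_, rfl⟩
  · rintro _ ⟨j, rfl⟩
    exact ⟨(j : ZMod (2 * n)), faceVertex_congr hn (by simp)⟩

theorem mem_closedFaceRegion_iff (n : ℕ) (z : ℍ) : z ∈ closedFaceRegion n ↔ ∀ j : ℤ, ch n *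
    (Real.cos (2 * halfAngle n * j + halfAngle n) * (klein z).re +
      Real.sin (2 * halfAngle n * j + halfAngle n) * (klein z).im) ≤
    sh n * Real.cos (halfAngle n) := by
  refine forall_congr' fun j => ?_
  have hT := hypTime_pos z
  rw [height, ← hypTime_mul_re, ← hypTime_mul_im]
  conv_rhs => rw [← mul_le_mul_iff_right₀ hT]
  apply iff_of_eq
  congr 1 <;> ring

theorem mem_faceRegion_iff (n : ℕ) (z : ℍ) : z ∈ faceRegion n ↔ ∀ j : ℤ, ch n *
    (Real.cos (2 * halfAngle n * j + halfAngle n) * (klein z).re +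
      Real.sin (2 * halfAngle n * j + halfAngle n) * (klein z).im) <
    sh n * Real.cos (halfAngle n) := by
  refine forall_congr' fun j => ?_
  have hT := hypTime_pos z
  rw [height, ← hypTime_mul_re, ← hypTime_mul_im]
  conv_rhs => rw [← mul_lt_mul_iff_right₀ hT]
  apply iff_of_eq
  congr 1 <;> ring

theorem faceVertex_mem (n : ℕ) (hn : 4 ≤ n) (l : ℤ) : faceVertex n l ∈ closedFaceRegion n := by
  rw [← place_I n 0, place_mem_closedFaceRegion_iff hn] <;> simp only [bary_I]
  · exact ⟨le_rfl, le_rfl⟩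
  · exact (sh_pos hn).le
  · exact (sh_pos hn).le

theorem hypHull_faceVertex {n : ℕ} (hn : 4 ≤ n) :
    hypHull (Set.range (faceVertex n)) = closedFaceRegion n := by
  have hC := ch_pos n
  have hS := sh_pos hn
  have hφ := halfAngle_pos hn
  have hφ' := halfAngle_lt hn
  have hpi := two_mul_halfAngle hn
  have hcos := cos_halfAngle_pos hn
  have hsin := sin_halfAngle_pos hn
  apply Set.Subset.antisymm
  · refine Set.sInter_subset_of_mem ⟨?_, ?_⟩
    · have : closedFaceRegion n = klein ⁻¹' ⋂ j : ℤ, {ζ : ℂ | ch n *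
          (Real.cos (2 * halfAngle n * j + halfAngle n) * ζ.re +
            Real.sin (2 * halfAngle n * j + halfAngle n) * ζ.im) ≤
          sh n * Real.cos (halfAngle n)} := by
        ext z
        rw [mem_closedFaceRegion_iff, Set.mem_preimage, Set.mem_iInter]
        rfl
      rw [this]
      refine hypConvex_preimage (convex_iInter fun j => convex_halfSpace_le ?_ _)
      constructor
      · intro a b; simp; ring
      · intro c a; simp; ring
    · rintro _ ⟨l, rfl⟩
      exact faceVertex_mem n hn l
  · intro z hz
    rw [hypHull_eq, Set.mem_preimage]
    set H := convexHull ℝ (klein '' Set.range (faceVertex n)) with hH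
    have hmem : ∀ j, klein (faceVertex n j) ∈ H :=
      fun j => subset_convexHull ℝ _ ⟨_, ⟨j, rfl⟩, rfl⟩
    have hconv : Convex ℝ H := convex_convexHull ℝ _
    have h0 : (0 : ℂ) ∈ H := by
      have := hconv (hmem 0) (hmem n) (a := 1 / 2) (b := 1 / 2) (by norm_num) (by norm_num)
        (by norm_num)
      rw [(polar_faceVertex n 0).klein_eq, (polar_faceVertex n n).klein_eq] at this
      convert this using 1
      have : 2 * halfAngle n * ((n : ℤ) : ℝ) = Real.pi := by exact_mod_cast hpi
      rw [this, Complex.exp_pi_mul_I]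
      simp
    obtain ⟨r, θ, hr, -, -, hP⟩ := exists_polar z
    set j := ⌊θ / (2 * halfAngle n)⌋ with hj
    have hf1 := Int.floor_le (θ / (2 * halfAngle n))
    have hf2 := Int.lt_floor_add_one (θ / (2 * halfAngle n))
    rw [← hj, le_div_iff₀ (by positivity)] at hf1
    rw [← hj, div_lt_iff₀ (by positivity)] at hf2
    set ψ := θ - 2 * halfAngle n * j with hψ
    have hs2 : Real.sin (2 * halfAngle n) = 2 * Real.sin (halfAngle n) * Real.cos (halfAngle n) :=
      Real.sin_two_mul _
    have hs2p : 0 < Real.sin (2 * halfAngle n) := by rw [hs2]; positivity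
    have ha0 : 0 ≤ Real.sin (2 * halfAngle n - ψ) :=
      Real.sin_nonneg_of_nonneg_of_le_pi (by linarith) (by linarith)
    have hb0 : 0 ≤ Real.sin ψ := Real.sin_nonneg_of_nonneg_of_le_pi (by linarith) (by linarith)
    have hle : ch n * (r * Real.cos (ψ - halfAngle n)) ≤ sh n * Real.cos (halfAngle n) := by
      have h := hz j
      rw [hP.height] at h
      have hT := hypTime_pos z
      have e : θ - (2 * halfAngle n * j + halfAngle n) = ψ - halfAngle n := by rw [hψ]; ring
      rw [e] at h
      rw [← mul_le_mul_iff_right₀ hT]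
      linarith
    set a := ch n * r * Real.sin (2 * halfAngle n - ψ) / (sh n * Real.sin (2 * halfAngle n)) with ha
    set b := ch n * r * Real.sin ψ / (sh n * Real.sin (2 * halfAngle n)) with hb
    have hab : a + b ≤ 1 := by
      rw [ha, hb, ← add_div, div_le_one (by positivity)]
      have e : Real.sin (2 * halfAngle n - ψ) + Real.sin ψ =
          2 * Real.sin (halfAngle n) * Real.cos (ψ - halfAngle n) := by
        rw [Real.sin_sub (2 * halfAngle n) ψ, Real.cos_sub ψ (halfAngle n), hs2, Real.cos_two_mul]
        have := Real.sin_sq_add_cos_sq (halfAngle n)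
        linear_combination (-2 * Real.sin ψ) * this
      calc ch n * r * Real.sin (2 * halfAngle n - ψ) + ch n * r * Real.sin ψ
          = 2 * Real.sin (halfAngle n) * (ch n * (r * Real.cos (ψ - halfAngle n))) := by
            rw [← mul_add, e]; ring
        _ ≤ 2 * Real.sin (halfAngle n) * (sh n * Real.cos (halfAngle n)) := by gcongr
        _ = _ := by rw [hs2]; ring
    have hcomb : klein z = a • klein (faceVertex n j) + b • klein (faceVertex n (j + 1)) +
        (1 - a - b) • (0 : ℂ) := by
      rw [hP.klein_eq, (polar_faceVertex n j).klein_eq, (polar_faceVertex n (j + 1)).klein_eq]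
      have e1 : θ = 2 * halfAngle n * j + ψ := by rw [hψ]; ring
      have e2 : 2 * halfAngle n * ((j + 1 : ℤ) : ℝ) = 2 * halfAngle n * j + 2 * halfAngle n := by
        push_cast; ring
      rw [e1, e2]
      have hs0 := hs2p.ne'
      have key1 : r * Real.cos ψ = a * (sh n / ch n) + b * (sh n / ch n) *
          Real.cos (2 * halfAngle n) := by
        rw [ha, hb, Real.sin_sub]
        field_simp
        ring
      have key2 : r * Real.sin ψ = b * (sh n / ch n) * Real.sin (2 * halfAngle n) := by
        rw [hb]
        field_simp
      apply Complex.ext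
      · simp only [Complex.add_re, Complex.smul_re, Complex.re_ofReal_mul,
          Complex.exp_ofReal_mul_I_re, smul_eq_mul, Complex.zero_re, mul_zero, Real.cos_add]
        linear_combination Real.cos (2 * halfAngle n * j) * key1 -
          Real.sin (2 * halfAngle n * j) * key2
      · simp only [Complex.add_im, Complex.smul_im, Complex.im_ofReal_mul,
          Complex.exp_ofReal_mul_I_im, smul_eq_mul, Complex.zero_im, mul_zero, Real.sin_add]
        linear_combination Real.sin (2 * halfAngle n * j) * key1 +
          Real.cos (2 * halfAngle n * j) * key2
    rw [hcomb]
    have hs3 : (Finset.univ : Finset (Fin 3)).sum (fun i => ![a, b, 1 - a - b] i) = 1 := by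
      rw [Fin.sum_univ_three]; simp
    have := hconv.sum_mem (t := (Finset.univ : Finset (Fin 3))) (w := ![a, b, 1 - a - b])
      (z := ![klein (faceVertex n j), klein (faceVertex n (j + 1)), 0]) ?_ hs3 ?_
    · rw [Fin.sum_univ_three] at this
      exact this
    · intro i _
      have p1 : 0 ≤ a := by rw [ha]; positivity
      have p2 : 0 ≤ b := by rw [hb]; positivity
      fin_cases i
      · exact p1
      · exact p2
      · change 0 ≤ 1 - a - b
        linarith
    · intro i _
      fin_cases i
      exacts [hmem _, hmem _, h0]

theorem interior_closedFaceRegion {n : ℕ} (hn : 4 ≤ n) :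
    interior (closedFaceRegion n) = faceRegion n := by
  have hC := ch_pos n
  set A : Fin (2 * n) → ℝ := fun j => 2 * halfAngle n * (((j : ℕ) : ℤ) : ℝ) + halfAngle n with hA
  set f : Fin (2 * n) → ℂ →L[ℝ] ℝ := fun j => (ch n * Real.cos (A j)) • Complex.reCLM +
    (ch n * Real.sin (A j)) • Complex.imCLM with hf
  have hfz : ∀ j z, hypTime z * f j (klein z) = ch n * height (A j) z := by
    intro j z
    simp only [hf, add_apply, smul_apply,
      Complex.reCLM_apply, Complex.imCLM_apply, smul_eq_mul]
    rw [height, ← hypTime_mul_re, ← hypTime_mul_im]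
    ring
  have hsurj : ∀ j, Function.Surjective (f j) := by
    intro j t
    refine ⟨⟨t / ch n * Real.cos (A j), t / ch n * Real.sin (A j)⟩, ?_⟩
    simp only [hf, add_apply, smul_apply,
      Complex.reCLM_apply, Complex.imCLM_apply, smul_eq_mul]
    have := Real.sin_sq_add_cos_sq (A j)
    field_simp
    linear_combination t * this
  have h1 : closedFaceRegion n = ⋂ j : Fin (2 * n),
      klein ⁻¹' (f j ⁻¹' Set.Iic (sh n * Real.cos (halfAngle n))) := by
    ext z
    rw [Set.mem_iInter]
    have e1 : z ∈ closedFaceRegion n ↔ ∀ j : Fin (2 * n), ch n * height (A j) z ≤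
        sh n * Real.cos (halfAngle n) * hypTime z :=
      forall_int_iff_of_periodic (by omega) fun j N => by rw [height_add_period hn]
    rw [e1]
    refine forall_congr' fun j => ?_
    rw [← hfz, mul_comm _ (hypTime z), mul_le_mul_iff_right₀ (hypTime_pos z)]
    rfl
  have h2 : faceRegion n = ⋂ j : Fin (2 * n),
      klein ⁻¹' (f j ⁻¹' Set.Iio (sh n * Real.cos (halfAngle n))) := by
    ext z
    rw [Set.mem_iInter]
    have e1 : z ∈ faceRegion n ↔ ∀ j : Fin (2 * n), ch n * height (A j) z <
        sh n * Real.cos (halfAngle n) * hypTime z :=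
      forall_int_iff_of_periodic (by omega) fun j N => by rw [height_add_period hn]
    rw [e1]
    refine forall_congr' fun j => ?_
    rw [← hfz, mul_comm _ (hypTime z), mul_lt_mul_iff_right₀ (hypTime_pos z)]
    rfl
  rw [h1, h2, interior_iInter_of_finite]
  refine Set.iInter_congr fun j => ?_
  rw [← isOpenMap_klein.preimage_interior_eq_interior_preimage continuous_klein,
    (f j).interior_preimage (hsurj j), interior_Iic]

theorem isOpen_faceRegion {n : ℕ} (hn : 4 ≤ n) : IsOpen (faceRegion n) := by
  rw [← interior_closedFaceRegion hn]
  exact isOpen_interior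

theorem hypConvex_faceRegion (n : ℕ) : HypConvex (faceRegion n) := by
  have : faceRegion n = klein ⁻¹' ⋂ j : ℤ, {ζ : ℂ | ch n *
      (Real.cos (2 * halfAngle n * j + halfAngle n) * ζ.re +
        Real.sin (2 * halfAngle n * j + halfAngle n) * ζ.im) <
      sh n * Real.cos (halfAngle n)} := by
    ext z
    rw [mem_faceRegion_iff, Set.mem_preimage, Set.mem_iInter]
    rfl
  rw [this]
  refine hypConvex_preimage (convex_iInter fun j => convex_halfSpace_lt ?_ _)
  constructor
  · intro a b; simp; ring
  · intro c a; simp; ring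

theorem angle_polar {r r' a b : ℝ} (hr : 0 < r) (hr' : 0 < r') (h : -Real.pi < a - b)
    (h' : a - b ≤ Real.pi) :
    InnerProductGeometry.angle ((r : ℂ) * Complex.exp (a * Complex.I))
      ((r' : ℂ) * Complex.exp (b * Complex.I)) = |a - b| := by
  have hr0 : (r : ℂ) ≠ 0 := by exact_mod_cast hr.ne'
  have hr0' : (r' : ℂ) ≠ 0 := by exact_mod_cast hr'.ne'
  rw [Complex.angle_eq_abs_arg (mul_ne_zero hr0 (Complex.exp_ne_zero _))
    (mul_ne_zero hr0' (Complex.exp_ne_zero _))]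
  congr 1
  have e : (r : ℂ) * Complex.exp (a * Complex.I) / (r' * Complex.exp (b * Complex.I)) =
      ((r / r' : ℝ) : ℂ) * (Complex.cos ((a - b : ℝ) : ℂ) +
        Complex.sin ((a - b : ℝ) : ℂ) * Complex.I) := by
    rw [← Complex.exp_mul_I, mul_div_mul_comm, ← Complex.exp_sub]
    push_cast
    ring_nf
  rw [e, Complex.arg_mul_cos_add_sin_mul_I (by positivity) ⟨h, h'⟩]

theorem isRegularPolygon_face {n : ℕ} (hn : 4 ≤ n) :
    IsRegularPolygon UpperHalfPlane.I (fun j : ZMod (2 * n) => faceVertex n (j.val : ℤ))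
      (2 * Real.pi / 3) := by
  have hC := ch_pos n
  have hS := sh_pos hn
  have hpi := two_mul_halfAngle hn
  have hsin := sin_halfAngle_pos hn
  have : NeZero (2 * n) := ⟨by omega⟩
  have h3 := sqrt_three_sq
  refine ⟨by omega, ⟨hypTime (boost n • UpperHalfPlane.I) /
      (hypTime (boost n • UpperHalfPlane.I) + 1) * (sh n / ch n), 0, ?_, fun j => ?_⟩, fun j => ?_⟩
  · have := hypTime_pos (boost n • UpperHalfPlane.I)
    positivity
  · rw [discCoord_I, (polar_faceVertex n _).klein_eq]
    have e1 : hypTime (faceVertex n (j.val : ℤ)) = hypTime (boost n • UpperHalfPlane.I) :=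
      hypTime_spin _ _ _
    have e2 : (0 + 2 * Real.pi * (j.val : ℝ) / ((2 * n : ℕ) : ℝ) : ℝ) =
        2 * halfAngle n * ((j.val : ℤ) : ℝ) := by
      rw [← hpi]
      have : (n : ℝ) ≠ 0 := by positivity
      push_cast
      field_simp
      ring
    rw [e1, e2, Complex.real_smul]
    push_cast
    ring
  · have e1 : faceVertex n (((j - 1).val : ℕ) : ℤ) = faceVertex n (j.val - 1) :=
      faceVertex_congr hn (by simp)
    have e2 : faceVertex n (((j + 1).val : ℕ) : ℤ) = faceVertex n (j.val + 1) :=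
      faceVertex_congr hn (by simp)
    change hypAngle (faceVertex n (((j - 1).val : ℕ) : ℤ)) (faceVertex n (j.val : ℤ))
      (faceVertex n (((j + 1).val : ℕ) : ℤ)) = _
    rw [e1, e2]
    have hv : ∀ l, faceVertex n l = rotation (halfAngle n * l) • boost n • UpperHalfPlane.I := by
      intro l
      by_cases hl : Even l
      · rw [faceVertex, spin_apply_of_even n hl]
      · rw [faceVertex, spin_apply_of_odd n hl]
        congr 1
        apply klein_injective
        rw [klein_mirror, (polar_boost_I n).klein_eq]
        simp
    set k : ℤ := (j.val : ℤ)
    have hrot : ∀ (a b : ℝ) (z : ℍ), rotation a • rotation b • z = rotation (a + b) • z := by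
      intro a b z
      apply klein_injective
      rw [klein_rotation, klein_rotation, klein_rotation, ← mul_assoc, ← Complex.exp_add]
      push_cast
      ring_nf
    have hrot0 : ∀ z : ℍ, rotation 0 • z = z := by
      intro z
      apply klein_injective
      rw [klein_rotation]
      simp
    have hg : (boost n * rotation (-(halfAngle n * k))) • faceVertex n k = UpperHalfPlane.I := by
      rw [mul_smul, hv, hrot, neg_add_cancel, hrot0, boost_boost]
    rw [hypAngle_eq hg]
    have hq : ∀ s : ℝ, s = 1 ∨ s = -1 → ∃ R, 0 < R ∧
        Polar (boost n • rotation (s * halfAngle n) • boost n • UpperHalfPlane.I) R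
          (-s * (Real.pi / 3)) := by
      intro s hs
      obtain ⟨b0, b1, b2⟩ := hyp_boost_I n
      obtain ⟨c0, c1, c2⟩ := hyp_rotation (s * halfAngle n) (boost n • UpperHalfPlane.I)
      set w := rotation (s * halfAngle n) • boost n • UpperHalfPlane.I
      obtain ⟨d0, d1, d2⟩ := hyp_boost n w
      have hT := hypTime_pos (boost n • w)
      have hm := ch_mul hn
      have hsc := Real.sin_sq_add_cos_sq (halfAngle n)
      have p1 : Real.cos (2 * (s * halfAngle n)) = 1 - 2 * Real.sin (halfAngle n) ^ 2 := by
        rcases hs with rfl | rfl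
        · rw [one_mul, Real.cos_two_mul]; linear_combination 2 * hsc
        · rw [neg_one_mul, mul_neg, Real.cos_neg, Real.cos_two_mul]; linear_combination 2 * hsc
      have p2 : Real.sin (2 * (s * halfAngle n)) =
          2 * s * Real.sin (halfAngle n) * Real.cos (halfAngle n) := by
        rcases hs with rfl | rfl
        · rw [one_mul, Real.sin_two_mul]; ring
        · rw [neg_one_mul, mul_neg, Real.sin_neg, Real.sin_two_mul]; ring
      have p3 : Real.cos (-s * (Real.pi / 3)) = 1 / 2 := by
        rcases hs with rfl | rfl
        · rw [neg_one_mul, Real.cos_neg, Real.cos_pi_div_three]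
        · rw [neg_neg, one_mul, Real.cos_pi_div_three]
      have p4 : Real.sin (-s * (Real.pi / 3)) = -s * (√3 / 2) := by
        rcases hs with rfl | rfl
        · rw [neg_one_mul, Real.sin_neg, Real.sin_pi_div_three]; ring
        · rw [neg_neg, one_mul, Real.sin_pi_div_three]; ring
      refine ⟨4 * sh n * ch n * Real.sin (halfAngle n) ^ 2 / hypTime (boost n • w),
        by positivity, ?_, ?_⟩
      · rw [p3, d1, c0, c1, b0, b1, b2, p1]
        field_simp
        ring
      · rw [p4, d2, c2, b1, b2, p2]
        field_simp
        linear_combination 4 * s * sh n * Real.sin (halfAngle n) * hm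
    have hl : ∀ (l : ℤ) (s : ℝ), (l : ℝ) = k + s →
        (boost n * rotation (-(halfAngle n * k))) • faceVertex n l =
          boost n • rotation (s * halfAngle n) • boost n • UpperHalfPlane.I := by
      intro l s hls
      rw [mul_smul, hv, hrot, hls]
      ring_nf
    obtain ⟨R, hR, hP⟩ := hq 1 (Or.inl rfl)
    obtain ⟨R', hR', hP'⟩ := hq (-1) (Or.inr rfl)
    have hpp := Real.pi_pos
    rw [hl (k - 1) (-1) (by push_cast; ring), hl (k + 1) 1 (by push_cast; ring), hP.klein_eq,
      hP'.klein_eq, angle_polar hR' hR (by linarith) (by linarith), abs_of_pos (by linarith)]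
    ring

theorem isRegularPolygon_triangle {n : ℕ} (hn : 4 ≤ n) :
    IsRegularPolygon UpperHalfPlane.I (triVertex n) (Real.pi / n) := by
  have hC := ch_pos n
  have hS := sh_pos hn
  have hpi := two_mul_halfAngle hn
  have hφ := halfAngle_pos hn
  have hφ' := halfAngle_lt hn
  refine ⟨le_rfl, ⟨ch n / (ch n + 1) * (sh n / ch n), 0, by positivity, fun j => ?_⟩, fun j => ?_⟩
  · obtain ⟨h0, h1, h2⟩ := hyp_triVertex n j
    obtain ⟨hc, hs⟩ := cos_sin_third j
    have hP : Polar (triVertex n j) (sh n / ch n) (2 * (Real.pi * (j.val : ℝ) / 3)) := by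
      unfold Polar
      rw [h0, h1, h2, hc, hs]
      constructor <;> field_simp
    have e2 : (0 + 2 * Real.pi * (j.val : ℝ) / ((3 : ℕ) : ℝ) : ℝ) =
        2 * (Real.pi * (j.val : ℝ) / 3) := by
      push_cast
      ring
    rw [discCoord_I, hP.klein_eq, h0, e2, Complex.real_smul]
    push_cast
    ring
  · have d : ∀ j : ZMod 3, j - 1 = j + 2 ∧ j ≠ j + 1 ∧ j ≠ j + 2 ∧ j + 1 ≠ j + 2 ∧
      j + 2 ≠ j + 1 ∧ j + 1 ≠ j ∧ j + 2 ≠ j := by decide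
    obtain ⟨d0, d1, d2, d3, d4, d5, d6⟩ := d j
    have hg : toVertex n j • triVertex n j = UpperHalfPlane.I := by
      obtain ⟨-, e1, e2⟩ := bary_eq_toVertex n j (triVertex n j)
      rw [bary_triVertex, if_neg d5] at e1
      rw [bary_triVertex, if_neg d6] at e2
      have f1 : hypFst (toVertex n j • triVertex n j) = 0 := by linarith
      have f2 : hypSnd (toVertex n j • triVertex n j) = 0 := by
        have : (2 * √3 * ch n) * hypSnd (toVertex n j • triVertex n j) = 0 := by linarith
        exact (mul_eq_zero.1 this).resolve_left (by positivity)
      apply klein_injective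
      rw [klein_I]
      apply Complex.ext
      · rw [klein_re, f1, zero_div]; rfl
      · rw [klein_im, f2, zero_div]; rfl
    have hsin := sin_halfAngle_pos hn
    have hb : ∀ l m, 0 ≤ bary n l (triVertex n m) := by
      intro l m
      rw [bary_triVertex]
      split_ifs <;> positivity
    -- The two neighbours lie on the two boundary rays of the sector.
    have hv1 : ∃ r, 0 < r ∧ Polar (toVertex n j • triVertex n (j + 1)) r (-halfAngle n) := by
      obtain ⟨r, θ, hr, hθ, hP⟩ := exists_polar_of_mem_triangle hn j (hb _ (j + 1)) (hb _ _)
      obtain ⟨e1, e2⟩ := hP.bary hn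
      have hT := (hypTime_pos (toVertex n j • triVertex n (j + 1))).ne'
      rw [bary_triVertex, if_pos rfl] at e1
      rw [bary_triVertex, if_neg d4, mul_zero] at e2
      have hr0 : r ≠ 0 := by
        rintro rfl
        rw [mul_zero, zero_mul] at e1
        exact absurd e1 (by positivity)
      rw [abs_le] at hθ
      have := mul_left_cancel₀ (mul_ne_zero hT hr0) (e2.symm.trans (mul_zero _).symm)
      have := (Real.sin_eq_zero_iff_of_lt_of_lt (by linarith) (by linarith)).1 this
      obtain rfl : θ = -halfAngle n := by linarith
      exact ⟨r, lt_of_le_of_ne hr hr0.symm, hP⟩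
    have hv2 : ∃ r, 0 < r ∧ Polar (toVertex n j • triVertex n (j + 2)) r (halfAngle n) := by
      obtain ⟨r, θ, hr, hθ, hP⟩ := exists_polar_of_mem_triangle hn j (hb _ (j + 2)) (hb _ _)
      obtain ⟨e1, e2⟩ := hP.bary hn
      have hT := (hypTime_pos (toVertex n j • triVertex n (j + 2))).ne'
      rw [bary_triVertex, if_pos rfl] at e2
      rw [bary_triVertex, if_neg d3, mul_zero] at e1
      have hr0 : r ≠ 0 := by
        rintro rfl
        rw [mul_zero, zero_mul] at e2
        exact absurd e2 (by positivity)
      rw [abs_le] at hθ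
      have := mul_left_cancel₀ (mul_ne_zero hT hr0) (e1.symm.trans (mul_zero _).symm)
      have := (Real.sin_eq_zero_iff_of_lt_of_lt (by linarith) (by linarith)).1 this
      obtain rfl : θ = halfAngle n := by linarith
      exact ⟨r, lt_of_le_of_ne hr hr0.symm, hP⟩
    obtain ⟨r, hr, hP⟩ := hv1
    obtain ⟨r', hr', hP'⟩ := hv2
    rw [d0, hypAngle_eq hg, hP.klein_eq, hP'.klein_eq,
      angle_polar hr' hr (by linarith) (by linarith), abs_of_pos (by linarith), ← hpi]
    have : (n : ℝ) ≠ 0 := by positivity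
    field_simp
    ring

/-! ### Spokes and sides of the polygons -/

theorem exists_midpoint {n : ℕ} (hn : 4 ≤ n) (l : ZMod 3) : ∃ m, m ∈ triangle n ∧ bary n l m = 0 ∧
    bary n (l + 1) m = bary n (l + 2) m ∧ 0 < bary n (l + 1) m ∧
    triSpoke n l = hypSegment UpperHalfPlane.I m := by
  have d1 : ∀ i : ZMod 3, i + 1 ≠ i ∧ i + 2 ≠ i := by decide
  obtain ⟨d1, d2⟩ := d1 l
  obtain ⟨m, r, hr, hm⟩ := exists_bary_eq hn (c := fun i => if i = l then 0 else 1)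
    (fun l => by split_ifs <;> norm_num)
    (by
      clear d1 d2
      revert l
      rw [forall_zmod3]
      refine ⟨?_, ?_, ?_⟩ <;> simp +decide)
  have m0 : bary n l m = 0 := by rw [hm]; simp
  have m1 : bary n (l + 1) m = r := by rw [hm]; simp [d1]
  have m2 : bary n (l + 2) m = r := by rw [hm]; simp [d2]
  have hT : m ∈ triangle n := by
    rw [mem_triangle_iff hn, forall_zmod3' l, m0, m1, m2]
    exact ⟨le_rfl, hr.le, hr.le⟩
  refine ⟨m, hT, m0, m1.trans m2.symm, m1.symm ▸ hr, ?_⟩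
  have hsub : triSpoke n l = {p | ∃ m' ∈ triSide n l, bary n (l + 1) m' = bary n (l + 2) m' ∧
      p ∈ hypSegment UpperHalfPlane.I m'} := by
    ext p
    simp only [triSpoke, dist_triVertex_eq_iff hn]
  rw [hsub]
  apply Set.Subset.antisymm
  · rintro p ⟨m', hm', he, hp⟩
    obtain ⟨-, h0⟩ := (mem_triSide_iff hn).1 hm'
    have : m' = m := by
      refine eq_of_bary_eq hn (r := bary n (l + 1) m' / r) ?_
      rw [forall_zmod3' l, m0, m1, m2, ← he, h0]
      refine ⟨by simp, ?_, ?_⟩ <;> field_simp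
    rwa [← this]
  · exact fun p hp => ⟨m, (mem_triSide_iff hn).2 ⟨hT, m0⟩, m1.trans m2.symm, hp⟩

theorem hypSegment_image (e : ℍ ≃ᵢ ℍ) (a b : ℍ) :
    e '' hypSegment a b = hypSegment (e a) (e b) := by
  ext p
  constructor
  · rintro ⟨q, hq, rfl⟩
    change dist _ _ + dist _ _ = dist _ _
    rw [e.dist_eq, e.dist_eq, e.dist_eq]
    exact hq
  · intro hp
    obtain ⟨q, rfl⟩ := e.surjective p
    change dist _ _ + dist _ _ = dist _ _ at hp
    rw [e.dist_eq, e.dist_eq, e.dist_eq] at hp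
    exact ⟨q, hp, rfl⟩

theorem hypSegment_eq_union {a m b : ℍ} (h : klein m = (1 / 2 : ℝ) • (klein a + klein b)) :
    hypSegment a b = hypSegment a m ∪ hypSegment b m := by
  ext p
  rw [Set.mem_union, mem_hypSegment_iff, mem_hypSegment_iff, mem_hypSegment_iff, h]
  constructor
  · rintro ⟨s, t, hs, ht, hst, hp⟩
    rcases le_total t s with hts | hts
    · left
      refine ⟨s - t, 2 * t, by linarith, by linarith, by linarith, ?_⟩
      rw [← hp]
      module
    · right
      refine ⟨t - s, 2 * s, by linarith, by linarith, by linarith, ?_⟩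
      rw [← hp]
      module
  · rintro (⟨s, t, hs, ht, hst, hp⟩ | ⟨s, t, hs, ht, hst, hp⟩)
    · refine ⟨s + t / 2, t / 2, by linarith, by linarith, by linarith, ?_⟩
      rw [← hp]
      module
    · refine ⟨t / 2, s + t / 2, by linarith, by linarith, by linarith, ?_⟩
      rw [← hp]
      module

/-- The side of the polygon which joins the centres of two consecutive triangles consists of the
spokes of these triangles to their common side. -/
theorem hypSegment_faceVertex {n : ℕ} (hn : 4 ≤ n) (i : ZMod 3) (j : ℤ) :
    hypSegment (faceVertex n j) (faceVertex n (j + 1)) =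
      place n i j '' triSpoke n (sideAfter i j) ∪
      place n i (j + 1) '' triSpoke n (sideAfter i j) := by
  obtain ⟨m, hmT, m0, m1, m2, hm⟩ := exists_midpoint hn (sideAfter i j)
  have hC := ch_pos n
  have hS := sh_pos hn
  have hφ := halfAngle_pos hn
  have hφ' := halfAngle_lt hn
  have hsin := sin_halfAngle_pos hn
  have hcm := ch_mul hn
  have hsq := ch_sq n
  have h3 := sqrt_three_sq
  rw [hm, hypSegment_image, hypSegment_image, place_I, place_I, place_succ hn hmT m0]
  refine hypSegment_eq_union ?_
  have hb := (mem_triangle_iff hn).1 hmT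
  -- The polar coordinates of the midpoint of the common side.
  obtain ⟨r, θ, hr, hθ, hP⟩ := exists_polar_of_mem_triangle hn i (hb _) (hb _)
  obtain ⟨e1, e2⟩ := hP.bary hn
  obtain ⟨f0, f1, f2⟩ := bary_eq_toVertex n i m
  have hT := hypTime_pos (toVertex n i • m)
  have hi : ∀ i : ZMod 3, i + 1 + 1 = i + 2 ∧ i + 1 + 2 = i ∧ i + 2 + 1 = i ∧ i + 2 + 2 = i + 1 := by
    decide
  obtain ⟨i1, i2, i3, i4⟩ := hi i
  rw [abs_le] at hθ
  have hr0 : r ≠ 0 := by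
    rintro rfl
    simp only [mul_zero, zero_mul] at e1 e2
    have e1 := (mul_eq_zero.1 e1).resolve_left hsin.ne'
    have e2 := (mul_eq_zero.1 e2).resolve_left hsin.ne'
    unfold sideAfter at m1 m2
    split_ifs at m1 m2
    · rw [i1, e2] at m2; exact lt_irrefl _ m2
    · rw [i3, i4] at m1; rw [i3, m1, e1] at m2; exact lt_irrefl _ m2
  have hang : sgn j * θ = halfAngle n ∧ ch n * r = sh n * Real.cos (halfAngle n) := by
    have hsc := Real.sin_sq_add_cos_sq (halfAngle n)
    unfold sideAfter at m0 m1
    unfold sgn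
    split_ifs at m0 m1 ⊢ with hj
    · rw [m0, mul_zero] at e1
      have := mul_left_cancel₀ (mul_ne_zero hT.ne' hr0) (e1.symm.trans (mul_zero _).symm)
      have := (Real.sin_eq_zero_iff_of_lt_of_lt (by linarith) (by linarith)).1 this
      obtain rfl : θ = halfAngle n := by linarith
      refine ⟨one_mul _, ?_⟩
      rw [i1, i2, f0, f2, hP.1, hP.2] at m1
      have : hypTime (toVertex n i • m) * (3 * ch n) * (ch n * r) =
          hypTime (toVertex n i • m) * (3 * ch n) * (sh n * Real.cos (halfAngle n)) := by
        linear_combination Real.cos (halfAngle n) * m1 + (-3 * hypTime (toVertex n i • m) * ch n ^ 2 *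
          r) * hsc + hypTime (toVertex n i • m) * r * Real.cos (halfAngle n) ^ 2 * hsq
          + (√3 * hypTime (toVertex n i • m) * ch n * r * Real.sin (halfAngle n)) * hcm
          - (hypTime (toVertex n i • m) * ch n ^ 2 * r * Real.sin (halfAngle n) ^ 2) * h3
      exact mul_left_cancel₀ (by positivity) this
    · rw [m0, mul_zero] at e2
      have := mul_left_cancel₀ (mul_ne_zero hT.ne' hr0) (e2.symm.trans (mul_zero _).symm)
      have := (Real.sin_eq_zero_iff_of_lt_of_lt (by linarith) (by linarith)).1 this
      obtain rfl : θ = -halfAngle n := by linarith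
      refine ⟨by ring, ?_⟩
      rw [i3, i4, f0, f1, hP.1, hP.2, Real.cos_neg, Real.sin_neg] at m1
      have : hypTime (toVertex n i • m) * (3 * ch n) * (ch n * r) =
          hypTime (toVertex n i • m) * (3 * ch n) * (sh n * Real.cos (halfAngle n)) := by
        linear_combination -Real.cos (halfAngle n) * m1 + (-3 * hypTime (toVertex n i • m) * ch n ^ 2 *
          r) * hsc + hypTime (toVertex n i • m) * r * Real.cos (halfAngle n) ^ 2 * hsq
          + (√3 * hypTime (toVertex n i • m) * ch n * r * Real.sin (halfAngle n)) * hcm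
          - (hypTime (toVertex n i • m) * ch n ^ 2 * r * Real.sin (halfAngle n) ^ 2) * h3
      exact mul_left_cancel₀ (by positivity) this
  have hQ := hP.spin n j
  rw [hang.1] at hQ
  rw [place_apply, hQ.klein_eq, (polar_faceVertex n j).klein_eq,
    (polar_faceVertex n (j + 1)).klein_eq]
  have hr' : r = sh n * Real.cos (halfAngle n) / ch n := by
    rw [eq_div_iff hC.ne', mul_comm]; exact hang.2
  have e2 : 2 * halfAngle n * ((j + 1 : ℤ) : ℝ) =
      2 * halfAngle n * j + halfAngle n + halfAngle n := by
    push_cast; ring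
  have e3 : 2 * halfAngle n * j = 2 * halfAngle n * j + halfAngle n - halfAngle n := by ring
  rw [e2, hr']
  conv_rhs => rw [e3]
  set a := 2 * halfAngle n * j + halfAngle n
  rw [sub_add_cancel]
  apply Complex.ext
  · simp only [Complex.add_re, Complex.smul_re, Complex.re_ofReal_mul,
      Complex.exp_ofReal_mul_I_re, smul_eq_mul, Real.cos_add, Real.cos_sub]
    ring
  · simp only [Complex.add_im, Complex.smul_im, Complex.im_ofReal_mul,
      Complex.exp_ofReal_mul_I_im, smul_eq_mul, Real.sin_add, Real.sin_sub]
    ring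

/-! ### Triangles of the glued surface and their sectors around a vertex -/

section Sectors

variable {Γ : Type} [Group Γ] {x : ZMod 3 → Γ} {n : ℕ}

/-- The hypotheses on the group and its generators under which the triangles fit together to a
hyperbolic surface: `2 n` triangles with angles `π / n` meet at every vertex. -/
structure IsTriangleSystem (x : ZMod 3 → Γ) (n : ℕ) : Prop where
  four_le : 4 ≤ n
  orderOf_eq : ∀ i, orderOf (x i) = n
  mul_eq_one : x 0 * x 1 * x 2 = 1
  closure_eq_top : Subgroup.closure (Set.range x) = ⊤

/-- The centre of the triangle lies in the triangle. -/
theorem I_mem_triangle (hn : 4 ≤ n) : UpperHalfPlane.I ∈ triangle n :=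
  (mem_triangle_iff hn).2 fun i => by rw [bary_I]; exact (sh_pos hn).le

theorem subset_hypHull (s : Set ℍ) : s ⊆ hypHull s := Set.subset_sInter fun _ ht => ht.2

open Classical in
/-- The point of the surface given by a point of the triangle with label and colour `s`. Points
outside the triangle get the value of some point of it. -/
noncomputable def pt (x : ZMod 3 → Γ) (n : ℕ) (s : Γ × Colour) (p : ℍ) : GluedSurface x n :=
  GluedSurface.mk x n s.1 s.2
    (if h : p ∈ triangle n then ⟨p, h⟩ else
      ⟨triVertex n 0, subset_hypHull _ ⟨0, rfl⟩⟩)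

theorem pt_of_mem {p : ℍ} (hp : p ∈ triangle n) (s : Γ × Colour) :
    pt x n s p = GluedSurface.mk x n s.1 s.2 ⟨p, hp⟩ := by
  rw [pt, dif_pos hp]

theorem mk_eq_pt (g : Γ) (c : Colour) (p : triangle n) :
    GluedSurface.mk x n g c p = pt x n (g, c) p :=
  (pt_of_mem p.2 (g, c)).symm

theorem exists_pt (a : GluedSurface x n) : ∃ s p, p ∈ triangle n ∧ pt x n s p = a := by
  obtain ⟨⟨g, c, p⟩, rfl⟩ := Quot.exists_rep a
  exact ⟨(g, c), p, p.2, pt_of_mem p.2 _⟩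

/-- The triangle which has the `i`-th side in common with the triangle `s`. -/
def across (x : ZMod 3 → Γ) (i : ZMod 3) : Γ × Colour → Γ × Colour
  | (g, Colour.white) => (g * crossing x i, Colour.black)
  | (g, Colour.black) => (g * (crossing x i)⁻¹, Colour.white)

theorem across_across (i : ZMod 3) (s : Γ × Colour) : across x i (across x i s) = s := by
  obtain ⟨g, _ | _⟩ := s <;> simp [across]

theorem pt_across (hn : 4 ≤ n) {p : ℍ} (hp : p ∈ triangle n) {i : ZMod 3} (h : bary n i p = 0)
    (s : Γ × Colour) : pt x n (across x i s) p = pt x n s p := by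
  have key : ∀ g, pt x n (g, Colour.white) p = pt x n (g * crossing x i, Colour.black) p := by
    intro g
    rw [pt_of_mem hp, pt_of_mem hp]
    exact Quot.sound (Glue.side g i ⟨p, hp⟩ ((mem_triSide_iff hn).2 ⟨hp, h⟩))
  obtain ⟨g, _ | _⟩ := s
  · exact (key g).symm
  · have := key (g * (crossing x i)⁻¹)
    rwa [inv_mul_cancel_right] at this

/-- Points of the surface are equal only if they have the same position in their triangles and the
labels cannot be separated by a property which is invariant under crossing the sides through the
point. -/
theorem eq_of_pt_eq (hn : 4 ≤ n) {p q : ℍ} (hp : p ∈ triangle n) (hq : q ∈ triangle n)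
    {s t : Γ × Colour} (h : pt x n s p = pt x n t q) :
    p = q ∧ ∀ P : Γ × Colour → Prop,
      (∀ i, bary n i p = 0 → ∀ u, P u → P (across x i u)) → P s → P t := by
  have key : ∀ P : Γ × Colour → Prop,
      (∀ i, bary n i p = 0 → ∀ u, P u → P (across x i u)) → P s → p = q ∧ P t := by
    intro P hP hs
    let F : GluedSurface x n → Prop := Quot.lift (fun t => p = (t.2.2 : ℍ) ∧ P (t.1, t.2.1)) (by
      rintro _ _ ⟨g, i, r, hr⟩
      refine propext (and_congr_right ?_)
      rintro rfl
      have h0 := ((mem_triSide_iff hn).1 hr).2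
      refine ⟨fun h => hP i h0 _ h, fun h => ?_⟩
      have := hP i h0 _ h
      simpa [across] using this)
    have h1 : F (pt x n s p) := by
      rw [pt_of_mem hp]
      exact ⟨rfl, hs⟩
    rw [h, pt_of_mem hq] at h1
    exact h1
  exact ⟨(key (fun _ => True) (fun _ _ _ _ => trivial) trivial).1, fun P hP hs => (key P hP hs).2⟩

theorem eq_of_pt_eq_of_pos (hn : 4 ≤ n) {p q : ℍ} (hp : p ∈ triangle n) (hq : q ∈ triangle n)
    (h0 : ∀ i, 0 < bary n i p) {s t : Γ × Colour} (h : pt x n s p = pt x n t q) : s = t :=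
  (eq_of_pt_eq hn hp hq h).2 (fun u => s = u) (fun i hi => absurd hi (h0 i).ne') rfl

theorem crossing_mul_inv (hx : x 0 * x 1 * x 2 = 1) (i : ZMod 3) :
    crossing x (i + 1) * (crossing x (i + 2))⁻¹ = x i := by
  revert i
  rw [forall_zmod3]
  refine ⟨?_, ?_, ?_⟩
  · change 1 * ((x 0)⁻¹)⁻¹ = x 0
    simp
  · change (x 0)⁻¹ * (x 2)⁻¹ = x 1
    rw [eq_inv_of_mul_eq_one_right hx]
    group
  · change x 2 * 1⁻¹ = x 2
    simp

/-- The triangles around the `i`-th vertex of the white triangle `g`, in their cyclic order; the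
sectors with even numbers are white. -/
def sector (x : ZMod 3 → Γ) (i : ZMod 3) (g : Γ) (j : ℤ) : Γ × Colour :=
  if Even j then (g * x i ^ (j / 2), Colour.white)
  else (g * x i ^ (j / 2) * crossing x (i + 1), Colour.black)

theorem sector_even (i : ZMod 3) (g : Γ) (a : ℤ) :
    sector x i g (2 * a) = (g * x i ^ a, Colour.white) := by
  rw [sector, if_pos (by simp)]
  congr 3
  omega

theorem sector_odd (i : ZMod 3) (g : Γ) (a : ℤ) :
    sector x i g (2 * a + 1) = (g * x i ^ a * crossing x (i + 1), Colour.black) := by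
  rw [sector, if_neg (by simp)]
  congr 4
  omega

theorem sector_shift (i : ZMod 3) (g : Γ) (j a : ℤ) :
    sector x i g (j + 2 * a) = sector x i (g * x i ^ a) j := by
  rcases Int.even_or_odd' j with ⟨b, rfl | rfl⟩
  · rw [← mul_add, sector_even, sector_even, mul_assoc, ← zpow_add, add_comm]
  · rw [show 2 * b + 1 + 2 * a = 2 * (a + b) + 1 by ring, sector_odd, sector_odd, zpow_add,
      ← mul_assoc g]

theorem sector_succ (hx : x 0 * x 1 * x 2 = 1) (i : ZMod 3) (g : Γ) (j : ℤ) :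
    sector x i g (j + 1) = across x (sideAfter i j) (sector x i g j) := by
  rcases Int.even_or_odd' j with ⟨b, rfl | rfl⟩
  · rw [sideAfter, if_pos (by simp), sector_even, sector_odd]
    rfl
  · rw [sideAfter, if_neg (by simp), sector_odd, show 2 * b + 1 + 1 = 2 * (b + 1) by ring,
      sector_even]
    change _ = (_ * _ * _ * _, _)
    rw [mul_assoc _ (crossing x (i + 1)), crossing_mul_inv hx, zpow_add_one, mul_assoc]

variable (hS : IsTriangleSystem x n)
include hS

namespace IsTriangleSystem

theorem sector_add_period (i : ZMod 3) (g : Γ) (j N : ℤ) :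
    sector x i g (j + 2 * n * N) = sector x i g j := by
  rw [mul_assoc, sector_shift, zpow_mul, zpow_natCast, ← hS.orderOf_eq i, pow_orderOf_eq_one,
    one_zpow, mul_one]

theorem exists_of_sector_eq {i : ZMod 3} {g : Γ} {j k : ℤ}
    (h : sector x i g j = sector x i g k) : ∃ N : ℤ, j = k + 2 * n * N := by
  have key : ∀ a b : ℤ, x i ^ a = x i ^ b → ∃ N : ℤ, a = b + n * N := by
    intro a b hab
    rw [zpow_eq_zpow_iff_modEq, hS.orderOf_eq] at hab
    obtain ⟨N, hN⟩ := hab.symm.dvd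
    exact ⟨N, by linarith⟩
  rcases Int.even_or_odd' j with ⟨a, rfl | rfl⟩ <;> rcases Int.even_or_odd' k with ⟨b, rfl | rfl⟩ <;>
    simp only [sector_even, sector_odd, Prod.mk.injEq, reduceCtorEq, and_false, and_true,
      mul_left_inj, mul_right_inj] at h <;> obtain ⟨N, rfl⟩ := key _ _ h <;> exact ⟨N, by ring⟩

theorem pt_sector_succ (i : ZMod 3) (g : Γ) {j : ℤ} {p : ℍ} (hp : p ∈ triangle n)
    (h : bary n (sideAfter i j) p = 0) :
    pt x n (sector x i g (j + 1)) p = pt x n (sector x i g j) p := by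
  rw [sector_succ hS.mul_eq_one, pt_across hS.four_le hp h]

theorem pt_sector_eq_zero (i : ZMod 3) (g : Γ) {p : ℍ} (hp : p ∈ triangle n)
    (h1 : bary n (i + 1) p = 0) (h2 : bary n (i + 2) p = 0) (j : ℤ) :
    pt x n (sector x i g j) p = pt x n (sector x i g 0) p := by
  have step : ∀ l : ℤ, pt x n (sector x i g (l + 1)) p = pt x n (sector x i g l) p := by
    intro l
    refine hS.pt_sector_succ i g hp ?_
    unfold sideAfter
    split_ifs <;> assumption
  induction j using Int.induction_on with
  | zero => rfl
  | succ l ih => rw [step, ih]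
  | pred l ih => rw [← ih, ← step, sub_add_cancel]

theorem pt_sector_eq (i : ZMod 3) (g : Γ) {j k : ℤ} {p q : ℍ} (hp : p ∈ triangle n)
    (hq : q ∈ triangle n) (h : place n i j p = place n i k q) :
    pt x n (sector x i g j) p = pt x n (sector x i g k) q := by
  obtain ⟨rfl, ⟨h1, h2⟩ | ⟨N, rfl | ⟨rfl, h0⟩ | ⟨rfl, h0⟩⟩⟩ := place_eq_place hS.four_le hp hq h
  · rw [hS.pt_sector_eq_zero i g hp h1 h2 j, hS.pt_sector_eq_zero i g hp h1 h2 k]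
  · rw [hS.sector_add_period]
  · rw [add_right_comm, hS.sector_add_period, hS.pt_sector_succ i g hp h0]
  · rw [add_right_comm, hS.sector_add_period, hS.pt_sector_succ i g hp h0]

end IsTriangleSystem

end Sectors

/-! ### The developing map around a vertex -/

section Star

variable {Γ : Type} [Group Γ] {x : ZMod 3 → Γ} {n : ℕ}

open Classical in
/-- The map from the hyperbolic plane to the surface which takes the `2 n` triangles around `i` in
the hyperbolic plane to the triangles around the `i`-th vertex of the white triangle `g`. Only its
values on these triangles matter. -/
noncomputable def star (x : ZMod 3 → Γ) (n : ℕ) (i : ZMod 3) (g : Γ) (z : ℍ) : GluedSurface x n :=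
  if h : ∃ (j : ℤ) (p : ℍ), p ∈ triangle n ∧ place n i j p = z then
    pt x n (sector x i g h.choose) h.choose_spec.choose
  else pt x n (g, Colour.white) z

namespace IsTriangleSystem

variable (hS : IsTriangleSystem x n)
include hS

theorem star_place (i : ZMod 3) (g : Γ) (j : ℤ) {p : ℍ} (hp : p ∈ triangle n) :
    star x n i g (place n i j p) = pt x n (sector x i g j) p := by
  have h : ∃ (j' : ℤ) (p' : ℍ), p' ∈ triangle n ∧ place n i j' p' = place n i j p := ⟨j, p, hp, rfl⟩
  rw [star, dif_pos h]
  exact hS.pt_sector_eq i g h.choose_spec.choose_spec.1 hp h.choose_spec.choose_spec.2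

/-- Inside the star, the placed triangles through a point of the hyperbolic plane are all the
triangles through its image. -/
theorem exists_lift {i : ZMod 3} {g : Γ} {z : ℍ} (hz : z ∈ starRegion n) {s : Γ × Colour} {q : ℍ}
    (hq : q ∈ triangle n) (h : star x n i g z = pt x n s q) :
    ∃ k, sector x i g k = s ∧ place n i k q = z := by
  obtain ⟨j, p, hp, h0, rfl⟩ := exists_place_of_mem_starRegion hS.four_le i hz
  rw [hS.star_place i g j hp] at h
  obtain ⟨rfl, hP⟩ := eq_of_pt_eq hS.four_le hp hq h
  -- Inside the star a gluing at `p` only crosses a side through the vertex `i`, hence leads to the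
  -- next or the previous sector.
  refine hP (fun s => ∃ k, sector x i g k = s ∧ place n i k p = place n i j p) ?_ ⟨j, rfl, rfl⟩
  rintro l hl _ ⟨k, rfl, hk⟩
  have hl' : l = i + 1 ∨ l = i + 2 := by
    have : ∀ i l : ZMod 3, l = i ∨ l = i + 1 ∨ l = i + 2 := by decide
    rcases this i l with rfl | h | h
    · exact absurd hl h0.ne'
    · exact Or.inl h
    · exact Or.inr h
  have hside : l = sideAfter i k ∨ l = sideAfter i (k - 1) := by
    unfold sideAfter
    by_cases hk : Even k
    · rw [if_pos hk, if_neg (by simpa [Int.even_sub_one] using hk)]; exact hl'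
    · rw [if_neg hk, if_pos (by simpa [Int.even_sub_one] using hk)]; exact hl'.symm
  rcases hside with rfl | rfl
  · exact ⟨k + 1, sector_succ hS.mul_eq_one _ _ _, (place_succ hS.four_le hp hl).trans hk⟩
  · refine ⟨k - 1, ?_, ?_⟩
    · have := sector_succ hS.mul_eq_one i g (k - 1)
      rw [sub_add_cancel] at this
      rw [this, across_across]
    · have := place_succ hS.four_le hp hl
      rw [sub_add_cancel] at this
      rw [← this, hk]

theorem injOn_star (i : ZMod 3) (g : Γ) : Set.InjOn (star x n i g) (starRegion n) := by
  intro z hz w hw h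
  obtain ⟨j, q, hq, -, rfl⟩ := exists_place_of_mem_starRegion hS.four_le i hw
  rw [hS.star_place i g j hq] at h
  obtain ⟨k, hk, rfl⟩ := hS.exists_lift hz hq h
  obtain ⟨N, rfl⟩ := hS.exists_of_sector_eq hk
  rw [place_add_period hS.four_le]

theorem exists_star_eq (a : GluedSurface x n) :
    ∃ i g, ∃ z ∈ starRegion n, star x n i g z = a := by
  obtain ⟨⟨g, c⟩, p, hp, rfl⟩ := exists_pt a
  have hb := (mem_triangle_iff hS.four_le).1 hp
  obtain ⟨i, hi⟩ : ∃ i, 0 < bary n i p := by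
    by_contra! h
    have := sum_bary_pos hS.four_le 0 p
    have h0 := h 0
    have h1 := h (0 + 1)
    have h2 := h (0 + 2)
    linarith
  have hmem : ∀ j, place n i j p ∈ starRegion n := fun j =>
    (place_mem_starRegion_iff hS.four_le (hb _) (hb _)).2 hi
  cases c with
  | white =>
    refine ⟨i, g, place n i (2 * 0) p, hmem _, ?_⟩
    rw [hS.star_place i g _ hp, sector_even, zpow_zero, mul_one]
  | black =>
    refine ⟨i, g * (crossing x (i + 1))⁻¹, place n i (2 * 0 + 1) p, hmem _, ?_⟩
    rw [hS.star_place i _ _ hp, sector_odd, zpow_zero, mul_one, inv_mul_cancel_right]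

end IsTriangleSystem

end Star

/-! ### The developing map is a local isometry -/

section LocalIsometry

open scoped ENNReal

variable {Γ : Type} [Group Γ] {x : ZMod 3 → Γ} {n : ℕ}

theorem edist_pt_le {p q : ℍ} (hp : p ∈ triangle n) (hq : q ∈ triangle n) (s : Γ × Colour) :
    edist (pt x n s p) (pt x n s q) ≤ edist p q := by
  rw [pt_of_mem hp, pt_of_mem hq]
  have := IsChain.cons s.1 s.2 (⟨p, hp⟩ : triangle n) ⟨q, hq⟩ (IsChain.nil (x := x) _)
  rw [add_zero] at this
  exact iInf₂_le _ this

theorem hypConvex_starRegion (n : ℕ) : HypConvex (starRegion n) := by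
  have : starRegion n = klein ⁻¹' ⋂ j : ℤ, {ζ : ℂ | (sh n ^ 2 + 2 * ch n ^ 2) *
      (Real.cos (2 * halfAngle n * j + 0) * ζ.re + Real.sin (2 * halfAngle n * j + 0) * ζ.im) <
      3 * sh n * ch n} := by
    ext z
    rw [Set.mem_preimage, Set.mem_iInter]
    refine forall_congr' fun j => ?_
    rw [Set.mem_ofPred_eq]
    conv_rhs => rw [← mul_lt_mul_iff_right₀ (hypTime_pos z)]
    rw [height, ← hypTime_mul_re, ← hypTime_mul_im]
    apply iff_of_eq
    congr 1 <;> ring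
  rw [this]
  refine hypConvex_preimage (convex_iInter fun j => convex_halfSpace_lt ?_ _)
  constructor
  · intro a b; simp only [Complex.add_re, Complex.add_im]; ring
  · intro c a; simp only [Complex.smul_re, Complex.smul_im, smul_eq_mul]; ring

/-- The geodesic from `a` to `b`, parametrized by the segment in the Klein model. -/
theorem exists_geodesic (a b : ℍ) : ∃ γ : ℝ → ℍ, ContinuousOn γ (Set.Icc 0 1) ∧ γ 0 = a ∧ γ 1 = b ∧
    ∀ s ∈ Set.Icc (0 : ℝ) 1, klein (γ s) = (1 - s) • klein a + s • klein b := by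
  have hmem : ∀ s ∈ Set.Icc (0 : ℝ) 1,
      (1 - s) • klein a + s • klein b ∈ Metric.ball (0 : ℂ) 1 := fun s hs =>
    convex_ball (0 : ℂ) 1 (klein_mem_ball a) (klein_mem_ball b) (by linarith [hs.2]) hs.1 (by ring)
  refine ⟨fun s => unklein ((1 - s) • klein a + s • klein b), ?_, ?_, ?_, fun s hs => ?_⟩
  · exact continuousOn_unklein.comp (by fun_prop) hmem
  · simp [unklein_klein]
  · simp [unklein_klein]
  · exact klein_unklein (normSq_lt_one_of_mem_ball (hmem s hs))

theorem mem_hypSegment_of_klein_eq {a b : ℍ} {γ : ℝ → ℍ}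
    (h : ∀ s ∈ Set.Icc (0 : ℝ) 1, klein (γ s) = (1 - s) • klein a + s • klein b) {s t : ℝ}
    (hs : 0 ≤ s) (hst : s ≤ t) (ht : t ≤ 1) : γ s ∈ hypSegment a (γ t) := by
  rw [mem_hypSegment_iff, h s ⟨hs, hst.trans ht⟩, h t ⟨hs.trans hst, ht⟩]
  rcases (hs.trans hst).eq_or_lt with rfl | ht0
  · obtain rfl : s = 0 := le_antisymm hst hs
    exact right_mem_segment _ _ _
  · refine ⟨1 - s / t, s / t, ?_, by positivity, by ring, ?_⟩
    · rw [sub_nonneg, div_le_one ht0]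
      exact hst
    · have : s = s / t * t := by field_simp
      conv_rhs => rw [this]
      module

/-- Every point of the triangle is a limit of interior points. -/
theorem exists_bary_pos_of_mem_nhds (hn : 4 ≤ n) {p : ℍ} (hp : p ∈ triangle n) {U : Set ℍ}
    (hU : U ∈ nhds p) : ∃ q ∈ U, ∀ i, 0 < bary n i q := by
  rw [mem_triangle_iff hn] at hp
  by_cases hpI : p = UpperHalfPlane.I
  · refine ⟨p, mem_of_mem_nhds hU, fun i => ?_⟩
    rw [hpI, bary_I]
    exact sh_pos hn
  obtain ⟨γ, hγ, h0, h1, hk⟩ := exists_geodesic p UpperHalfPlane.I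
  have hc : Filter.Tendsto γ (nhdsWithin 0 (Set.Ioi 0)) (nhds p) := by
    rw [← h0]
    exact (hγ 0 ⟨le_rfl, zero_le_one⟩).mono_of_mem_nhdsWithin (Icc_mem_nhdsGT zero_lt_one)
  obtain ⟨s, hsU, hs0, hs1⟩ := ((hc.eventually hU).and (Ioc_mem_nhdsGT (zero_lt_one' ℝ))).exists
  refine ⟨γ s, hsU, ?_⟩
  have hseg := mem_hypSegment_of_klein_eq hk hs0.le hs1 le_rfl
  rw [h1] at hseg
  obtain ⟨u, v, hu, hv, huv⟩ := (mem_hypSegment_iff_bary hn).1 hseg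
  have hv0 : v ≠ 0 := by
    rintro rfl
    have he : γ s = p := eq_of_bary_eq hn (r := u) fun i => by rw [huv i]; ring
    have := hk s ⟨hs0.le, hs1⟩
    rw [he, klein_I, smul_zero, add_zero] at this
    have h2 : s • klein p = 0 := by
      have h3 : s • klein p = klein p - (1 - s) • klein p := by module
      rw [h3, ← this, sub_self]
    exact hpI (klein_injective (((smul_eq_zero.1 h2).resolve_left hs0.ne').trans klein_I.symm))
  intro i
  rw [huv i, bary_I]
  have := sh_pos hn
  have := hp i
  have := hv.lt_of_ne' hv0
  positivity

namespace IsTriangleSystem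

variable (hS : IsTriangleSystem x n)
include hS

/-- Chains lift as long as they do not leave the star. -/
theorem exists_lift_chain {i : ZMod 3} {g : Γ} {a b : GluedSurface x n} {ℓ : ℝ≥0∞}
    (h : IsChain x n a b ℓ) : ∀ (z : ℍ) (R : ℝ≥0∞), (∀ w, edist z w < R → w ∈ starRegion n) →
      star x n i g z = a → ℓ < R → ∃ w, star x n i g w = b ∧ edist z w ≤ ℓ := by
  induction h with
  | nil a => exact fun z R _ hz _ => ⟨z, hz, by simp⟩
  | @cons g' c p q b ℓ h ih =>
    intro z R hR hz hℓ
    rw [mk_eq_pt] at hz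
    have hzR : z ∈ starRegion n := hR z (by rw [edist_self]; exact zero_le.trans_lt hℓ)
    obtain ⟨k, hk, rfl⟩ := hS.exists_lift hzR p.2 hz
    have hd : edist (place n i k p) (place n i k q) = edist p q := (place n i k).edist_eq _ _
    have hR' : ∀ w, edist (place n i k q) w < R - edist p q → w ∈ starRegion n := by
      refine fun w hw => hR w ((edist_triangle _ (place n i k q) _).trans_lt ?_)
      rw [hd]
      exact lt_tsub_iff_left.1 hw
    obtain ⟨w, hw, hle⟩ := ih (place n i k q) (R - edist p q) hR'
      (by rw [hS.star_place i g k q.2, hk, mk_eq_pt]) (lt_tsub_iff_left.2 hℓ)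
    exact ⟨w, hw, (edist_triangle _ _ _).trans (add_le_add hd.le hle)⟩

theorem exists_lift_of_edist_lt {i : ZMod 3} {g : Γ} {z : ℍ} {R : ℝ≥0∞}
    (hR : ∀ w, edist z w < R → w ∈ starRegion n) {b : GluedSurface x n}
    (hb : edist (star x n i g z) b < R) :
    ∃ w, star x n i g w = b ∧ edist z w ≤ edist (star x n i g z) b := by
  have hlt : ∀ r, edist (star x n i g z) b < r → r ≤ R →
      ∃ w, star x n i g w = b ∧ edist z w < r := by
    intro r hr hrR
    obtain ⟨ℓ, hℓ⟩ := iInf_lt_iff.1 (show (⨅ (ℓ : ℝ≥0∞) (_ : IsChain x n _ b ℓ), ℓ) < r from hr)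
    obtain ⟨hc, hℓ⟩ := iInf_lt_iff.1 hℓ
    obtain ⟨w, hw, hle⟩ := hS.exists_lift_chain hc z R hR rfl (hℓ.trans_le hrR)
    exact ⟨w, hw, hle.trans_lt hℓ⟩
  obtain ⟨w, hw, hwR⟩ := hlt R hb le_rfl
  refine ⟨w, hw, le_of_forall_gt fun r hr => ?_⟩
  obtain ⟨w', hw', hlt'⟩ := hlt (min r R) (lt_min hr hb) (min_le_right _ _)
  obtain rfl := hS.injOn_star i g (hR w hwR) (hR w' (hlt'.trans_le (min_le_right _ _)))
    (hw.trans hw'.symm)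
  exact hlt'.trans_le (min_le_left _ _)

theorem eventually_edist_star_le (i : ZMod 3) (g : Γ) {z : ℍ} :
    ∀ᶠ w in nhds z, w ∈ starRegion n → edist (star x n i g z) (star x n i g w) ≤ edist z w := by
  have hn := hS.four_le
  have hcl : ∀ j : ℤ, IsClosed (place n i j '' triangle n) := fun j =>
    ((isCompact_triangle n).image (place n i j).continuous).isClosed
  -- The placed triangles are closed and finite in number, so that those near `z` contain `z`.
  have hev : ∀ᶠ w in nhds z, ∀ j : Fin (2 * n),
      w ∈ place n i (j : ℕ) '' triangle n → z ∈ place n i (j : ℕ) '' triangle n := by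
    rw [Filter.eventually_all]
    intro j
    by_cases hj : z ∈ place n i (j : ℕ) '' triangle n
    · exact Filter.Eventually.of_forall fun _ _ => hj
    · filter_upwards [(hcl j).isOpen_compl.mem_nhds hj] with w hw hw'
      exact absurd hw' hw
  filter_upwards [hev] with w hw hws
  have hw' := (forall_int_iff_of_periodic (m := 2 * n) (by omega)
    (P := fun j => w ∈ place n i j '' triangle n → z ∈ place n i j '' triangle n)
    (fun j N => by
      have : ((place n i (j + ((2 * n : ℕ) : ℤ) * N)) : ℍ → ℍ) = place n i j := by
        funext p
        push_cast
        exact place_add_period hn i j N p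
      simp only [this])).2 hw
  obtain ⟨j, q, hq, -, rfl⟩ := exists_place_of_mem_starRegion hn i hws
  obtain ⟨p, hp, rfl⟩ := hw' j ⟨q, hq, rfl⟩
  rw [hS.star_place i g j hp, hS.star_place i g j hq, (place n i j).edist_eq]
  exact edist_pt_le hp hq _

theorem continuousOn_star (i : ZMod 3) (g : Γ) : ContinuousOn (star x n i g) (starRegion n) := by
  intro z hz
  rw [ContinuousWithinAt, EMetric.tendsto_nhds]
  intro ε hε
  have h1 := nhdsWithin_le_nhds (s := starRegion n) (hS.eventually_edist_star_le i g (z := z))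
  have h2 : ∀ᶠ w in nhdsWithin z (starRegion n), edist w z < ε :=
    nhdsWithin_le_nhds (Metric.eball_mem_nhds z hε)
  filter_upwards [h1, h2, self_mem_nhdsWithin] with w hw1 hw2 hw3
  rw [edist_comm]
  refine (hw1 hw3).trans_lt ?_
  rwa [edist_comm]

/-- The developing map does not increase distances. -/
theorem edist_star_le (i : ZMod 3) (g : Γ) {a b : ℍ} (ha : a ∈ starRegion n)
    (hb : b ∈ starRegion n) : edist (star x n i g a) (star x n i g b) ≤ edist a b := by
  obtain ⟨γ, hγ, h0, h1, hk⟩ := exists_geodesic a b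
  have hseg := fun {s t : ℝ} => mem_hypSegment_of_klein_eq hk (s := s) (t := t)
  have hmem : ∀ s ∈ Set.Icc (0 : ℝ) 1, γ s ∈ starRegion n := fun s hs =>
    hypConvex_starRegion n a ha b hb (h1 ▸ hseg hs.1 hs.2 le_rfl)
  set A : Set ℝ := {s | edist (star x n i g a) (star x n i g (γ s)) ≤ edist a (γ s)} with hA
  have hclosed : IsClosed (A ∩ Set.Icc 0 1) := by
    rw [Set.inter_comm]
    have c1 : Continuous fun b => edist (star x n i g a) b := continuous_const.edist continuous_id
    have c2 : Continuous fun b => edist a b := continuous_const.edist continuous_id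
    exact isClosed_Icc.isClosed_le (c1.comp_continuousOn ((hS.continuousOn_star i g).comp hγ hmem))
      (c2.comp_continuousOn hγ)
  -- The set of parameters up to which distances do not increase is closed and open to the right.
  have hsub : Set.Icc (0 : ℝ) 1 ⊆ A := by
    refine hclosed.Icc_subset_of_forall_mem_nhdsWithin ?_ ?_
    · rw [hA, Set.mem_ofPred_eq, h0, edist_self]
      exact zero_le
    · rintro s ⟨hsA, hs⟩
      have hc : Filter.Tendsto γ (nhdsWithin s (Set.Ioi s)) (nhds (γ s)) :=
        (hγ s ⟨hs.1, hs.2.le⟩).mono_of_mem_nhdsWithin (Icc_mem_nhdsGT_of_mem hs)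
      filter_upwards [hc.eventually (hS.eventually_edist_star_le i g), Ioc_mem_nhdsGT hs.2]
        with t ht hst
      have hadd : dist a (γ s) + dist (γ s) (γ t) = dist a (γ t) := hseg hs.1 hst.1.le hst.2
      calc edist (star x n i g a) (star x n i g (γ t))
          ≤ edist a (γ s) + edist (γ s) (γ t) := (edist_triangle _ (star x n i g (γ s)) _).trans
            (add_le_add hsA (ht (hmem t ⟨hs.1.trans hst.1.le, hst.2⟩)))
        _ = edist a (γ t) := by
          rw [edist_dist, edist_dist, edist_dist, ← ENNReal.ofReal_add dist_nonneg dist_nonneg,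
            hadd]
  have := hsub ⟨zero_le_one, le_rfl⟩
  rwa [hA, Set.mem_ofPred_eq, h1] at this

/-- On a ball whose fourfold enlargement lies in the star, the developing map is an isometry. -/
theorem edist_star_eq {i : ZMod 3} {g : Γ} {z : ℍ} {R : ℝ}
    (hR : Metric.ball z (4 * R) ⊆ starRegion n) {a b : ℍ} (ha : a ∈ Metric.ball z R)
    (hb : b ∈ Metric.ball z R) : edist (star x n i g a) (star x n i g b) = edist a b := by
  rw [Metric.mem_ball] at ha hb
  have hR0 : 0 < R := dist_nonneg.trans_lt ha
  have hab : dist a b < 2 * R := by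
    have := dist_triangle_right a b z
    linarith
  have hsub : ∀ w, dist w z < 4 * R → w ∈ starRegion n := fun w hw => hR hw
  have h1 := hS.edist_star_le i g (hsub a (by linarith)) (hsub b (by linarith))
  refine le_antisymm h1 ?_
  -- A short chain from the image of `a` to that of `b` lifts to one from `a` which stays in the star;
  -- it ends in `b` by injectivity.
  have hball : ∀ w, edist a w < ENNReal.ofReal (2 * R) → w ∈ starRegion n := by
    intro w hw
    rw [edist_dist, ENNReal.ofReal_lt_ofReal_iff (by linarith)] at hw
    refine hsub w ?_
    have := dist_triangle_left w z a
    linarith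
  have hab' : edist a b < ENNReal.ofReal (2 * R) := by
    rwa [edist_dist, ENNReal.ofReal_lt_ofReal_iff (by linarith)]
  obtain ⟨w, hw, hle⟩ := hS.exists_lift_of_edist_lt hball (h1.trans_lt hab')
  have := hS.injOn_star i g (hball w ((hle.trans h1).trans_lt hab')) (hball b hab') hw
  rwa [this] at hle

theorem image_star_ball {i : ZMod 3} {g : Γ} {z : ℍ} {R : ℝ}
    (hR : Metric.ball z R ⊆ starRegion n) :
    star x n i g '' Metric.ball z R = Metric.eball (star x n i g z) (ENNReal.ofReal R) := by
  rcases le_or_gt R 0 with h0 | h0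
  · rw [Metric.ball_eq_empty.2 h0, ENNReal.ofReal_of_nonpos h0]
    simp
  have hz : z ∈ starRegion n := hR (Metric.mem_ball_self h0)
  ext b
  constructor
  · rintro ⟨w, hw, rfl⟩
    have := hS.edist_star_le i g (hR hw) hz
    refine this.trans_lt ?_
    rw [edist_dist]
    exact (ENNReal.ofReal_lt_ofReal_iff h0).2 hw
  · intro hb
    have hb' : edist (star x n i g z) b < ENNReal.ofReal R := by
      rw [edist_comm]; exact hb
    obtain ⟨w, hw, hle⟩ := hS.exists_lift_of_edist_lt (R := ENNReal.ofReal R) (fun w hw => by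
      rw [edist_comm, edist_dist] at hw
      exact hR ((ENNReal.ofReal_lt_ofReal_iff h0).1 hw)) hb'
    refine ⟨w, ?_, hw⟩
    have := hle.trans_lt hb'
    rw [edist_comm, edist_dist] at this
    exact (ENNReal.ofReal_lt_ofReal_iff h0).1 this

theorem isOpen_image_star {i : ZMod 3} {g : Γ} {U : Set ℍ} (hU : IsOpen U)
    (hUs : U ⊆ starRegion n) : IsOpen (star x n i g '' U) := by
  rw [isOpen_iff_mem_nhds]
  rintro _ ⟨z, hz, rfl⟩
  obtain ⟨R, hR, hb⟩ := Metric.isOpen_iff.1 hU z hz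
  refine Filter.mem_of_superset ?_ (Set.image_mono hb)
  rw [hS.image_star_ball (hb.trans hUs)]
  exact Metric.eball_mem_nhds _ (ENNReal.ofReal_pos.2 hR)

end IsTriangleSystem

end LocalIsometry

/-! ### The surface is closed, connected and hyperbolic -/

section ClosedSurface

open scoped ENNReal

variable {Γ : Type} [Group Γ] {x : ZMod 3 → Γ} {n : ℕ}

instance : Finite Colour :=
  Finite.of_injective (fun c => match c with | Colour.white => true | Colour.black => false)
    (by rintro (_ | _) (_ | _) h <;> simp_all)

theorem continuousOn_pt (s : Γ × Colour) : ContinuousOn (pt x n s) (triangle n) := by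
  have : LipschitzOnWith 1 (pt x n s) (triangle n) := fun p hp q hq => by
    rw [ENNReal.coe_one, one_mul]
    exact edist_pt_le hp hq s
  exact this.continuousOn

theorem compactSpace_gluedSurface [Finite Γ] : CompactSpace (GluedSurface x n) := by
  constructor
  have : (Set.univ : Set (GluedSurface x n)) = ⋃ s : Γ × Colour, pt x n s '' triangle n := by
    refine (Set.eq_univ_of_forall fun a => ?_).symm
    obtain ⟨s, p, hp, rfl⟩ := exists_pt a
    exact Set.mem_iUnion.2 ⟨s, p, hp, rfl⟩
  rw [this]
  exact isCompact_iUnion fun s => (isCompact_triangle n).image_of_continuousOn (continuousOn_pt s)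

namespace IsTriangleSystem

variable (hS : IsTriangleSystem x n)
include hS

theorem eq_of_edist_eq_zero {a b : GluedSurface x n} (h : edist a b = 0) : a = b := by
  obtain ⟨i, g, z, hz, rfl⟩ := hS.exists_star_eq a
  obtain ⟨R, hR, hb⟩ := Metric.isOpen_iff.1 (isOpen_starRegion hS.four_le) z hz
  have hR' : ∀ w, edist z w < ENNReal.ofReal R → w ∈ starRegion n := fun w hw => by
    rw [edist_comm, edist_dist] at hw
    exact hb ((ENNReal.ofReal_lt_ofReal_iff hR).1 hw)
  obtain ⟨w, hw, hle⟩ := hS.exists_lift_of_edist_lt hR'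
    (h.symm ▸ ENNReal.ofReal_pos.2 hR : edist _ b < ENNReal.ofReal R)
  rw [h, nonpos_iff_eq_zero, edist_eq_zero] at hle
  rw [hle, hw]

theorem t2Space : T2Space (GluedSurface x n) := by
  have : T0Space (GluedSurface x n) := ⟨fun a b h =>
    hS.eq_of_edist_eq_zero (EMetric.inseparable_iff.1 h)⟩
  infer_instance

/-- A set of triangles which contains with a triangle its neighbours contains all of them if it is
not empty. -/
theorem forall_of_across {P : Γ × Colour → Prop} (h1 : P (1, Colour.white))
    (hP : ∀ i s, P s → P (across x i s)) (s : Γ × Colour) : P s := by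
  have hP' : ∀ i s, P (across x i s) → P s := fun i s h => by
    have := hP i _ h
    rwa [across_across] at this
  have hsec : ∀ (i : ZMod 3) (g : Γ) (j : ℤ), P (sector x i g (j + 1)) ↔ P (sector x i g j) := by
    intro i g j
    rw [sector_succ hS.mul_eq_one]
    exact ⟨hP' _ _, hP _ _⟩
  have hgen : ∀ (i : ZMod 3) (g : Γ), P (g * x i, Colour.white) ↔ P (g, Colour.white) := by
    intro i g
    have h1 := hsec i g (2 * 0)
    have h2 := hsec i g (2 * 0 + 1)
    rw [h1, show (2 * 0 + 1 + 1 : ℤ) = 2 * 1 by norm_num, sector_even, sector_even, zpow_one,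
      zpow_zero, mul_one] at h2
    exact h2
  have hall : ∀ h : Γ, ∀ g : Γ, P (g * h, Colour.white) ↔ P (g, Colour.white) := by
    intro h
    have hh : h ∈ Subgroup.closure (Set.range x) := by rw [hS.closure_eq_top]; trivial
    induction hh using Subgroup.closure_induction with
    | mem y hy =>
      obtain ⟨i, rfl⟩ := hy
      exact hgen i
    | one => simp
    | mul a b _ _ ha hb => exact fun g => by rw [← mul_assoc, hb, ha]
    | inv a _ ha => exact fun g => by rw [← ha (g * a⁻¹), inv_mul_cancel_right]
  have hw : ∀ g, P (g, Colour.white) := fun g => by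
    have := hall g 1
    rw [one_mul] at this
    exact this.2 h1
  obtain ⟨g, _ | _⟩ := s
  · exact hw g
  · have : crossing x 1 = 1 := rfl
    have := hP 1 _ (hw g)
    simpa [across, crossing] using this

theorem connectedSpace : ConnectedSpace (GluedSurface x n) := by
  have hn := hS.four_le
  have hI := I_mem_triangle hn
  set a := pt x n (1, Colour.white) UpperHalfPlane.I with ha
  have hpre : ∀ s, IsPreconnected (pt x n s '' triangle n) := fun s =>
    (HypConvex.isPreconnected (hypConvex_hypHull _)).image _ (continuousOn_pt s)
  have hall : ∀ s, pt x n s '' triangle n ⊆ connectedComponent a := by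
    refine hS.forall_of_across ?_ fun i s hs => ?_
    · exact (hpre _).subset_connectedComponent ⟨_, hI, rfl⟩
    · have hv : triVertex n (i + 1) ∈ triangle n := subset_hypHull _ ⟨_, rfl⟩
      have h0 : bary n i (triVertex n (i + 1)) = 0 := by
        rw [bary_triVertex]
        simp
      have hmem := hs ⟨_, hv, rfl⟩
      rw [← pt_across hn hv h0] at hmem
      rw [connectedComponent_eq hmem]
      exact (hpre _).subset_connectedComponent ⟨_, hv, rfl⟩
  refine connectedSpace_iff_connectedComponent.2 ⟨a, Set.eq_univ_of_forall fun b => ?_⟩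
  obtain ⟨s, p, hp, rfl⟩ := exists_pt b
  exact hall s ⟨p, hp, rfl⟩

end IsTriangleSystem

theorem sector_snd_eq_white (i : ZMod 3) (g : Γ) (j : ℤ) :
    (sector x i g j).2 = Colour.white ↔ Even j := by
  unfold sector
  split_ifs with h <;> simp [h]

/-- Two placements of a triangle with the same colour differ by an orientation-preserving isometry
of the hyperbolic plane. -/
theorem exists_smul_place_eq (n : ℕ) (i i' : ZMod 3) {j k : ℤ} (h : Even j ↔ Even k) :
    ∃ A : SL(2, ℝ), ∀ p, place n i' k p = A • place n i j p := by
  by_cases hj : Even j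
  · refine ⟨rotation (halfAngle n * k) * toVertex n i' * (rotation (halfAngle n * j) *
      toVertex n i)⁻¹, fun p => ?_⟩
    rw [place_apply, place_apply, spin_apply_of_even n hj, spin_apply_of_even n (h.1 hj),
      ← mul_smul, ← mul_smul, ← mul_smul]
    congr 1
    group
  · obtain ⟨B, hB⟩ := exists_mirror_smul_mirror (toVertex n i' * (toVertex n i)⁻¹)
    refine ⟨rotation (halfAngle n * k) * B * (rotation (halfAngle n * j))⁻¹, fun p => ?_⟩
    rw [place_apply, place_apply, spin_apply_of_odd n hj,
      spin_apply_of_odd n (fun hk => hj (h.2 hk)), mul_smul, inv_smul_smul, mul_smul, ← hB,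
      mirror_mirror, mul_smul, inv_smul_smul]

/-- The charts of the surface: distance-preserving inverses of restrictions of the developing maps
around the vertices. -/
def IsStarChart (e : OpenPartialHomeomorph (GluedSurface x n) ℍ) : Prop :=
  ∃ i g, e.target ⊆ starRegion n ∧ (∀ z ∈ e.target, e.symm z = star x n i g z) ∧
    ∀ s ∈ e.source, ∀ t ∈ e.source, edist (e s) (e t) = edist s t

namespace IsTriangleSystem

variable (hS : IsTriangleSystem x n)
include hS

theorem exists_isStarChart (a : GluedSurface x n) :
    ∃ e : OpenPartialHomeomorph (GluedSurface x n) ℍ, IsStarChart e ∧ a ∈ e.source := by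
  obtain ⟨i, g, z, hz, rfl⟩ := hS.exists_star_eq a
  obtain ⟨R, hR, hb⟩ := Metric.isOpen_iff.1 (isOpen_starRegion hS.four_le) z hz
  have hb4 : Metric.ball z (4 * (R / 4)) ⊆ starRegion n := by
    rwa [mul_div_cancel₀ _ (by norm_num : (4 : ℝ) ≠ 0)]
  have hsub : Metric.ball z (R / 4) ⊆ starRegion n :=
    (Metric.ball_subset_ball (by linarith)).trans hb
  set E := ((hS.injOn_star i g).mono hsub).toPartialEquiv (star x n i g) (Metric.ball z (R / 4))
  have hiso : ∀ w ∈ E.source, ∀ w' ∈ E.source, edist (E w) (E w') = edist w w' :=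
    fun w hw w' hw' => hS.edist_star_eq hb4 hw hw'
  have hiso' : ∀ s ∈ E.target, ∀ t ∈ E.target, edist (E.symm s) (E.symm t) = edist s t := by
    intro s hs t ht
    rw [← hiso _ (E.map_target hs) _ (E.map_target ht), E.right_inv hs, E.right_inv ht]
  have hL : ∀ {α β : Type} [PseudoEMetricSpace α] [PseudoEMetricSpace β] {f : α → β} {s : Set α},
      (∀ a ∈ s, ∀ b ∈ s, edist (f a) (f b) = edist a b) → ContinuousOn f s := by
    intro α β _ _ f s h
    have : LipschitzOnWith 1 f s := fun a ha b hb => by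
      rw [h a ha b hb, ENNReal.coe_one, one_mul]
    exact this.continuousOn
  let e : OpenPartialHomeomorph ℍ (GluedSurface x n) :=
    { E with
      open_source := Metric.isOpen_ball
      open_target := hS.isOpen_image_star Metric.isOpen_ball hsub
      continuousOn_toFun := hL hiso
      continuousOn_invFun := hL hiso' }
  exact ⟨e.symm, ⟨i, g, hsub, fun _ _ => rfl, hiso'⟩, z, Metric.mem_ball_self (by positivity), rfl⟩

/-- Changes of coordinates are orientation-preserving isometries: this holds on the intersection
with each triangle, and an isometry is determined by its values on an open set. -/
theorem exists_smul_eq {e e' : OpenPartialHomeomorph (GluedSurface x n) ℍ} (he : IsStarChart e)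
    (he' : IsStarChart e') {s : GluedSurface x n} (hs : s ∈ e.source ∩ e'.source) :
    ∃ A : SL(2, ℝ), ∀ᶠ t in nhds s, e' t = A • e t := by
  have hn := hS.four_le
  obtain ⟨i, g, hsub, hsymm, hiso⟩ := he
  obtain ⟨i', g', hsub', hsymm', hiso'⟩ := he'
  obtain ⟨j, p, hp, -, hpz⟩ := exists_place_of_mem_starRegion hn i (hsub (e.map_source hs.1))
  have hstar : ∀ t ∈ e.source, star x n i g (e t) = t := fun t ht => by
    rw [← hsymm _ (e.map_source ht), e.left_inv ht]
  have hstar' : ∀ t ∈ e'.source, star x n i' g' (e' t) = t := fun t ht => by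
    rw [← hsymm' _ (e'.map_source ht), e'.left_inv ht]
  have hpt : s = pt x n (sector x i g j) p := by
    rw [← hS.star_place i g j hp, hpz, hstar s hs.1]
  obtain ⟨k, hk, hkz⟩ := hS.exists_lift (hsub' (e'.map_source hs.2)) hp
    ((hstar' s hs.2).trans hpt)
  have hpar : Even j ↔ Even k := by
    rw [← sector_snd_eq_white i g, ← sector_snd_eq_white i' g', hk]
  obtain ⟨A, hA⟩ := exists_smul_place_eq n i i' hpar
  refine ⟨A, ?_⟩
  have hW : e.source ∩ e'.source ∈ nhds s :=
    Filter.inter_mem (e.open_source.mem_nhds hs.1) (e'.open_source.mem_nhds hs.2)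
  -- The points of the interior of the triangle whose images lie in the domains of both charts.
  set O : Set ℍ := {q | ∀ l, 0 < bary n l q} with hO
  have hOo : IsOpen O := by
    have : O = ⋂ l, {q | 0 < bary n l q} := by ext q; simp [hO]
    rw [this]
    exact isOpen_iInter_of_finite fun l => isOpen_lt continuous_const (continuous_bary n l)
  have hev : ∀ᶠ q in nhds p, place n i j q ∈ e.target ∩ e.symm ⁻¹' (e.source ∩ e'.source) := by
    have h1 : e.target ∩ e.symm ⁻¹' (e.source ∩ e'.source) ∈ nhds (place n i j p) := by
      rw [hpz]
      refine Filter.inter_mem (e.open_target.mem_nhds (e.map_source hs.1)) ?_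
      refine (e.continuousAt_symm (e.map_source hs.1)) ?_
      rwa [e.left_inv hs.1]
    exact (place n i j).continuous.continuousAt h1
  obtain ⟨U, hU, hUo, hpU⟩ := mem_nhds_iff.1 hev
  obtain ⟨q₀, hq₀U, hq₀⟩ := exists_bary_pos_of_mem_nhds hn hp (hUo.mem_nhds hpU)
  have hmain : ∀ q ∈ U ∩ O, ∃ u ∈ e.source ∩ e'.source, e u = place n i j q ∧
      e' u = place n i' k q := by
    rintro q ⟨hqU, hqO⟩
    have hqT : q ∈ triangle n := (mem_triangle_iff hn).2 fun l => (hqO l).le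
    obtain ⟨h1, h2⟩ := hU hqU
    refine ⟨e.symm (place n i j q), h2, e.right_inv h1, ?_⟩
    have h3 : star x n i' g' (e' (e.symm (place n i j q))) = pt x n (sector x i g j) q := by
      rw [hstar' _ h2.2, hsymm _ h1, hS.star_place i g j hqT]
    have h4 : star x n i' g' (place n i' k q) = pt x n (sector x i g j) q := by
      rw [hS.star_place i' g' k hqT, hk]
    refine hS.injOn_star i' g' (hsub' (e'.map_source h2.2)) ?_ (h3.trans h4.symm)
    exact (place_mem_starRegion_iff hn (hqO _).le (hqO _).le).2 (hqO _)
  filter_upwards [hW] with t ht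
  refine eq_of_dist_eq_on_open (U := place n i' k '' (U ∩ O))
    ((place n i' k).toHomeomorph.isOpenMap _ (hUo.inter hOo)) ⟨_, q₀, ⟨hq₀U, hq₀⟩, rfl⟩ ?_
  rintro _ ⟨q, hq, rfl⟩
  obtain ⟨u, hu, hu1, hu2⟩ := hmain q hq
  have e1 := hiso t ht.1 u hu.1
  have e2 := hiso' t ht.2 u hu.2
  rw [hu1] at e1
  rw [hu2, ← e1, edist_dist, edist_dist, ENNReal.ofReal_eq_ofReal_iff dist_nonneg dist_nonneg] at e2
  rw [e2, hA, dist_smul]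

theorem isClosedOrientableHyperbolicSurface [Finite Γ] :
    IsClosedOrientableHyperbolicSurface (GluedSurface x n) :=
  ⟨compactSpace_gluedSurface, hS.connectedSpace, hS.t2Space, {e | IsStarChart e},
    fun s => hS.exists_isStarChart s, fun _ he => he.choose_spec.choose_spec.2.2,
    fun _ he _ he' _ hs => hS.exists_smul_eq he he' hs⟩

end IsTriangleSystem

end ClosedSurface

/-! ### The action of the group by isometries -/

section Translations

open scoped ENNReal

variable {Γ : Type} [Group Γ] {x : ZMod 3 → Γ} {n : ℕ}

/-- Left multiplication of all labels by a group element. -/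
def leftMul (h : Γ) : GluedSurface x n → GluedSurface x n :=
  Quot.map (fun t => (h * t.1, t.2)) (by
    rintro _ _ ⟨g, i, p, hp⟩
    have := Glue.side (x := x) (h * g) i p hp
    rwa [mul_assoc] at this)

theorem leftMul_leftMul (h h' : Γ) (a : GluedSurface x n) :
    leftMul h (leftMul h' a) = leftMul (h * h') a := by
  obtain ⟨⟨g, c, p⟩, rfl⟩ := Quot.exists_rep a
  change Quot.mk _ (h * (h' * g), c, p) = Quot.mk _ (h * h' * g, c, p)
  rw [mul_assoc]

theorem leftMul_one (a : GluedSurface x n) : leftMul 1 a = a := by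
  obtain ⟨⟨g, c, p⟩, rfl⟩ := Quot.exists_rep a
  change Quot.mk _ (1 * g, c, p) = Quot.mk _ (g, c, p)
  rw [one_mul]

theorem IsChain.leftMul (h : Γ) {a b : GluedSurface x n} {ℓ : ℝ≥0∞} (hc : IsChain x n a b ℓ) :
    IsChain x n (leftMul h a) (leftMul h b) ℓ := by
  induction hc with
  | nil a => exact IsChain.nil _
  | cons g c p q _ ih => exact IsChain.cons (h * g) c p q ih

theorem edist_leftMul_le (h : Γ) (a b : GluedSurface x n) :
    edist (leftMul h a) (leftMul h b) ≤ edist a b :=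
  le_iInf₂ fun ℓ hc => iInf₂_le ℓ (hc.leftMul h)

/-- The isometry of the surface given by left multiplication. -/
def leftMulIso (h : Γ) : GluedSurface x n ≃ᵢ GluedSurface x n where
  toFun := leftMul h
  invFun := leftMul h⁻¹
  left_inv a := by rw [leftMul_leftMul, inv_mul_cancel, leftMul_one]
  right_inv a := by rw [leftMul_leftMul, mul_inv_cancel, leftMul_one]
  isometry_toFun a b := by
    refine le_antisymm (edist_leftMul_le h a b) ?_
    have := edist_leftMul_le h⁻¹ (leftMul h a) (leftMul h b)
    rwa [leftMul_leftMul, leftMul_leftMul, inv_mul_cancel, leftMul_one, leftMul_one] at this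

theorem leftMulIso_injective (hn : 4 ≤ n) :
    Function.Injective (leftMulIso : Γ → (GluedSurface x n ≃ᵢ GluedSurface x n)) := by
  intro h h' he
  have h1 : leftMul h (pt x n (1, Colour.white) UpperHalfPlane.I) =
      leftMul h' (pt x n (1, Colour.white) UpperHalfPlane.I) :=
    congrArg (fun e : GluedSurface x n ≃ᵢ GluedSurface x n =>
      e (pt x n (1, Colour.white) UpperHalfPlane.I)) he
  have h2 : ∀ h : Γ, leftMul h (pt x n (1, Colour.white) UpperHalfPlane.I) =
      pt x n (h * 1, Colour.white) UpperHalfPlane.I := fun _ => rfl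
  rw [h2, h2, mul_one, mul_one] at h1
  have := eq_of_pt_eq_of_pos hn (I_mem_triangle hn) (I_mem_triangle hn)
    (fun i => by rw [bary_I]; exact sh_pos hn) h1
  exact congrArg Prod.fst this

theorem card_le_card_isometryEquiv (hn : 4 ≤ n) :
    ENat.card Γ ≤ ENat.card (GluedSurface x n ≃ᵢ GluedSurface x n) :=
  ENat.card_le_card_of_injective (leftMulIso_injective hn)

end Translations

/-! ### The vertices and edges of the tessellation -/

section Counting

variable {Γ : Type} [Group Γ] {x : ZMod 3 → Γ} {n : ℕ}

theorem card_colour : Nat.card Colour = 2 := by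
  have e : Colour ≃ Bool :=
    { toFun := fun c => match c with | Colour.white => true | Colour.black => false
      invFun := fun b => if b then Colour.white else Colour.black
      left_inv := by rintro (_ | _) <;> rfl
      right_inv := by rintro (_ | _) <;> rfl }
  rw [Nat.card_congr e, Nat.card_eq_fintype_card, Fintype.card_bool]

theorem tessVertices_eq (hn : 4 ≤ n) :
    tessVertices x n = Set.range fun s : Γ × Colour => pt x n s UpperHalfPlane.I := by
  have hI := I_mem_triangle hn
  ext a
  constructor
  · rintro ⟨g, c, ⟨p, hp⟩, rfl, rfl⟩
    exact ⟨(g, c), pt_of_mem hp _⟩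
  · rintro ⟨s, rfl⟩
    exact ⟨s.1, s.2, ⟨_, hI⟩, rfl, pt_of_mem hI s⟩

theorem bary_I_pos (hn : 4 ≤ n) (i : ZMod 3) : 0 < bary n i UpperHalfPlane.I := by
  rw [bary_I]
  exact sh_pos hn

theorem tessEdge_eq (hn : 4 ≤ n) (g : Γ) (i : ZMod 3) : tessEdge x n g i =
    pt x n (g, Colour.white) '' triSpoke n i ∪
      pt x n (across x i (g, Colour.white)) '' triSpoke n i := by
  ext a
  constructor
  · rintro ⟨⟨p, hpT⟩, hp, rfl | rfl⟩
    · exact Or.inl ⟨p, hp, pt_of_mem hpT _⟩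
    · exact Or.inr ⟨p, hp, pt_of_mem hpT _⟩
  · rintro (⟨p, hp, rfl⟩ | ⟨p, hp, rfl⟩)
    · have hpT := ((mem_triSpoke_iff hn).1 hp).1
      exact ⟨⟨p, hpT⟩, hp, Or.inl (pt_of_mem hpT _)⟩
    · have hpT := ((mem_triSpoke_iff hn).1 hp).1
      exact ⟨⟨p, hpT⟩, hp, Or.inr (pt_of_mem hpT _)⟩

/-- The two halves of an edge may be listed starting from either of its end points. -/
theorem exists_tessEdge_eq (hn : 4 ≤ n) (s : Γ × Colour) (i : ZMod 3) :
    ∃ g, tessEdge x n g i =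
      pt x n s '' triSpoke n i ∪ pt x n (across x i s) '' triSpoke n i := by
  obtain ⟨g, _ | _⟩ := s
  · exact ⟨g, tessEdge_eq hn g i⟩
  · refine ⟨g * (crossing x i)⁻¹, ?_⟩
    have h : (g * (crossing x i)⁻¹, Colour.white) = across x i (g, Colour.black) := rfl
    rw [tessEdge_eq hn, h, across_across, Set.union_comm]

theorem mem_sUnion_tessEdges (hn : 4 ≤ n) {a : GluedSurface x n} :
    a ∈ ⋃₀ tessEdges x n ↔ ∃ s i, ∃ p ∈ triSpoke n i, pt x n s p = a := by
  constructor
  · rintro ⟨_, ⟨g, i, rfl⟩, ha⟩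
    rw [tessEdge_eq hn] at ha
    rcases ha with ⟨p, hp, rfl⟩ | ⟨p, hp, rfl⟩
    exacts [⟨_, i, p, hp, rfl⟩, ⟨_, i, p, hp, rfl⟩]
  · rintro ⟨s, i, p, hp, rfl⟩
    obtain ⟨g, hg⟩ := exists_tessEdge_eq (x := x) hn s i
    exact ⟨_, ⟨g, i, rfl⟩, hg ▸ Or.inl ⟨p, hp, rfl⟩⟩

theorem tessEdge_injective (hn : 4 ≤ n) :
    Function.Injective fun t : Γ × ZMod 3 => tessEdge x n t.1 t.2 := by
  rintro ⟨g, i⟩ ⟨g', i'⟩ h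
  have h : tessEdge x n g i = tessEdge x n g' i' := h
  have hI := I_mem_triangle hn
  have hg : g = g' := by
    have h1 : pt x n (g, Colour.white) UpperHalfPlane.I ∈ tessEdge x n g' i' := by
      rw [← h, tessEdge_eq hn]
      exact Or.inl ⟨_, (mem_triSpoke_iff hn).2
        ⟨hI, by rw [bary_I, bary_I], by rw [bary_I, bary_I]⟩, rfl⟩
    rw [tessEdge_eq hn] at h1
    rcases h1 with ⟨p, hp, he⟩ | ⟨p, hp, he⟩
    · exact congrArg Prod.fst (eq_of_pt_eq_of_pos hn hI ((mem_triSpoke_iff hn).1 hp).1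
        (bary_I_pos hn) he.symm)
    · have := congrArg Prod.snd (eq_of_pt_eq_of_pos hn hI ((mem_triSpoke_iff hn).1 hp).1
        (bary_I_pos hn) he.symm)
      cases this
  obtain ⟨m, hm, h0, h1, h2, -⟩ := exists_midpoint hn i
  have hi : i = i' := by
    have h3 : pt x n (g, Colour.white) m ∈ tessEdge x n g' i' := by
      rw [← h, tessEdge_eq hn]
      exact Or.inl ⟨_, (mem_triSpoke_iff hn).2 ⟨hm, h1, by rw [h0]; exact h2.le⟩, rfl⟩
    have h4 : m ∈ triSpoke n i' := by
      rw [tessEdge_eq hn] at h3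
      rcases h3 with ⟨p, hp, he⟩ | ⟨p, hp, he⟩
      · exact (eq_of_pt_eq hn hm ((mem_triSpoke_iff hn).1 hp).1 he.symm).1 ▸ hp
      · exact (eq_of_pt_eq hn hm ((mem_triSpoke_iff hn).1 hp).1 he.symm).1 ▸ hp
    obtain ⟨-, h5, -⟩ := (mem_triSpoke_iff hn).1 h4
    have hd : ∀ i i' : ZMod 3, i = i' ∨ (i' + 1 = i + 2 ∧ i' + 2 = i) ∨
        (i' + 1 = i ∧ i' + 2 = i + 1) := by decide
    rcases hd i i' with h | ⟨e1, e2⟩ | ⟨e1, e2⟩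
    · exact h
    · rw [e1, e2, h0] at h5; linarith
    · rw [e1, e2, h0] at h5; linarith
  rw [hg, hi]

namespace IsTriangleSystem

variable (hS : IsTriangleSystem x n)
include hS

theorem ncard_tessVertices : (tessVertices x n).ncard = 2 * Nat.card Γ := by
  have hn := hS.four_le
  have hI := I_mem_triangle hn
  rw [tessVertices_eq hn, ← Nat.card_coe_set_eq, Nat.card_range_of_injective, Nat.card_prod,
    card_colour, mul_comm]
  exact fun s t h => eq_of_pt_eq_of_pos hn hI hI (bary_I_pos hn) h

theorem ncard_tessEdges : (tessEdges x n).ncard = 3 * Nat.card Γ := by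
  have : tessEdges x n = Set.range fun t : Γ × ZMod 3 => tessEdge x n t.1 t.2 := by
    ext e
    constructor
    · rintro ⟨g, i, rfl⟩
      exact ⟨(g, i), rfl⟩
    · rintro ⟨t, rfl⟩
      exact ⟨t.1, t.2, rfl⟩
  rw [this, ← Nat.card_coe_set_eq, Nat.card_range_of_injective (tessEdge_injective hS.four_le),
    Nat.card_prod, Nat.card_zmod, mul_comm]

end IsTriangleSystem

end Counting

/-! ### The faces of the tessellation -/

section Faces

variable {Γ : Type} [Group Γ] {x : ZMod 3 → Γ} {n : ℕ}

/-- If a set is the union of nonempty open preconnected sets any two of which are equal or disjoint,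
then these are its connected components. -/
theorem connectedComponents_eq_range {X ι : Type} [TopologicalSpace X] {C : Set X} {U : ι → Set X}
    (hC : C = ⋃ i, U i) (ho : ∀ i, IsOpen (U i)) (hp : ∀ i, IsPreconnected (U i))
    (hne : ∀ i, (U i).Nonempty) (hd : ∀ i j, (U i ∩ U j).Nonempty → U i = U j) :
    {f | ∃ s ∈ C, f = connectedComponentIn C s} = Set.range U := by
  have key : ∀ i, ∀ s ∈ U i, connectedComponentIn C s = U i := by
    intro i s hs
    have hsC : U i ⊆ C := hC ▸ Set.subset_iUnion U i
    refine Set.Subset.antisymm ?_ ((hp i).subset_connectedComponentIn hs hsC)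
    have hu : IsOpen (⋃ j ∈ {j | Disjoint (U i) (U j)}, U j) := isOpen_biUnion fun j _ => ho j
    refine isPreconnected_connectedComponentIn.subset_left_of_subset_union (ho i) hu ?_ ?_
      ⟨s, mem_connectedComponentIn (hsC hs), hs⟩
    · exact Set.disjoint_iUnion₂_right.2 fun j hj => hj
    · refine (connectedComponentIn_subset C s).trans ?_
      rw [hC]
      refine Set.iUnion_subset fun j => ?_
      by_cases hj : (U i ∩ U j).Nonempty
      · rw [← hd i j hj]
        exact Set.subset_union_left
      · exact (Set.subset_biUnion_of_mem (u := U)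
          (Set.disjoint_iff_inter_eq_empty.2 (Set.not_nonempty_iff_eq_empty.1 hj))).trans
          Set.subset_union_right
  ext f
  constructor
  · rintro ⟨s, hs, rfl⟩
    rw [hC] at hs
    obtain ⟨i, hi⟩ := Set.mem_iUnion.1 hs
    exact ⟨i, (key i s hi).symm⟩
  · rintro ⟨i, rfl⟩
    obtain ⟨s, hs⟩ := hne i
    exact ⟨s, hC ▸ Set.mem_iUnion.2 ⟨i, hs⟩, (key i s hs).symm⟩

theorem faceRegion_subset_closed (n : ℕ) : faceRegion n ⊆ closedFaceRegion n :=
  fun _ hz j => (hz j).le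

theorem exists_sector_eq (i : ZMod 3) (s : Γ × Colour) : ∃ g j, sector x i g j = s := by
  obtain ⟨g, _ | _⟩ := s
  · exact ⟨g, 2 * 0, by rw [sector_even, zpow_zero, mul_one]⟩
  · exact ⟨g * (crossing x (i + 1))⁻¹, 2 * 0 + 1, by
      rw [sector_odd, zpow_zero, mul_one, inv_mul_cancel_right]⟩

theorem exists_zpow_of_sector_eq {i : ZMod 3} {g g' : Γ} {j k : ℤ}
    (h : sector x i g j = sector x i g' k) : ∃ a : ℤ, g' = g * x i ^ a := by
  rcases Int.even_or_odd' j with ⟨a, rfl | rfl⟩ <;> rcases Int.even_or_odd' k with ⟨b, rfl | rfl⟩ <;>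
    simp only [sector_even, sector_odd, Prod.mk.injEq, reduceCtorEq, and_false, and_true,
      mul_left_inj] at h <;>
    exact ⟨a - b, by rw [zpow_sub, ← mul_assoc, h, mul_inv_cancel_right]⟩

/-- The interior of the polygon around the `i`-th vertex of the white triangle `g`. -/
def faceAround (x : ZMod 3 → Γ) (n : ℕ) (i : ZMod 3) (g : Γ) : Set (GluedSurface x n) :=
  star x n i g '' faceRegion n

namespace IsTriangleSystem

variable (hS : IsTriangleSystem x n)
include hS

theorem faceRegion_subset_star : faceRegion n ⊆ starRegion n :=
  (faceRegion_subset_closed n).trans (closedFaceRegion_subset hS.four_le)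

theorem mem_faceAround_iff {i : ZMod 3} {g : Γ} {s : Γ × Colour} {p : ℍ} (hp : p ∈ triangle n) :
    pt x n s p ∈ faceAround x n i g ↔
      (bary n (i + 1) p < bary n i p ∧ bary n (i + 2) p < bary n i p) ∧
        ∃ k, sector x i g k = s := by
  have hn := hS.four_le
  have hb := (mem_triangle_iff hn).1 hp
  constructor
  · rintro ⟨z, hz, h⟩
    obtain ⟨k, hk, rfl⟩ := hS.exists_lift (hS.faceRegion_subset_star hz) hp h
    exact ⟨(place_mem_faceRegion_iff hn (hb _) (hb _)).1 hz, k, hk⟩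
  · rintro ⟨h, k, rfl⟩
    exact ⟨_, (place_mem_faceRegion_iff hn (hb _) (hb _)).2 h, hS.star_place i g k hp⟩

theorem compl_sUnion_tessEdges :
    (⋃₀ tessEdges x n)ᶜ = ⋃ t : ZMod 3 × Γ, faceAround x n t.1 t.2 := by
  have hn := hS.four_le
  have hd : ∀ i : ZMod 3, i + 1 + 1 = i + 2 ∧ i + 1 + 2 = i ∧ i + 2 + 1 = i ∧ i + 2 + 2 = i + 1 := by
    decide
  ext a
  obtain ⟨s, p, hp, rfl⟩ := exists_pt a
  rw [Set.mem_compl_iff, mem_sUnion_tessEdges hn, Set.mem_iUnion]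
  constructor
  · intro h
    have h' : ∀ i, bary n (i + 1) p = bary n (i + 2) p → ¬ bary n i p ≤ bary n (i + 1) p :=
      fun i h1 h2 => h ⟨s, i, p, (mem_triSpoke_iff hn).2 ⟨hp, h1, h2⟩, rfl⟩
    obtain ⟨i, hi⟩ := Finite.exists_max fun i => bary n i p
    obtain ⟨d1, d2, d3, d4⟩ := hd i
    obtain ⟨g, j, hj⟩ := exists_sector_eq (x := x) i s
    refine ⟨(i, g), (hS.mem_faceAround_iff hp).2 ⟨⟨?_, ?_⟩, j, hj⟩⟩
    · refine (hi _).lt_of_ne fun he => h' (i + 2) ?_ ?_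
      · rw [d3, d4, he]
      · rw [d3]; exact hi _
    · refine (hi _).lt_of_ne fun he => h' (i + 1) ?_ ?_
      · rw [d1, d2, he]
      · rw [d1, he]; exact hi _
  · rintro ⟨⟨i, g⟩, h⟩ ⟨s', l, q, hq, he⟩
    obtain ⟨hqT, h1, h2⟩ := (mem_triSpoke_iff hn).1 hq
    obtain rfl := (eq_of_pt_eq hn hp hqT he.symm).1
    obtain ⟨⟨h3, h4⟩, -⟩ := (hS.mem_faceAround_iff hp).1 h
    obtain ⟨d1, d2, d3, d4⟩ := hd i
    have : ∀ i l : ZMod 3, l = i ∨ l = i + 1 ∨ l = i + 2 := by decide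
    rcases this i l with rfl | rfl | rfl
    · linarith
    · rw [d1, d2] at h1; linarith
    · rw [d3, d4] at h1; linarith

theorem faceAround_mul_zpow (i : ZMod 3) (g : Γ) (a : ℤ) :
    faceAround x n i (g * x i ^ a) = faceAround x n i g := by
  ext b
  obtain ⟨s, p, hp, rfl⟩ := exists_pt b
  rw [hS.mem_faceAround_iff hp, hS.mem_faceAround_iff hp]
  refine and_congr_right fun _ => ⟨?_, ?_⟩
  · rintro ⟨k, rfl⟩
    exact ⟨k + 2 * a, sector_shift _ _ _ _⟩
  · rintro ⟨k, rfl⟩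
    refine ⟨k - 2 * a, ?_⟩
    rw [← sector_shift, sub_add_cancel]

theorem exists_of_inter_nonempty {i i' : ZMod 3} {g g' : Γ}
    (h : (faceAround x n i g ∩ faceAround x n i' g').Nonempty) :
    i = i' ∧ ∃ a : ℤ, g' = g * x i ^ a := by
  obtain ⟨b, h1, h2⟩ := h
  obtain ⟨s, p, hp, rfl⟩ := exists_pt b
  obtain ⟨⟨a1, a2⟩, k, hk⟩ := (hS.mem_faceAround_iff hp).1 h1
  obtain ⟨⟨b1, b2⟩, k', hk'⟩ := (hS.mem_faceAround_iff hp).1 h2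
  have hd : ∀ i i' : ZMod 3, i = i' ∨ (i' = i + 1 ∧ i' + 2 = i) ∨ (i' = i + 2 ∧ i' + 1 = i) := by
    decide
  obtain rfl : i = i' := by
    rcases hd i i' with h | ⟨e1, e2⟩ | ⟨e1, e2⟩
    · exact h
    · rw [e2, e1] at b2; linarith
    · rw [e2, e1] at b1; linarith
  exact ⟨rfl, exists_zpow_of_sector_eq (hk.trans hk'.symm)⟩

theorem faceAround_nonempty (i : ZMod 3) (g : Γ) : (faceAround x n i g).Nonempty := by
  have hn := hS.four_le
  have hv : triVertex n i ∈ triangle n := subset_hypHull _ ⟨i, rfl⟩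
  have h2 : (2 : ZMod 3) ≠ 0 := by decide
  have hs := sh_pos hn
  refine ⟨pt x n (sector x i g 0) (triVertex n i), (hS.mem_faceAround_iff hv).2 ⟨?_, 0, rfl⟩⟩
  simp [bary_triVertex, h2, hs, ch_pos n]

theorem tessFaces_eq :
    tessFaces x n = Set.range fun t : ZMod 3 × Γ => faceAround x n t.1 t.2 := by
  refine connectedComponents_eq_range hS.compl_sUnion_tessEdges (fun t => ?_) (fun t => ?_)
    (fun t => hS.faceAround_nonempty _ _) ?_
  · exact hS.isOpen_image_star (isOpen_faceRegion hS.four_le) hS.faceRegion_subset_star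
  · exact (hypConvex_faceRegion n).isPreconnected.image _
      ((hS.continuousOn_star _ _).mono hS.faceRegion_subset_star)
  · rintro ⟨i, g⟩ ⟨i', g'⟩ h
    obtain ⟨rfl, a, rfl⟩ := hS.exists_of_inter_nonempty h
    exact (hS.faceAround_mul_zpow _ _ _).symm

theorem card_sigma_quotient [Finite Γ] :
    Nat.card (Σ i : ZMod 3, Γ ⧸ Subgroup.zpowers (x i)) * n = 3 * Nat.card Γ := by
  have h : ∀ i, Nat.card (Γ ⧸ Subgroup.zpowers (x i)) * n = Nat.card Γ := by
    intro i
    rw [Subgroup.card_eq_card_quotient_mul_card_subgroup (Subgroup.zpowers (x i)),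
      Nat.card_zpowers, hS.orderOf_eq]
  rw [Nat.card_sigma, Finset.sum_mul, Finset.sum_congr rfl fun i _ => h i]
  simp [ZMod.card]

theorem ncard_tessFaces [Finite Γ] : (tessFaces x n).ncard * n = 3 * Nat.card Γ := by
  have : tessFaces x n = Set.range fun t : Σ i : ZMod 3, Γ ⧸ Subgroup.zpowers (x i) =>
      faceAround x n t.1 t.2.out := by
    rw [hS.tessFaces_eq]
    ext f
    constructor
    · rintro ⟨⟨i, g⟩, rfl⟩
      refine ⟨⟨i, QuotientGroup.mk g⟩, ?_⟩
      obtain ⟨⟨_, a, rfl⟩, ha⟩ := QuotientGroup.mk_out_eq_mul (Subgroup.zpowers (x i)) g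
      change faceAround x n i (Quotient.out (QuotientGroup.mk g)) = _
      rw [ha]
      exact hS.faceAround_mul_zpow i g a
    · rintro ⟨t, rfl⟩
      exact ⟨(t.1, t.2.out), rfl⟩
  rw [this, ← Nat.card_coe_set_eq, Nat.card_range_of_injective, hS.card_sigma_quotient]
  rintro ⟨i, c⟩ ⟨i', c'⟩ h
  have h : faceAround x n i c.out = faceAround x n i' c'.out := h
  have hne := hS.faceAround_nonempty i c.out
  rw [← Set.inter_self (faceAround x n i c.out)] at hne
  nth_rewrite 2 [h] at hne
  obtain ⟨rfl, a, ha⟩ := hS.exists_of_inter_nonempty hne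
  have : c = c' := by
    rw [← QuotientGroup.out_eq' c, ← QuotientGroup.out_eq' c', QuotientGroup.eq, ha,
      inv_mul_cancel_left]
    exact ⟨a, rfl⟩
  rw [this]

theorem isRegularFace {f : Set (GluedSurface x n)} (hf : f ∈ tessFaces x n) :
    IsRegularFace (tessVertices x n) (tessEdges x n) f (2 * n) (2 * Real.pi / 3) := by
  have hn := hS.four_le
  have : NeZero (2 * n) := ⟨by omega⟩
  rw [hS.tessFaces_eq] at hf
  obtain ⟨⟨i, g⟩, rfl⟩ := hf
  have hsub := closedFaceRegion_subset hn
  have hconv : HypConvex (closedFaceRegion n) := by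
    rw [← hypHull_faceVertex hn]
    exact hypConvex_hypHull _
  refine ⟨UpperHalfPlane.I, fun j => faceVertex n (j.val : ℤ), star x n i g,
    isRegularPolygon_face hn, ?_, ?_, fun j => ⟨?_, ?_⟩⟩
  · rw [range_faceVertex hn, hypHull_faceVertex hn]
    intro p hp
    obtain ⟨R, hR, hb⟩ := Metric.isOpen_iff.1 (isOpen_starRegion hn) p (hsub hp)
    have hb4 : Metric.ball p (4 * (R / 4)) ⊆ starRegion n := by
      rwa [mul_div_cancel₀ _ (by norm_num : (4 : ℝ) ≠ 0)]
    exact ⟨Metric.ball p (R / 4), Metric.ball_mem_nhds p (by positivity),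
      fun q hq r hr => hS.edist_star_eq hb4 hq.1 hr.1⟩
  · rw [range_faceVertex hn, hypHull_faceVertex hn, interior_closedFaceRegion hn]
    exact ((hS.injOn_star i g).mono hS.faceRegion_subset_star).bijOn_image
  · change star x n i g (faceVertex n (j.val : ℤ)) ∈ _
    rw [← place_I n i, hS.star_place i g _ (I_mem_triangle hn), tessVertices_eq hn]
    exact ⟨_, rfl⟩
  · set l : ℤ := (j.val : ℤ) with hl
    have e : faceVertex n (((j + 1).val : ℕ) : ℤ) = faceVertex n (l + 1) :=
      faceVertex_congr hn (by simp [hl])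
    change ∃ e ∈ _, Set.BijOn _ (hypSegment (faceVertex n l) (faceVertex n ((j + 1).val : ℤ))) e
    rw [e]
    obtain ⟨g', hg'⟩ := exists_tessEdge_eq (x := x) hn (sector x i g l) (sideAfter i l)
    refine ⟨_, ⟨g', sideAfter i l, rfl⟩, ?_⟩
    have himage : star x n i g '' hypSegment (faceVertex n l) (faceVertex n (l + 1)) =
        tessEdge x n g' (sideAfter i l) := by
      rw [hypSegment_faceVertex hn i l, hg', ← sector_succ hS.mul_eq_one, Set.image_union,
        Set.image_image, Set.image_image]
      congr 1
      · exact Set.image_congr fun p hp =>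
          hS.star_place i g l ((mem_triSpoke_iff hn).1 hp).1
      · exact Set.image_congr fun p hp =>
          hS.star_place i g (l + 1) ((mem_triSpoke_iff hn).1 hp).1
    rw [← himage]
    exact ((hS.injOn_star i g).mono ((hconv _ (faceVertex_mem n hn l) _
      (faceVertex_mem n hn (l + 1))).trans hsub)).bijOn_image

end IsTriangleSystem

end Faces

/-! ### Barycentric parametrization of the triangle -/

section Simplex

variable {n : ℕ}

/-- The point of the triangle with the given weights in the Klein model. -/
noncomputable def simplexPoint (n : ℕ) (w : ZMod 3 → ℝ) : ℍ :=
  unklein (∑ i, w i • klein (triVertex n i))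

theorem sum_klein_mem_ball (n : ℕ) {w : ZMod 3 → ℝ} (hw : w ∈ stdSimplex ℝ (ZMod 3)) :
    ∑ i, w i • klein (triVertex n i) ∈ Metric.ball (0 : ℂ) 1 :=
  (convex_ball (0 : ℂ) 1).sum_mem (fun i _ => hw.1 i) hw.2 fun _ _ => klein_mem_ball _

theorem klein_simplexPoint {w : ZMod 3 → ℝ} (hw : w ∈ stdSimplex ℝ (ZMod 3)) :
    klein (simplexPoint n w) = ∑ i, w i • klein (triVertex n i) :=
  klein_unklein (normSq_lt_one_of_mem_ball (sum_klein_mem_ball n hw))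

theorem continuousOn_simplexPoint (n : ℕ) :
    ContinuousOn (simplexPoint n) (stdSimplex ℝ (ZMod 3)) :=
  continuousOn_unklein.comp (by fun_prop) fun _ hw => sum_klein_mem_ball n hw

theorem bary_simplexPoint {w : ZMod 3 → ℝ} (hw : w ∈ stdSimplex ℝ (ZMod 3)) (i : ZMod 3) :
    bary n i (simplexPoint n w) = 3 * sh n * hypTime (simplexPoint n w) * w i := by
  have hC := (ch_pos n).ne'
  have h3 := sqrt_three_sq
  have hsum := hw.2
  rw [sum_zmod3] at hsum
  obtain ⟨a0, a1, a2⟩ := hyp_triVertex_zero n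
  obtain ⟨b0, b1, b2⟩ := hyp_triVertex_one n
  obtain ⟨c0, c1, c2⟩ := hyp_triVertex_two n
  have hk := klein_simplexPoint (n := n) hw
  rw [sum_zmod3] at hk
  have hre := congrArg Complex.re hk
  have him := congrArg Complex.im hk
  simp only [Complex.add_re, Complex.add_im, Complex.smul_re, Complex.smul_im, smul_eq_mul] at hre him
  rw [klein_re (triVertex n 0), klein_re (triVertex n 1), klein_re (triVertex n 2), a0, a1, b0, b1,
    c0, c1] at hre
  rw [klein_im (triVertex n 0), klein_im (triVertex n 1), klein_im (triVertex n 2), a0, a2, b0, b2,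
    c0, c2] at him
  have h1 := hypTime_mul_re (simplexPoint n w)
  have h2 := hypTime_mul_im (simplexPoint n w)
  set T := hypTime (simplexPoint n w) with hT
  rw [hre] at h1
  rw [him] at h2
  have hw0 : w 0 = 1 - w 1 - w 2 := by linarith
  revert i
  rw [forall_zmod3]
  refine ⟨?_, ?_, ?_⟩
  · change sh n * T + 2 * ch n * hypFst _ = _
    rw [← h1, hw0]
    field_simp
    ring
  · change sh n * T - ch n * hypFst _ + √3 * ch n * hypSnd _ = _
    rw [← h1, ← h2, hw0]
    field_simp
    linear_combination T * sh n * (w 1 - w 2) * h3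
  · change sh n * T - ch n * hypFst _ - √3 * ch n * hypSnd _ = _
    rw [← h1, ← h2, hw0]
    field_simp
    linear_combination T * sh n * (w 2 - w 1) * h3

theorem bary_simplexPoint_pos_iff (hn : 4 ≤ n) {w : ZMod 3 → ℝ} (hw : w ∈ stdSimplex ℝ (ZMod 3))
    (i : ZMod 3) : 0 < bary n i (simplexPoint n w) ↔ 0 < w i := by
  have := sh_pos hn
  have := hypTime_pos (simplexPoint n w)
  rw [bary_simplexPoint hw]
  exact mul_pos_iff_of_pos_left (by positivity)

theorem bary_simplexPoint_eq_zero_iff (hn : 4 ≤ n) {w : ZMod 3 → ℝ}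
    (hw : w ∈ stdSimplex ℝ (ZMod 3)) (i : ZMod 3) :
    bary n i (simplexPoint n w) = 0 ↔ w i = 0 := by
  have := sh_pos hn
  have := hypTime_pos (simplexPoint n w)
  rw [bary_simplexPoint hw, mul_eq_zero, or_iff_right (by positivity)]

theorem simplexPoint_mem (hn : 4 ≤ n) {w : ZMod 3 → ℝ} (hw : w ∈ stdSimplex ℝ (ZMod 3)) :
    simplexPoint n w ∈ triangle n := by
  rw [mem_triangle_iff hn]
  intro i
  have := sh_pos hn
  have := hypTime_pos (simplexPoint n w)
  have := hw.1 i
  rw [bary_simplexPoint hw]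
  positivity

theorem exists_simplexPoint_eq (hn : 4 ≤ n) {p : ℍ} (hp : p ∈ triangle n) :
    ∃ w ∈ stdSimplex ℝ (ZMod 3), simplexPoint n w = p := by
  have hs := sh_pos hn
  have hT := hypTime_pos p
  refine ⟨fun i => bary n i p / (3 * sh n * hypTime p), ⟨fun i => ?_, ?_⟩, ?_⟩
  · have := (mem_triangle_iff hn).1 hp i
    positivity
  · have := sum_bary n 0 p
    have e : (0 : ZMod 3) + 1 = 1 ∧ (0 : ZMod 3) + 2 = 2 := by decide
    rw [e.1, e.2] at this
    rw [sum_zmod3, ← add_div, ← add_div, this]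
    exact div_self (by positivity)
  · rw [simplexPoint, ← klein_eq_sum hn, unklein_klein]

theorem injOn_simplexPoint (hn : 4 ≤ n) :
    Set.InjOn (simplexPoint n) (stdSimplex ℝ (ZMod 3)) := by
  intro w hw w' hw' h
  have hs := sh_pos hn
  have hT := hypTime_pos (simplexPoint n w)
  funext i
  have h1 := bary_simplexPoint (n := n) hw i
  have h2 := bary_simplexPoint (n := n) hw' i
  rw [← h, h1] at h2
  exact mul_left_cancel₀ (by positivity) h2

/-- `W` takes the closed unit ball (for the maximum norm) homeomorphically to the face of the
standard triangle which is spanned by the vertices in `F`, and the open ball to the interior of this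
face. -/
def IsSimplexChart (d : ℕ) (F : Finset (ZMod 3)) (W : (Fin d → ℝ) → ZMod 3 → ℝ) : Prop :=
  ContinuousOn W (Metric.closedBall 0 1) ∧ Set.InjOn W (Metric.closedBall 0 1) ∧
  W '' Metric.closedBall 0 1 = {w | w ∈ stdSimplex ℝ (ZMod 3) ∧ ∀ i, i ∉ F → w i = 0} ∧
  W '' Metric.ball 0 1 = {w | w ∈ stdSimplex ℝ (ZMod 3) ∧ ∀ i, 0 < w i ↔ i ∈ F}

theorem isSimplexChart_vertex (i : ZMod 3) : IsSimplexChart 0 {i} fun _ => Pi.single i 1 := by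
  have hc : Metric.closedBall (0 : Fin 0 → ℝ) 1 = {0} :=
    Set.eq_singleton_iff_unique_mem.2 ⟨by simp, fun _ _ => Subsingleton.elim _ _⟩
  have hb : Metric.ball (0 : Fin 0 → ℝ) 1 = {0} :=
    Set.eq_singleton_iff_unique_mem.2 ⟨by simp, fun _ _ => Subsingleton.elim _ _⟩
  have hmem : (Pi.single i 1 : ZMod 3 → ℝ) ∈ stdSimplex ℝ (ZMod 3) := single_mem_stdSimplex ℝ i
  have huniq : ∀ w : ZMod 3 → ℝ, w ∈ stdSimplex ℝ (ZMod 3) → (∀ j, j ∉ ({i} : Finset (ZMod 3)) →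
      w j = 0) → w = Pi.single i 1 := by
    intro w hw h
    have hs := hw.2
    rw [Finset.sum_eq_single i (fun j _ hj => h j (by simpa using hj)) (by simp)] at hs
    funext j
    by_cases hj : j = i
    · rw [hj, hs, Pi.single_eq_same]
    · rw [h j (by simpa using hj), Pi.single_eq_of_ne hj]
  refine ⟨continuousOn_const, hc ▸ Set.injOn_singleton _ _, ?_, ?_⟩
  · rw [hc, Set.image_singleton]
    ext w
    constructor
    · rintro rfl
      exact ⟨hmem, fun j hj => Pi.single_eq_of_ne (by simpa using hj) _⟩
    · exact fun hw => huniq w hw.1 hw.2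
  · rw [hb, Set.image_singleton]
    ext w
    constructor
    · rintro rfl
      refine ⟨hmem, fun j => ?_⟩
      by_cases hj : j = i
      · simp [hj]
      · rw [Pi.single_eq_of_ne hj, Finset.mem_singleton]
        exact ⟨fun h => absurd h (lt_irrefl _), fun h => absurd h hj⟩
    · exact fun hw => huniq w hw.1 fun j hj =>
        le_antisymm (not_lt.1 fun h => hj ((hw.2 j).1 h)) (hw.1.1 j)

theorem isSimplexChart_side (i : ZMod 3) : IsSimplexChart 1 {i}ᶜ fun y j =>
    if j = i + 1 then (1 - y 0) / 2 else if j = i + 2 then (1 + y 0) / 2 else 0 := by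
  have hc : ∀ y : Fin 1 → ℝ, y ∈ Metric.closedBall 0 1 ↔ |y 0| ≤ 1 := by
    intro y
    rw [mem_closedBall_zero_iff, pi_norm_le_iff_of_nonneg zero_le_one]
    simp
  have hb : ∀ y : Fin 1 → ℝ, y ∈ Metric.ball 0 1 ↔ |y 0| < 1 := by
    intro y
    rw [mem_ball_zero_iff, pi_norm_lt_iff zero_lt_one]
    simp
  have hd : ∀ i : ZMod 3, i ≠ i + 1 ∧ i ≠ i + 2 ∧ i + 1 ≠ i ∧ i + 2 ≠ i ∧ i + 2 ≠ i + 1 := by decide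
  obtain ⟨d1, d2, d3, d4, d5⟩ := hd i
  have hsum : ∀ (i : ZMod 3) (f : ZMod 3 → ℝ), ∑ j, f j = f i + f (i + 1) + f (i + 2) := by
    intro i f
    rw [sum_zmod3]
    revert i
    rw [forall_zmod3]
    refine ⟨rfl, ?_, ?_⟩
    · change _ = f 1 + f 2 + f 0
      ring
    · change _ = f 2 + f 0 + f 1
      ring
  set W : (Fin 1 → ℝ) → ZMod 3 → ℝ := fun y j =>
    if j = i + 1 then (1 - y 0) / 2 else if j = i + 2 then (1 + y 0) / 2 else 0 with hW
  have w0 : ∀ y, W y i = 0 := fun y => by simp only [hW, if_neg d1, if_neg d2]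
  have w1 : ∀ y, W y (i + 1) = (1 - y 0) / 2 := fun y => by simp only [hW, if_true]
  have w2 : ∀ y, W y (i + 2) = (1 + y 0) / 2 := fun y => by simp only [hW, if_neg d5, if_true]
  have hmem : ∀ y ∈ Metric.closedBall (0 : Fin 1 → ℝ) 1, W y ∈ stdSimplex ℝ (ZMod 3) := by
    intro y hy
    rw [hc, abs_le] at hy
    refine ⟨(forall_zmod3' i).2 ⟨?_, ?_, ?_⟩, ?_⟩
    · rw [w0]
    · rw [w1]; linarith
    · rw [w2]; linarith
    · rw [hsum i, w0, w1, w2]; ring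
  have hex : ∀ w ∈ stdSimplex ℝ (ZMod 3), w i = 0 →
      ∃ y, y 0 = w (i + 2) - w (i + 1) ∧ W y = w := by
    intro w hw h0
    obtain ⟨y, hy⟩ : ∃ y : Fin 1 → ℝ, y 0 = w (i + 2) - w (i + 1) := ⟨fun _ => _, rfl⟩
    refine ⟨y, hy, ?_⟩
    have h1 := hw.2
    rw [hsum i, h0] at h1
    rw [funext_iff, forall_zmod3' i, w0, w1, w2, h0, hy]
    exact ⟨rfl, by linarith, by linarith⟩
  refine ⟨?_, fun y _ y' _ h => ?_, ?_, ?_⟩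
  · refine (continuous_pi fun j => ?_).continuousOn
    simp only [hW]
    split_ifs <;> fun_prop
  · have h2 := congrFun h (i + 2)
    rw [w2, w2] at h2
    funext l
    rw [Subsingleton.elim l 0]
    linarith
  · ext w
    constructor
    · rintro ⟨y, hy, rfl⟩
      refine ⟨hmem y hy, fun j hj => ?_⟩
      obtain rfl : j = i := by simpa using hj
      exact w0 y
    · rintro ⟨hw, h⟩
      have h0 : w i = 0 := h i (by simp)
      obtain ⟨y, hy, rfl⟩ := hex w hw h0
      refine ⟨y, ?_, rfl⟩
      have h1 := hw.2
      rw [hsum i, h0] at h1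
      have h2 := hw.1 (i + 1)
      have h3 := hw.1 (i + 2)
      rw [hc, hy, abs_le]
      constructor <;> linarith
  · ext w
    constructor
    · rintro ⟨y, hy, rfl⟩
      refine ⟨hmem y (Metric.ball_subset_closedBall hy), ?_⟩
      rw [hb, abs_lt] at hy
      rw [forall_zmod3' i, w0, w1, w2]
      refine ⟨by simp, ?_, ?_⟩
      · simp only [Finset.mem_compl, Finset.mem_singleton, d3, not_false_eq_true, iff_true]
        linarith
      · simp only [Finset.mem_compl, Finset.mem_singleton, d4, not_false_eq_true, iff_true]
        linarith
    · rintro ⟨hw, h⟩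
      have h0 : w i = 0 := le_antisymm (not_lt.1 fun h' => absurd ((h i).1 h') (by simp)) (hw.1 i)
      obtain ⟨y, hy, rfl⟩ := hex w hw h0
      refine ⟨y, ?_, rfl⟩
      have h1 := hw.2
      rw [hsum i, h0] at h1
      have h2 := (h (i + 1)).2 (by simp)
      have h3 := (h (i + 2)).2 (by simpa using d4)
      rw [hb, hy, abs_lt]
      constructor <;> linarith

theorem exists_isSimplexChart_univ : ∃ W, IsSimplexChart 2 Finset.univ W := by
  set s : Set (Fin 2 → ℝ) := {y | 0 ≤ y 0 ∧ 0 ≤ y 1 ∧ y 0 + y 1 ≤ 1} with hs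
  have hmem : ∀ y, y ∈ s ↔ 0 ≤ y 0 ∧ 0 ≤ y 1 ∧ y 0 + y 1 ≤ 1 := fun _ => Iff.rfl
  have hcl : IsClosed s := by
    have h : ∀ j : Fin 2, Continuous fun y : Fin 2 → ℝ => y j := fun j => continuous_apply j
    exact (isClosed_le continuous_const (h 0)).inter
      ((isClosed_le continuous_const (h 1)).inter (isClosed_le ((h 0).add (h 1)) continuous_const))
  have hint : interior s = {y | 0 < y 0 ∧ 0 < y 1 ∧ y 0 + y 1 < 1} := by
    apply Set.Subset.antisymm
    · intro y hy
      have hc : Filter.Tendsto (fun ε : ℝ => fun j => y j + ε) (nhds 0) (nhds y) := by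
        have : Continuous fun ε : ℝ => fun j => y j + ε := by fun_prop
        simpa using this.tendsto 0
      obtain ⟨ε, hε, h⟩ := Metric.eventually_nhds_iff.1
        (hc.eventually (mem_interior_iff_mem_nhds.1 hy))
      have h1 := h (y := ε / 2) (by rw [dist_zero_right, Real.norm_eq_abs, abs_of_pos] <;> linarith)
      have h2 := h (y := -(ε / 2)) (by
        rw [dist_zero_right, norm_neg, Real.norm_eq_abs, abs_of_pos] <;> linarith)
      obtain ⟨-, -, h1⟩ : _ ∧ _ ∧ y 0 + ε / 2 + (y 1 + ε / 2) ≤ 1 := h1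
      obtain ⟨h3, h4, -⟩ : 0 ≤ y 0 + -(ε / 2) ∧ 0 ≤ y 1 + -(ε / 2) ∧ _ := h2
      refine ⟨?_, ?_, ?_⟩ <;> linarith
    · have h : ∀ j : Fin 2, Continuous fun y : Fin 2 → ℝ => y j := fun j => continuous_apply j
      refine interior_maximal (fun y hy => ⟨hy.1.le, hy.2.1.le, hy.2.2.le⟩) ?_
      exact (isOpen_lt continuous_const (h 0)).inter
        ((isOpen_lt continuous_const (h 1)).inter (isOpen_lt ((h 0).add (h 1)) continuous_const))
  have hconv : Convex ℝ s := by
    rintro y ⟨a1, a2, a3⟩ y' ⟨b1, b2, b3⟩ a b ha hb hab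
    refine ⟨?_, ?_, ?_⟩
    · change 0 ≤ a * y 0 + b * y' 0
      positivity
    · change 0 ≤ a * y 1 + b * y' 1
      positivity
    · change a * y 0 + b * y' 0 + (a * y 1 + b * y' 1) ≤ 1
      nlinarith
  have hbdd : Bornology.IsBounded s := by
    refine (Metric.isBounded_closedBall (x := (0 : Fin 2 → ℝ)) (r := 1)).subset fun y hy => ?_
    obtain ⟨h1, h2, h3⟩ := hy
    rw [mem_closedBall_zero_iff, pi_norm_le_iff_of_nonneg zero_le_one]
    intro j
    fin_cases j
    · change |y 0| ≤ 1
      rw [abs_of_nonneg h1]; linarith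
    · change |y 1| ≤ 1
      rw [abs_of_nonneg h2]; linarith
  obtain ⟨h, h1, h2, -⟩ := exists_homeomorph_image_interior_closure_frontier_eq_unitBall hconv
    ⟨fun _ => 1 / 3, by rw [hint]; refine ⟨?_, ?_, ?_⟩ <;> norm_num⟩ hbdd
  rw [hcl.closure_eq] at h2
  have h1' : h.symm '' Metric.ball 0 1 = interior s := by
    rw [← h1, ← Set.image_comp, h.symm_comp_self, Set.image_id]
  have h2' : h.symm '' Metric.closedBall 0 1 = s := by
    rw [← h2, ← Set.image_comp, h.symm_comp_self, Set.image_id]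
  set A : (Fin 2 → ℝ) → ZMod 3 → ℝ := fun y j =>
    if j = 0 then y 0 else if j = 1 then y 1 else 1 - y 0 - y 1 with hA
  have a0 : ∀ y, A y 0 = y 0 := fun _ => rfl
  have a1 : ∀ y, A y 1 = y 1 := fun _ => rfl
  have a2 : ∀ y, A y 2 = 1 - y 0 - y 1 := fun _ => rfl
  have hAc : Continuous A := by
    refine continuous_pi fun j => ?_
    simp only [hA]
    split_ifs <;> fun_prop
  have hAs : ∀ y, A y ∈ stdSimplex ℝ (ZMod 3) ↔ y ∈ s := by
    intro y
    rw [stdSimplex, Set.mem_ofPred_eq, forall_zmod3, sum_zmod3, a0, a1, a2, hmem]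
    constructor
    · rintro ⟨⟨b0, b1, b2⟩, -⟩
      exact ⟨b0, b1, by linarith⟩
    · rintro ⟨b0, b1, b2⟩
      exact ⟨⟨b0, b1, by linarith⟩, by ring⟩
  have hAe : ∀ w ∈ stdSimplex ℝ (ZMod 3), ∃ y, y 0 = w 0 ∧ y 1 = w 1 ∧ A y = w := by
    intro w hw
    obtain ⟨y, h0, h1⟩ : ∃ y : Fin 2 → ℝ, y 0 = w 0 ∧ y 1 = w 1 := ⟨![w 0, w 1], rfl, rfl⟩
    refine ⟨y, h0, h1, ?_⟩
    have hs := hw.2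
    rw [sum_zmod3] at hs
    rw [funext_iff, forall_zmod3, a0, a1, a2, h0, h1]
    exact ⟨rfl, rfl, by linarith⟩
  refine ⟨fun y => A (h.symm y), (hAc.comp h.symm.continuous).continuousOn, fun y _ y' _ he => ?_,
    ?_, ?_⟩
  · refine h.symm.injective (funext fun j => ?_)
    fin_cases j
    · exact congrFun he 0
    · exact congrFun he 1
  · rw [← Set.image_image A, h2']
    ext w
    constructor
    · rintro ⟨y, hy, rfl⟩
      exact ⟨(hAs y).2 hy, fun j hj => absurd (Finset.mem_univ j) hj⟩
    · rintro ⟨hw, -⟩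
      obtain ⟨y, -, -, rfl⟩ := hAe w hw
      exact ⟨y, (hAs y).1 hw, rfl⟩
  · rw [← Set.image_image A, h1', hint]
    ext w
    constructor
    · rintro ⟨y, ⟨b0, b1, b2⟩, rfl⟩
      refine ⟨(hAs y).2 ⟨b0.le, b1.le, b2.le⟩, ?_⟩
      rw [forall_zmod3, a0, a1, a2]
      simp only [Finset.mem_univ, iff_true]
      exact ⟨b0, b1, by linarith⟩
    · rintro ⟨hw, hpos⟩
      have hs := hw.2
      rw [sum_zmod3] at hs
      have hp : ∀ j, 0 < w j := fun j => (hpos j).2 (Finset.mem_univ j)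
      obtain ⟨y, h0, h1, hy⟩ := hAe w hw
      refine ⟨y, ⟨?_, ?_, ?_⟩, hy⟩
      · rw [h0]; exact hp 0
      · rw [h1]; exact hp 1
      · rw [h0, h1]; linarith [hp 2]

end Simplex

/-! ### The triangulation as a CW structure -/

section Genus

variable {Γ : Type} [Group Γ] {x : ZMod 3 → Γ} {n : ℕ}

theorem continuousOn_of_leftInvOn {X Y : Type} [TopologicalSpace X] [TopologicalSpace Y] [T2Space Y]
    {f : X → Y} {g : Y → X} {K s : Set X} (hK : IsCompact K) (hf : ContinuousOn f K)
    (hinj : Set.InjOn f K) (hs : s ⊆ K) (hg : Set.LeftInvOn g f s) : ContinuousOn g (f '' s) := by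
  rw [continuousOn_iff_isClosed]
  intro t ht
  refine ⟨f '' (K ∩ t), ((hK.inter_right ht).image_of_continuousOn
    (hf.mono Set.inter_subset_left)).isClosed, ?_⟩
  ext b
  constructor
  · rintro ⟨hb, a, ha, rfl⟩
    rw [Set.mem_preimage, hg ha] at hb
    exact ⟨⟨a, ⟨hs ha, hb⟩, rfl⟩, a, ha, rfl⟩
  · rintro ⟨⟨a, ha, hab⟩, a', ha', rfl⟩
    obtain rfl := hinj ha.1 (hs ha') hab
    refine ⟨?_, a, ha', rfl⟩
    rw [Set.mem_preimage, hg ha']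
    exact ha.2

/-- The cells of the triangulation: the vertices are labelled by cosets, the sides by the white
triangle to which they belong. -/
def TriCell (x : ZMod 3 → Γ) : ℕ → Type
  | 0 => Σ i : ZMod 3, Γ ⧸ Subgroup.zpowers (x i)
  | 1 => Γ × ZMod 3
  | 2 => Γ × Colour
  | _ => Empty

/-- The vertices of the standard triangle which span a cell. -/
def TriCell.face : (d : ℕ) → TriCell x d → Finset (ZMod 3)
  | 0, c => {c.1}
  | 1, c => {c.2}ᶜ
  | 2, _ => Finset.univ
  | _ + 3, c => nomatch c

/-- A triangle to which a cell belongs. -/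
noncomputable def TriCell.label : (d : ℕ) → TriCell x d → Γ × Colour
  | 0, c => (c.2.out, Colour.white)
  | 1, c => (c.1, Colour.white)
  | 2, c => c
  | _ + 3, c => nomatch c

theorem TriCell.card_face : ∀ (d : ℕ) (c : TriCell x d), (face d c).card = d + 1
  | 0, _ => Finset.card_singleton _
  | 1, c => by
    change ({c.2}ᶜ : Finset (ZMod 3)).card = 2
    rw [Finset.card_compl, Finset.card_singleton]
    rfl
  | 2, _ => rfl
  | _ + 3, c => nomatch c

theorem TriCell.exists_chart : ∀ (d : ℕ) (c : TriCell x d), ∃ W, IsSimplexChart d (face d c) W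
  | 0, _ => ⟨_, isSimplexChart_vertex _⟩
  | 1, _ => ⟨_, isSimplexChart_side _⟩
  | 2, _ => exists_isSimplexChart_univ
  | _ + 3, c => nomatch c

/-- The parametrization of a cell by weights. -/
noncomputable def TriCell.chart (d : ℕ) (c : TriCell x d) : (Fin d → ℝ) → ZMod 3 → ℝ :=
  (exists_chart d c).choose

theorem TriCell.isSimplexChart (d : ℕ) (c : TriCell x d) :
    IsSimplexChart d (face d c) (chart d c) := (exists_chart d c).choose_spec

theorem TriCell.chart_mem {d : ℕ} (c : TriCell x d) {y : Fin d → ℝ}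
    (hy : y ∈ Metric.closedBall 0 1) : chart d c y ∈ stdSimplex ℝ (ZMod 3) := by
  have : chart d c y ∈ chart d c '' Metric.closedBall 0 1 := ⟨y, hy, rfl⟩
  rw [(isSimplexChart d c).2.2.1] at this
  exact this.1

/-- The characteristic map of a cell. -/
noncomputable def TriCell.map (n d : ℕ) (c : TriCell x d) (y : Fin d → ℝ) : GluedSurface x n :=
  pt x n (label d c) (simplexPoint n (chart d c y))

theorem TriCell.continuousOn_map (hn : 4 ≤ n) {d : ℕ} (c : TriCell x d) :
    ContinuousOn (map n d c) (Metric.closedBall 0 1) := by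
  refine (continuousOn_pt (label d c)).comp ((continuousOn_simplexPoint n).comp
    (isSimplexChart d c).1 fun y hy => c.chart_mem hy) fun y hy => ?_
  exact simplexPoint_mem hn (c.chart_mem hy)

theorem TriCell.injOn_map (hn : 4 ≤ n) {d : ℕ} (c : TriCell x d) :
    Set.InjOn (map n d c) (Metric.closedBall 0 1) := by
  intro y hy y' hy' h
  have h1 := (eq_of_pt_eq hn (simplexPoint_mem hn (c.chart_mem hy))
    (simplexPoint_mem hn (c.chart_mem hy')) h).1
  exact (isSimplexChart d c).2.1 hy hy' (injOn_simplexPoint hn (c.chart_mem hy) (c.chart_mem hy') h1)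

theorem TriCell.image_closedBall (hn : 4 ≤ n) {d : ℕ} (c : TriCell x d) :
    map n d c '' Metric.closedBall 0 1 =
      pt x n (label d c) '' {p | p ∈ triangle n ∧ ∀ i, i ∉ face d c → bary n i p = 0} := by
  ext a
  constructor
  · rintro ⟨y, hy, rfl⟩
    have h : chart d c y ∈ chart d c '' Metric.closedBall 0 1 := ⟨y, hy, rfl⟩
    rw [(isSimplexChart d c).2.2.1] at h
    exact ⟨_, ⟨simplexPoint_mem hn h.1, fun i hi =>
      (bary_simplexPoint_eq_zero_iff hn h.1 i).2 (h.2 i hi)⟩, rfl⟩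
  · rintro ⟨p, ⟨hp, h⟩, rfl⟩
    obtain ⟨w, hw, rfl⟩ := exists_simplexPoint_eq hn hp
    have : w ∈ chart d c '' Metric.closedBall 0 1 := by
      rw [(isSimplexChart d c).2.2.1]
      exact ⟨hw, fun i hi => (bary_simplexPoint_eq_zero_iff hn hw i).1 (h i hi)⟩
    obtain ⟨y, hy, rfl⟩ := this
    exact ⟨y, hy, rfl⟩

theorem TriCell.image_ball (hn : 4 ≤ n) {d : ℕ} (c : TriCell x d) :
    map n d c '' Metric.ball 0 1 =
      pt x n (label d c) '' {p | p ∈ triangle n ∧ ∀ i, 0 < bary n i p ↔ i ∈ face d c} := by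
  ext a
  constructor
  · rintro ⟨y, hy, rfl⟩
    have h : chart d c y ∈ chart d c '' Metric.ball 0 1 := ⟨y, hy, rfl⟩
    rw [(isSimplexChart d c).2.2.2] at h
    exact ⟨_, ⟨simplexPoint_mem hn h.1, fun i =>
      (bary_simplexPoint_pos_iff hn h.1 i).trans (h.2 i)⟩, rfl⟩
  · rintro ⟨p, ⟨hp, h⟩, rfl⟩
    obtain ⟨w, hw, rfl⟩ := exists_simplexPoint_eq hn hp
    have : w ∈ chart d c '' Metric.ball 0 1 := by
      rw [(isSimplexChart d c).2.2.2]
      exact ⟨hw, fun i => (bary_simplexPoint_pos_iff hn hw i).symm.trans (h i)⟩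
    obtain ⟨y, hy, rfl⟩ := this
    exact ⟨y, hy, rfl⟩

namespace IsTriangleSystem

variable (hS : IsTriangleSystem x n)
include hS

open TriCell

/-- Every point lies in the interior of a cell, whose dimension is determined by the number of
vanishing barycentric coordinates. -/
theorem exists_cell (s : Γ × Colour) {p : ℍ} (hp : p ∈ triangle n) :
    ∃ (d : ℕ) (c : TriCell x d), (∀ i, 0 < bary n i p ↔ i ∈ face d c) ∧
      pt x n (label d c) p = pt x n s p := by
  have hn := hS.four_le
  have hb := (mem_triangle_iff hn).1 hp
  have key : ∀ F : Finset (ZMod 3), F = ∅ ∨ F = Finset.univ ∨ (∃ i, F = {i}ᶜ) ∨ ∃ i, F = {i} := by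
    decide
  have hF : ∀ i, 0 < bary n i p ↔ i ∈ Finset.univ.filter fun i => 0 < bary n i p := by simp
  have hz : ∀ i, i ∉ Finset.univ.filter (fun i => 0 < bary n i p) → bary n i p = 0 := fun i hi =>
    le_antisymm (not_lt.1 fun h => hi ((hF i).1 h)) (hb i)
  rcases key (Finset.univ.filter fun i => 0 < bary n i p) with h | h | ⟨i, h⟩ | ⟨i, h⟩ <;>
    rw [h] at hF hz
  · have := sum_bary_pos hn 0 p
    rw [hz _ (by simp), hz _ (by simp), hz _ (by simp)] at this
    norm_num at this
  · exact ⟨2, s, hF, rfl⟩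
  · have h0 : bary n i p = 0 := hz i (by simp)
    obtain ⟨g, _ | _⟩ := s
    · exact ⟨1, (g, i), hF, rfl⟩
    · exact ⟨1, (g * (crossing x i)⁻¹, i), hF, pt_across hn hp h0 (g, Colour.black)⟩
  · have hd : ∀ i : ZMod 3, i + 1 ≠ i ∧ i + 2 ≠ i := by decide
    have h1 : bary n (i + 1) p = 0 := hz _ (by simp [(hd i).1])
    have h2 : bary n (i + 2) p = 0 := hz _ (by simpa using (hd i).2)
    obtain ⟨g, j, rfl⟩ := exists_sector_eq (x := x) i s
    refine ⟨0, ⟨i, QuotientGroup.mk g⟩, hF, ?_⟩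
    obtain ⟨⟨_, a, rfl⟩, ha⟩ := QuotientGroup.mk_out_eq_mul (Subgroup.zpowers (x i)) g
    change pt x n (Quotient.out (QuotientGroup.mk g), Colour.white) p = _
    rw [ha, hS.pt_sector_eq_zero i g hp h1 h2 j, ← hS.pt_sector_eq_zero i g hp h1 h2 (2 * a),
      sector_even]

/-- The interiors of two cells are disjoint. -/
theorem cell_unique {d d' : ℕ} {c : TriCell x d} {c' : TriCell x d'} {p q : ℍ}
    (hp : p ∈ triangle n) (hq : q ∈ triangle n) (hc : ∀ i, 0 < bary n i p ↔ i ∈ face d c)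
    (hc' : ∀ i, 0 < bary n i q ↔ i ∈ face d' c')
    (h : pt x n (label d c) p = pt x n (label d' c') q) :
    (⟨d, c⟩ : Σ d, TriCell x d) = ⟨d', c'⟩ := by
  have hn := hS.four_le
  obtain ⟨rfl, hP⟩ := eq_of_pt_eq hn hp hq h
  have hface : face d c = face d' c' := Finset.ext fun i => (hc i).symm.trans (hc' i)
  obtain rfl : d = d' := by
    have h1 := card_face d c
    have h2 := card_face d' c'
    rw [hface] at h1
    omega
  congr 1
  have hmem : ∀ l, bary n l p = 0 → l ∉ face d c := fun l hl hl' => by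
    have := (hc l).2 hl'
    rw [hl] at this
    exact lt_irrefl _ this
  match d, c, c' with
  | 0, ⟨i, c⟩, ⟨i', c'⟩ =>
    obtain rfl : i = i' := Finset.singleton_injective hface
    have hd : ∀ i l : ZMod 3, l ≠ i → l = i + 1 ∨ l = i + 2 := by decide
    -- Only the triangles around the vertex contain it, and they determine its coset.
    have := hP (fun u => ∃ k, sector x i c.out k = u) ?_ ⟨2 * 0, by
      rw [sector_even, zpow_zero, mul_one]; rfl⟩
    · obtain ⟨k, hk⟩ := this
      change sector x i c.out k = (c'.out, Colour.white) at hk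
      have hk' : sector x i c'.out (2 * 0) = (c'.out, Colour.white) := by
        rw [sector_even, zpow_zero, mul_one]
      obtain ⟨a, ha⟩ := exists_zpow_of_sector_eq (hk.trans hk'.symm)
      have : c = c' := by
        rw [← QuotientGroup.out_eq' c, ← QuotientGroup.out_eq' c', QuotientGroup.eq, ha,
          inv_mul_cancel_left]
        exact ⟨a, rfl⟩
      rw [this]
    · rintro l hl _ ⟨k, rfl⟩
      have hl' := hd i l fun h => hmem l hl (Finset.mem_singleton.2 h)
      by_cases hls : l = sideAfter i k
      · exact ⟨k + 1, by rw [hls, sector_succ hS.mul_eq_one]⟩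
      · have : l = sideAfter i (k - 1) := by
          unfold sideAfter at hls ⊢
          by_cases hk : Even k
          · rw [if_pos hk] at hls
            rw [if_neg (by simpa [Int.even_sub_one] using hk)]
            exact hl'.resolve_left hls
          · rw [if_neg hk] at hls
            rw [if_pos (by simpa [Int.even_sub_one] using hk)]
            exact hl'.resolve_right hls
        refine ⟨k - 1, ?_⟩
        have h2 := sector_succ hS.mul_eq_one i c.out (k - 1)
        rw [sub_add_cancel] at h2
        rw [this, h2, across_across]
  | 1, ⟨g, i⟩, ⟨g', i'⟩ =>
    obtain rfl : i = i' := Finset.singleton_injective (compl_injective hface)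
    -- A point inside a side lies only in the two triangles with this side, one of which is white.
    have := hP (fun u => u = (g, Colour.white) ∨ u = across x i (g, Colour.white)) ?_ (Or.inl rfl)
    · rcases this with h | h
      · exact congrArg (fun u : Γ × Colour => ((u.1, i) : Γ × ZMod 3)) h.symm
      · cases congrArg Prod.snd h
    · intro l hl u hu
      obtain rfl : l = i := by
        by_contra h
        exact hmem l hl (by simpa [face] using h)
      rcases hu with rfl | rfl
      · exact Or.inr rfl
      · exact Or.inl (across_across _ _)
  | 2, s, s' =>
    exact hP (fun u => s = u) (fun l hl => absurd (Finset.mem_univ l) (hmem l hl)) rfl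
  | _ + 3, c, _ => exact nomatch c

/-- The Euler characteristic of the triangulation determines the genus. -/
theorem hasGenus [Finite Γ] {g v : ℕ} (hv : v * n = 3 * Nat.card Γ)
    (hg : (v : ℤ) - 3 * Nat.card Γ + 2 * Nat.card Γ = 2 - 2 * (g : ℤ)) :
    HasGenus (GluedSurface x n) g := by
  have hn := hS.four_le
  have := hS.t2Space
  have hsub : ∀ d, Metric.ball (0 : Fin d → ℝ) 1 ⊆ Metric.closedBall 0 1 :=
    fun d => Metric.ball_subset_closedBall
  have hcell : ∀ (s : Γ × Colour) (p : ℍ), p ∈ triangle n → ∃ (d : ℕ) (c : TriCell x d),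
      pt x n s p ∈ map n d c '' Metric.closedBall 0 1 ∧ ∀ i, 0 < bary n i p ↔ i ∈ face d c := by
    intro s p hp
    obtain ⟨d, c, h1, h2⟩ := hS.exists_cell s hp
    refine ⟨d, c, Set.image_mono (hsub d) ?_, h1⟩
    rw [c.image_ball hn]
    exact ⟨p, ⟨hp, h1⟩, h2⟩
  refine ⟨Topology.CWComplex.mkFinite (X := GluedSurface x n) Set.univ (TriCell x)
    (fun d c => ((c.injOn_map hn).mono (hsub d)).toPartialEquiv (TriCell.map n d c)
      (Metric.ball 0 1)) ?_ ?_ ?_ ?_ ?_ ?_ ?_ ?_, ?_, ?_, ?_⟩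
  · filter_upwards [Filter.eventually_ge_atTop 3] with d hd
    obtain ⟨d, rfl⟩ := Nat.exists_eq_add_of_le' hd
    exact inferInstanceAs (IsEmpty Empty)
  · rintro (_ | _ | _ | d)
    · exact inferInstanceAs (Finite (Σ i : ZMod 3, Γ ⧸ Subgroup.zpowers (x i)))
    · exact inferInstanceAs (Finite (Γ × ZMod 3))
    · exact inferInstanceAs (Finite (Γ × Colour))
    · exact inferInstanceAs (Finite Empty)
  · intro d c
    rfl
  · exact fun d c => c.continuousOn_map hn
  · intro d c
    exact continuousOn_of_leftInvOn (isCompact_closedBall 0 1) (c.continuousOn_map hn)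
      (c.injOn_map hn) (hsub d) (((c.injOn_map hn).mono (hsub d)).leftInvOn_invFunOn)
  · rintro ⟨d, c⟩ - ⟨d', c'⟩ - hne
    refine Set.disjoint_iff_inter_eq_empty.2 (Set.not_nonempty_iff_eq_empty.1 ?_)
    rintro ⟨a, h1, h2⟩
    change a ∈ TriCell.map n d c '' _ at h1
    change a ∈ TriCell.map n d' c' '' _ at h2
    rw [c.image_ball hn] at h1
    rw [c'.image_ball hn] at h2
    obtain ⟨p, ⟨hp, hc⟩, rfl⟩ := h1
    obtain ⟨q, ⟨hq, hc'⟩, h⟩ := h2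
    exact hne (hS.cell_unique hp hq hc hc' h.symm)
  · intro d c y hy
    have hyc : y ∈ Metric.closedBall (0 : Fin d → ℝ) 1 := Metric.sphere_subset_closedBall hy
    have h1 : TriCell.map n d c y ∈ TriCell.map n d c '' Metric.closedBall 0 1 := ⟨y, hyc, rfl⟩
    have h2 : TriCell.map n d c y ∉ TriCell.map n d c '' Metric.ball 0 1 := by
      rintro ⟨y', hy', h⟩
      have := c.injOn_map hn (hsub d hy') hyc h
      rw [this, mem_ball_zero_iff] at hy'
      rw [mem_sphere_zero_iff_norm] at hy
      exact hy'.ne hy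
    rw [c.image_closedBall hn] at h1
    rw [c.image_ball hn] at h2
    obtain ⟨p, ⟨hp, hpF⟩, hpy⟩ := h1
    obtain ⟨d', c', hm, hc'⟩ := hcell (label d c) p hp
    -- A boundary point has an additional vanishing coordinate, and so lies in a smaller cell.
    have hss : face d' c' ⊂ face d c := by
      refine Finset.ssubset_iff_subset_ne.2 ⟨fun i hi => ?_, fun he => h2 ⟨p, ⟨hp, ?_⟩, hpy⟩⟩
      · by_contra h
        have := (hc' i).2 hi
        rw [hpF i h] at this
        exact lt_irrefl _ this
      · rwa [← he]
    have hlt := Finset.card_lt_card hss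
    rw [card_face, card_face] at hlt
    change TriCell.map n d c y ∈ _
    rw [← hpy]
    exact Set.mem_iUnion₂.2 ⟨d', by omega, Set.mem_iUnion.2 ⟨c', hm⟩⟩
  · refine Set.eq_univ_of_forall fun a => ?_
    obtain ⟨s, p, hp, rfl⟩ := exists_pt a
    obtain ⟨d, c, hm, -⟩ := hcell s p hp
    exact Set.mem_iUnion₂.2 ⟨d, c, hm⟩
  · rintro (_ | _ | _ | d)
    · exact inferInstanceAs (Finite (Σ i : ZMod 3, Γ ⧸ Subgroup.zpowers (x i)))
    · exact inferInstanceAs (Finite (Γ × ZMod 3))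
    · exact inferInstanceAs (Finite (Γ × Colour))
    · exact inferInstanceAs (Finite Empty)
  · intro d hd
    obtain ⟨d, rfl⟩ := Nat.exists_eq_add_of_le' (show 3 ≤ d from hd)
    exact inferInstanceAs (IsEmpty Empty)
  · change (Nat.card (Σ i : ZMod 3, Γ ⧸ Subgroup.zpowers (x i)) : ℤ) - Nat.card (Γ × ZMod 3) +
      Nat.card (Γ × Colour) = _
    have h1 : Nat.card (Σ i : ZMod 3, Γ ⧸ Subgroup.zpowers (x i)) = v :=
      mul_right_cancel₀ (by omega : n ≠ 0) (hS.card_sigma_quotient.trans hv.symm)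
    rw [h1, Nat.card_prod, Nat.card_prod, Nat.card_zmod, card_colour, ← hg]
    push_cast
    ring

end IsTriangleSystem

end Genus

end TrivalentExpanders

open TrivalentExpanders in
theorem proposition1p1 (k : ℕ) (hk : 2 ≤ k) (n : ℕ) (hn : n = Nat.log 2 k + 1) :
    -- the generators `x₀, x₁, x₃` have order `2 ^ n`
    (∀ i : ZMod 3, orderOf (gen k i) = 2 ^ n) ∧
    -- `G_k` is a finite `2`-group, of order `2 ^ N`
    ∃ N : ℕ, Nat.card (GQuot k) = 2 ^ N ∧
      -- the triangles are equilateral, with interior angles `π / ord x₀, π / ord x₁, π / ord x₃`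
      (∀ i : ZMod 3, IsRegularPolygon UpperHalfPlane.I (triVertex (orderOf (gen k 0)))
        (Real.pi / orderOf (gen k i))) ∧
      -- `S_k` is a closed orientable hyperbolic surface
      IsClosedOrientableHyperbolicSurface (Surf k) ∧
      -- its isometry group has order at least `2 ^ N`
      ((2 ^ N : ℕ) : ℕ∞) ≤ ENat.card (Surf k ≃ᵢ Surf k) ∧
      -- the numbers of vertices, edges and faces of `T_k`
      (V k).ncard = 2 ^ (N + 1) ∧
      (E k).ncard = 3 * 2 ^ N ∧
      ((F k).ncard : ℚ) = 3 * 2 ^ ((N : ℤ) - n) ∧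
      -- the faces are regular polygons
      (∀ f ∈ F k, IsRegularFace (V k) (E k) f (2 ^ (n + 1)) (2 * Real.pi / 3)) ∧
      -- the genus
      ∃ g : ℕ, HasGenus (Surf k) g ∧
        (g : ℚ) = 1 + 2 ^ ((N : ℤ) - n - 1) * (2 ^ n - 3) := by
  have hord : ∀ i : ZMod 3, orderOf (gen k i) = 2 ^ n := by
    intro i
    rw [hn]
    exact orderOf_gen (by omega) i
  have hn2 : 2 ≤ n := by
    have := Nat.log_pos (b := 2) (by norm_num) hk
    omega
  have h4 : 4 ≤ 2 ^ n := by
    calc 4 = 2 ^ 2 := by norm_num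
      _ ≤ 2 ^ n := Nat.pow_le_pow_right (by norm_num) hn2
  obtain ⟨N, hN, hNn⟩ := exists_card_GQuot (k := k) (by omega)
  have hS : IsTriangleSystem (gen k) (2 ^ n) :=
    ⟨h4, hord, gen_mul_gen_mul_gen k, closure_gen k⟩
  have : Finite (GQuot k) := finite_GQuot k
  have hpow : (2 : ℚ) ^ ((N : ℤ) - n) * 2 ^ n = 2 ^ N := by
    rw [zpow_sub₀ two_ne_zero, zpow_natCast, zpow_natCast, div_mul_cancel₀ _ (by positivity)]
  refine ⟨hord, N, hN, ?_⟩
  unfold Surf V E F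
  have h0 := hord 0
  generalize orderOf (gen k 0) = m at h0 ⊢
  subst h0
  refine ⟨fun i => ?_, hS.isClosedOrientableHyperbolicSurface, ?_, ?_, ?_, ?_, fun f hf => ?_, ?_⟩
  · rw [hord i]
    exact isRegularPolygon_triangle h4
  · rw [← hN]
    refine le_trans (le_of_eq ?_) (card_le_card_isometryEquiv (Γ := GQuot k) h4)
    exact (ENat.card_eq_coe_natCard _).symm
  · rw [hS.ncard_tessVertices, hN, pow_succ']
  · rw [hS.ncard_tessEdges, hN]
  · have h := hS.ncard_tessFaces
    rw [hN] at h
    have h' : ((tessFaces (gen k) (2 ^ n)).ncard : ℚ) * 2 ^ n = 3 * 2 ^ N := by exact_mod_cast h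
    rw [← hpow, ← mul_assoc] at h'
    exact mul_right_cancel₀ (by positivity) h'
  · rw [pow_succ']
    exact hS.isRegularFace hf
  · -- The Euler characteristic is `3 * 2 ^ (N - n) - 3 * 2 ^ N + 2 * 2 ^ N`.
    obtain ⟨d, rfl⟩ : ∃ d, N = n + 1 + d := ⟨N - (n + 1), by omega⟩
    have h3 : 3 ≤ 2 ^ n := by omega
    refine ⟨1 + 2 ^ d * (2 ^ n - 3), hS.hasGenus (v := 3 * 2 ^ (d + 1)) ?_ ?_, ?_⟩
    · rw [hN]
      ring
    · rw [hN]
      push_cast [h3]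
      ring
    · have e : ((n + 1 + d : ℕ) : ℤ) - n - 1 = (d : ℕ) := by push_cast; ring
      rw [e, zpow_natCast]
      push_cast [h3]
      ring
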